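/- Let $d\ge 1$ and let $\tilde I=[a,b]$, $a<b$, be a compact interval. For real $N$ write $C^N=C^{\lfloor N\rfloor,\,N-\lfloor N\rfloor}$ (Hölder class). For a curve $\zeta$ in $\mathbb{R}^d$ that is $C^d$ on an interval, its torsion is $\tau_\zeta(t)=|\det[\zeta'(t),\dots,\zeta^{(d)}(t)]|$; put $\Phi_\zeta(t_1,\dots,t_d)=\zeta(t_1)+\dots+\zeta(t_d)$, let $J_{\Phi_\zeta}$ be the Jacobian determinant of $\Phi_\zeta$, and let $v(t_1,\dots,t_d)=\prod_{1\le i<j\le d}(t_j-t_i)$. For $m\ge 1$ and $h\in\mathbb{R}^m$ with $h_1\le\dots\le h_m$, the offspring curve of $\gamma:\tilde I\to\mathbb{R}^d$ is $\gamma_h(t)=\frac1m\sum_{j=1}^m\gamma(t+h_j)$, and for an interval $I=[\alpha,\beta]$ put $I_h=[\alpha-h_1,\beta-h_m]$ (empty if $\alpha-h_1>\beta-h_m$); $\gamma_h$ is defined on $\tilde I_h$, and only those $h$ are considered for which $h_m-h_1<b-a$, i.e. $\tilde I_h$ has more than one point. Write $\tau=\tau_\gamma$ and $\tau_h=\tau_{\gamma_h}$.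 **Theorem.** There are constants $c,C>0$ depending only on $d$ and $\tilde I$ such that the following holds. For every $\gamma:\tilde I\to\mathbb{R}^d$ there are $k_0\in\mathbb{Z}$ and $C_\gamma\in\mathbb{R}$ with $k_0+C_\gamma>0$, depending only on $\gamma$, $d$ and $\tilde I$, such that for every real $N>d$ with $\gamma\in C^N(\tilde I;\mathbb{R}^d)$ there are a constant $C_{N,\gamma}>0$, integers $N_k\ge 0$ and compact intervals $I_{k,l}$ ($k\in\mathbb{Z}$, $k\ge k_0$, $1\le l\le N_k$) with $$\tilde I=\{t\in\tilde I:\tau(t)=0\}\cup\bigcup_{k\ge k_0}\bigcup_{l=1}^{N_k}I_{k,l},$$ such that for all $k\ge k_0$, $1\le l\le N_k$, all $m\ge1$ and all $h\in\mathbb{R}^m$ as above: 1. $c\,2^{-k}\le\tau_h(t)\le C\,2^{-k}$ for all $t\in(I_{k,l})_h$; 2. $\Phi_{\gamma_h}$ is injective on $\{(t_1,\dots,t_d): t_1<\dots<t_d,\ t_i\in(I_{k,l})_h\}$; 3. $|J_{\Phi_{\gamma_h}}(t_1,\dots,t_d)|\ge c\,2^{-k}|v(t_1,\dots,t_d)|$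 for all $(t_1,\dots,t_d)\in(I_{k,l})_h^d$; and such that for all $k\ge k_0$ $$N_k\le C_{N,\gamma}(k+C_\gamma)^d\,2^{k\sum_{j=1}^d\frac1{N-j}},\qquad \sum_{l=1}^{N_k}|I_{k,l}|\le C_{N,\gamma}(k+C_\gamma)^d .$$ -/

import Mathlib

/-- `γ ∈ C^N(S; ℝ^d)` for real `N`, in the sense `C^N = C^{⌊N⌋, N - ⌊N⌋}`: `γ` is `⌊N⌋` times
continuously differentiable on `S` and the derivative of order `⌊N⌋` is Hölder continuous on `S`
with exponent `N - ⌊N⌋` (which says nothing more on a compact interval if `N` is an integer). -/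
def IsClassCN {d : ℕ} (N : ℝ) (γ : ℝ → Fin d → ℝ) (S : Set ℝ) : Prop :=
  ContDiffOn ℝ (⌊N⌋₊ : ℕ) γ S ∧
    ∃ K : NNReal, HolderOnWith K (N - ⌊N⌋₊).toNNReal (iteratedDerivWithin ⌊N⌋₊ γ S) S

/-- The torsion `|det [ζ'(t), …, ζ^{(d)}(t)]|` of a curve `ζ` with domain the interval `S`. -/
noncomputable def torsion {d : ℕ} (ζ : ℝ → Fin d → ℝ) (S : Set ℝ) (t : ℝ) : ℝ :=
  |(Matrix.of fun i j : Fin d => iteratedDerivWithin (j + 1) ζ S t i).det|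

/-- The offspring curve `γ_h(t) = (1 / m) ∑_{j = 1}^m γ(t + h_j)`; here `h` has `m + 1` entries. -/
noncomputable def offspring {d m : ℕ} (γ : ℝ → Fin d → ℝ) (h : Fin (m + 1) → ℝ) (t : ℝ) :
    Fin d → ℝ :=
  ((m : ℝ) + 1)⁻¹ • ∑ j, γ (t + h j)

/-- `I_h = [a - h_1, b - h_m]` for `I = [a, b]`. -/
def shiftInterval {m : ℕ} (a b : ℝ) (h : Fin (m + 1) → ℝ) : Set ℝ :=
  Set.Icc (a - h 0) (b - h (Fin.last m))

/-- `Φ_ζ(t_1, …, t_d) = ζ(t_1) + ⋯ + ζ(t_d)`. -/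
def sumMap {d : ℕ} (ζ : ℝ → Fin d → ℝ) (t : Fin d → ℝ) : Fin d → ℝ :=
  ∑ i, ζ (t i)

/-- The Jacobian determinant at `t` of `Φ_ζ` on `S^d`, for a curve `ζ` with domain `S`. -/
noncomputable def jacobianSumMap {d : ℕ} (ζ : ℝ → Fin d → ℝ) (S : Set ℝ) (t : Fin d → ℝ) : ℝ :=
  (fderivWithin ℝ (sumMap ζ) (Set.univ.pi fun _ => S) t).det

/-! Everything reduces to mixed determinants `det [γ'(s_1), γ''(s_2), …, γ^{(d)}(s_d)]`, whose rows
are evaluated at independent points. They are linear in each row, so a mixed determinant of an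
offspring curve is an average of mixed determinants of `γ`. If the latter have one sign and modulus
about `2^{-k}` on an interval (`MixedBound`), so have the former (`MixedBound.offspring`). The
torsion is the case of equal points. The Jacobian of `Φ_ζ` is the Vandermonde determinant times a
mixed determinant, divided by a product of factorials (`exists_det_eq_vandermonde`). Injectivity
follows from the nonvanishing of the Jacobian at increasing points, by summation by parts and
Rolle's theorem (`injOn_sumMap`). It remains to find intervals on which `MixedBound` holds.

Let `W_j` be the Wronskian of the first `j` components of `γ'`. If all `W_j` vary slowly at the
scale of an interval, the mixed determinants there are comparable to `W_d`
(`exists_mixedComparable`): division by the first component lowers the dimension by one, at the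
price of a small relative error.

At a point of torsion about `2^{-k}`, Laplace expansion provides an order of the coordinates in
which every `|W_j|` is at least a multiple of `2^{-k}` (`exists_column_order`). Recording this order
and the dyadic size of each `|W_j|` splits the torsion level into `O((k + C_γ)^d)` classes. Since
`W_j` is of class `C^{N-j}`, the set where `|W_j|` is about `lam` is cut out by `O(lam^{-1/(N-j)})`
breakpoints, between which the derivatives of `W_j` are also controlled
(`HolderClass.exists_breakpoints`). Cutting further into a fixed number of equal parts makes every
`W_j` slowly varying. Each class thus costs `O(2^{k ∑ 1/(N-j)})` intervals of total length at most
`b - a`, and summation over the classes gives the two bounds. The constants `c` and `C` come from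
the comparability and the factorials alone; the dependence on `γ` and `N` enters only the counts. -/

namespace TorsionDecomp

open Set

/-! ### Jets, Rolle's theorem and its consequences -/

/-- `G 0, …, G n` are successive derivatives of each other on `I`. -/
def IsJet {E : Type*} [NormedAddCommGroup E] [NormedSpace ℝ E] (n : ℕ) (G : ℕ → ℝ → E)
    (I : Set ℝ) : Prop :=
  ∀ j < n, ∀ t ∈ I, HasDerivWithinAt (G j) (G (j + 1) t) I t

theorem IsJet.mono {E : Type*} [NormedAddCommGroup E] [NormedSpace ℝ E] {n m : ℕ}
    {G : ℕ → ℝ → E} {I J : Set ℝ} (h : IsJet n G I) (hm : m ≤ n) (hJ : J ⊆ I) : IsJet m G J :=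
  fun j hj t ht => (h j (hj.trans_le hm) t (hJ ht)).mono hJ

theorem IsJet.tail {E : Type*} [NormedAddCommGroup E] [NormedSpace ℝ E] {n : ℕ}
    {G : ℕ → ℝ → E} {I : Set ℝ} (h : IsJet (n + 1) G I) : IsJet n (fun j => G (j + 1)) I :=
  fun j hj t ht => h (j + 1) (by omega) t ht

theorem isJet_iteratedDerivWithin {E : Type*} [NormedAddCommGroup E] [NormedSpace ℝ E]
    {n : ℕ} {f : ℝ → E} {u v : ℝ} (huv : u < v)
    (hf : ContDiffOn ℝ n f (Icc u v)) :
    IsJet n (fun j => iteratedDerivWithin j f (Icc u v)) (Icc u v) := by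
  intro j hj t ht
  have h := hf.differentiableOn_iteratedDerivWithin (m := j) (by exact_mod_cast hj)
    (uniqueDiffOn_Icc huv) t ht
  have := h.hasDerivWithinAt
  rwa [← iteratedDerivWithin_succ] at this

theorem iteratedDerivWithin_Icc_subset {E : Type*} [NormedAddCommGroup E] [NormedSpace ℝ E]
    {n : ℕ} {f : ℝ → E} {u v a b : ℝ} (huv : u < v)
    (hsub : Icc u v ⊆ Icc a b) (hf : ContDiffOn ℝ n f (Icc a b)) {i : ℕ} (hi : i ≤ n)
    {t : ℝ} (ht : t ∈ Icc u v) :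
    iteratedDerivWithin i f (Icc u v) t = iteratedDerivWithin i f (Icc a b) t := by
  have hab : a < b := by
    have h1 := hsub (left_mem_Icc.2 huv.le)
    have h2 := hsub (right_mem_Icc.2 huv.le)
    linarith [h1.1, h2.2]
  rw [iteratedDerivWithin, iteratedDerivWithin, iteratedFDerivWithin_subset hsub
    (uniqueDiffOn_Icc huv) (uniqueDiffOn_Icc hab) (hf.of_le (by exact_mod_cast hi)) ht]

theorem exists_eq_mul_sub {f f' : ℝ → ℝ} {u v : ℝ}
    (hf : ∀ t ∈ Icc u v, HasDerivWithinAt f (f' t) (Icc u v) t) {x y : ℝ}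
    (hx : x ∈ Icc u v) (hy : y ∈ Icc u v) :
    ∃ ξ ∈ Icc u v, f y - f x = f' ξ * (y - x) := by
  wlog hxy : x ≤ y generalizing x y
  · obtain ⟨ξ, h1, h2⟩ := this hy hx (le_of_not_ge hxy)
    exact ⟨ξ, h1, by linarith⟩
  rcases hxy.eq_or_lt with rfl | hlt
  · exact ⟨x, hx, by simp⟩
  have hsub : Icc x y ⊆ Icc u v := Icc_subset_Icc hx.1 hy.2
  obtain ⟨c, hc, h⟩ := exists_hasDerivAt_eq_slope f f' hlt
    (fun t ht => ((hf t (hsub ht)).mono hsub).continuousWithinAt)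
    (fun t ht => (hf t (hsub (Ioo_subset_Icc_self ht))).hasDerivAt
      (Icc_mem_nhds (hx.1.trans_lt ht.1) (ht.2.trans_le hy.2)))
  refine ⟨c, hsub (Ioo_subset_Icc_self hc), ?_⟩
  rw [h, div_mul_cancel₀]
  linarith

theorem exists_deriv_zero_Ioo {f f' : ℝ → ℝ} {u v : ℝ}
    (hf : ∀ t ∈ Icc u v, HasDerivWithinAt f (f' t) (Icc u v) t) {x y : ℝ}
    (hx : x ∈ Icc u v) (hy : y ∈ Icc u v) (hxy : x < y) (h0 : f x = f y) :
    ∃ ξ ∈ Ioo x y, f' ξ = 0 := by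
  have hsub : Icc x y ⊆ Icc u v := Icc_subset_Icc hx.1 hy.2
  exact exists_hasDerivAt_eq_zero hxy
    (fun t ht => ((hf t (hsub ht)).mono hsub).continuousWithinAt) h0
    (fun t ht => (hf t (hsub (Ioo_subset_Icc_self ht))).hasDerivAt
      (Icc_mem_nhds (hx.1.trans_lt ht.1) (ht.2.trans_le hy.2)))

/-- Rolle's theorem between consecutive zeros costs one zero per derivative. -/
theorem IsJet.exists_zero {u v : ℝ} (n : ℕ) {G : ℕ → ℝ → ℝ} (hG : IsJet n G (Icc u v))
    (z : Fin (n + 1) → ℝ) (hz : StrictMono z) (hzI : ∀ i, z i ∈ Icc u v)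
    (h0 : ∀ i, G 0 (z i) = 0) : ∃ ξ ∈ Icc u v, G n ξ = 0 := by
  induction n generalizing G with
  | zero => exact ⟨z 0, hzI 0, h0 0⟩
  | succ n ih =>
    have key : ∀ i : Fin (n + 1), ∃ ξ ∈ Ioo (z i.castSucc) (z i.succ), G 1 ξ = 0 := fun i =>
      exists_deriv_zero_Ioo (hG 0 (by omega)) (hzI _) (hzI _) (hz i.castSucc_lt_succ)
        ((h0 _).trans (h0 _).symm)
    choose w hw hw0 using key
    refine ih hG.tail w (Fin.strictMono_iff_lt_succ.2 fun i => ?_) (fun i => ?_) hw0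
    · exact (hw i.castSucc).2.trans_le (by simpa using (hw i.succ).1.le)
    · exact ⟨(hzI _).1.trans (hw i).1.le, (hw i).2.le.trans (hzI _).2⟩

theorem IsJet.exists_zero_of_card {u v : ℝ} {n : ℕ} {G : ℕ → ℝ → ℝ}
    (hG : IsJet n G (Icc u v)) (Z : Finset ℝ) (hZ : n + 1 ≤ Z.card) (hZI : ∀ z ∈ Z, z ∈ Icc u v)
    (h0 : ∀ z ∈ Z, G 0 z = 0) : ∃ ξ ∈ Icc u v, G n ξ = 0 := by
  obtain ⟨W, hW, hc⟩ := Finset.exists_subset_card_eq hZ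
  refine hG.exists_zero n (W.orderEmbOfFin hc) (W.orderEmbOfFin hc).strictMono
    (fun i => hZI _ (hW (W.orderEmbOfFin_mem hc i))) (fun i => h0 _ (hW (W.orderEmbOfFin_mem hc i)))

open Polynomial in
theorem isJet_polynomial (p : ℝ[X]) (n : ℕ) (I : Set ℝ) :
    IsJet n (fun j t => (derivative^[j] p).eval t) I := by
  intro j _ t _
  simp only [Function.iterate_succ_apply']
  exact (Polynomial.hasDerivAt _ t).hasDerivWithinAt

/-- The Lagrange interpolation remainder for a function vanishing at the nodes. -/
theorem IsJet.exists_eq_prod_mul {u v : ℝ} {n : ℕ} {G : ℕ → ℝ → ℝ}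
    (hG : IsJet n G (Icc u v)) (Z : Finset ℝ) (hZ : Z.card = n) (hZI : ∀ z ∈ Z, z ∈ Icc u v)
    (h0 : ∀ z ∈ Z, G 0 z = 0) {x : ℝ} (hx : x ∈ Icc u v) :
    ∃ ξ ∈ Icc u v, G 0 x * n.factorial = (∏ z ∈ Z, (x - z)) * G n ξ := by
  classical
  by_cases hxZ : x ∈ Z
  · exact ⟨x, hx, by rw [h0 x hxZ, Finset.prod_eq_zero hxZ (by simp)]; simp⟩
  have hP : ∏ z ∈ Z, (x - z) ≠ 0 := Finset.prod_ne_zero_iff.2 fun z hz h =>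
    hxZ (by rwa [sub_eq_zero.1 h])
  set p : Polynomial ℝ := ∏ z ∈ Z, (Polynomial.X - Polynomial.C z) with hp
  set K := G 0 x / ∏ z ∈ Z, (x - z) with hK
  have hev : ∀ y, p.eval y = ∏ z ∈ Z, (y - z) := fun y => by simp [hp, Polynomial.eval_prod]
  have hjet : IsJet n (fun j t => G j t - K * ((Polynomial.derivative^[j] p).eval t)) (Icc u v) :=
    fun j hj t ht => (hG j hj t ht).sub ((isJet_polynomial p n _ j hj t ht).const_mul K)
  -- `K` is chosen so that `G 0 - K p` vanishes at `x` as well as at the nodes, which makes `n + 1`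
  -- zeros; the derivative of `p` of order `n` is the constant `n!`.
  obtain ⟨ξ, hξ, h⟩ := hjet.exists_zero_of_card (insert x Z) (by simp [hxZ, hZ])
    (by simpa using ⟨hx, hZI⟩) (by
      intro z hz
      rcases Finset.mem_insert.1 hz with rfl | hz
      · simp only [Function.iterate_zero, id, hev, hK]
        field_simp
        ring
      · simp only [Function.iterate_zero, id, hev, h0 z hz]
        rw [Finset.prod_eq_zero hz (by simp)]
        simp)
  refine ⟨ξ, hξ, ?_⟩
  have hd : Polynomial.derivative^[n] p = (n.factorial : Polynomial ℝ) := by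
    rw [hp, Polynomial.iterate_derivative_prod_X_sub_C hZ.ge, hZ]
    simp
  simp only [hd] at h
  have : G n ξ = K * n.factorial := by
    rw [Polynomial.eval_natCast] at h; linarith
  rw [this, hK]
  field_simp

/-- If a function with a Hölder continuous derivative of order `n` has `n + 1` zeros in an
interval, then it is small there. -/
theorem IsJet.abs_le_of_zeros {u v H α : ℝ} {n : ℕ} {G : ℕ → ℝ → ℝ} (hα : 0 ≤ α)
    (hG : IsJet n G (Icc u v)) (hH : 0 ≤ H)
    (hhol : ∀ x ∈ Icc u v, ∀ y ∈ Icc u v, |G n x - G n y| ≤ H * |x - y| ^ α)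
    (Z : Finset ℝ) (hZ : n + 1 ≤ Z.card) (hZI : ∀ z ∈ Z, z ∈ Icc u v)
    (h0 : ∀ z ∈ Z, G 0 z = 0) {x : ℝ} (hx : x ∈ Icc u v) :
    |G 0 x| ≤ H * (v - u) ^ ((n : ℝ) + α) := by
  have huv : u ≤ v := hx.1.trans hx.2
  have hdist : ∀ x ∈ Icc u v, ∀ y ∈ Icc u v, |x - y| ≤ v - u := fun x hx y hy =>
    abs_le.2 ⟨by linarith [hx.1, hy.2], by linarith [hx.2, hy.1]⟩
  -- Every derivative up to order `n` has a zero, so the bound descends from order `n`, each order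
  -- costing a factor `v - u`.
  have key : ∀ i ≤ n, ∀ x ∈ Icc u v, |G (n - i) x| ≤ H * (v - u) ^ α * (v - u) ^ i := by
    intro i
    induction i with
    | zero =>
      intro _ x hx
      obtain ⟨ξ, hξ, h⟩ := hG.exists_zero_of_card Z hZ hZI h0
      have := hhol x hx ξ hξ
      rw [h, sub_zero] at this
      simp only [Nat.sub_zero, pow_zero, mul_one]
      exact this.trans (by gcongr; exact hdist x hx ξ hξ)
    | succ i ih =>
      intro hi x hx
      obtain ⟨ξ, hξ, h⟩ := (hG.mono (m := n - (i + 1)) (by omega) subset_rfl).exists_zero_of_card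
        Z (by omega) hZI h0
      obtain ⟨η, hη, h'⟩ := exists_eq_mul_sub (hG (n - (i + 1)) (by omega)) hξ hx
      rw [h, sub_zero] at h'
      have e : n - (i + 1) + 1 = n - i := by omega
      rw [h', e, abs_mul, pow_succ, ← mul_assoc]
      exact mul_le_mul (ih (by omega) η hη) (hdist x hx ξ hξ) (abs_nonneg _) (by
        have := sub_nonneg.2 huv; positivity)
  have := key n le_rfl x hx
  rw [Nat.sub_self] at this
  refine this.trans ?_
  rcases huv.eq_or_lt with rfl | hlt
  · rcases Nat.eq_zero_or_pos n with rfl | hn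
    · simp
    · simp only [sub_self, zero_pow hn.ne', mul_zero]
      positivity
  · rw [Real.rpow_add (sub_pos.2 hlt), Real.rpow_natCast]
    exact le_of_eq (by ring)

theorem isJet_cos (ω u : ℝ) (n : ℕ) (I : Set ℝ) :
    IsJet n (fun j t => ω ^ j * Real.cos (ω * (t - u) + j * (Real.pi / 2))) I := by
  intro j _ t _
  have h1 : HasDerivAt (fun t => ω * (t - u) + j * (Real.pi / 2)) ω t := by
    simpa using (((hasDerivAt_id t).sub_const u).const_mul ω).add_const ((j : ℝ) * (Real.pi / 2))
  have h2 := (h1.cos.const_mul (ω ^ j)).hasDerivWithinAt (s := I)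
  convert h2 using 1
  have : ω * (t - u) + ((j + 1 : ℕ) : ℝ) * (Real.pi / 2)
      = (ω * (t - u) + j * (Real.pi / 2)) + Real.pi / 2 := by push_cast; ring
  simp only [this, Real.cos_add_pi_div_two]
  ring

/-- A cosine of amplitude `2 A` with `n + 1` half-periods dominates `G 0` at its `n + 2` extrema, so
the difference has `n + 1` zeros and its derivative of order `n` has one. There `G n` equals a
derivative of the cosine. -/
theorem IsJet.exists_abs_le {u v A : ℝ} (huv : u < v) {n : ℕ} {G : ℕ → ℝ → ℝ}
    (hG : IsJet n G (Icc u v)) (hA : 0 < A) (hbd : ∀ x ∈ Icc u v, |G 0 x| ≤ A)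
    (hc : ContinuousOn (G 0) (Icc u v)) :
    ∃ ξ ∈ Icc u v, |G n ξ| * (v - u) ^ n ≤ 2 * A * ((n + 1) * Real.pi) ^ n := by
  have hw : 0 < v - u := sub_pos.2 huv
  set ω : ℝ := (n + 1) * Real.pi / (v - u) with hω
  have hω0 : 0 < ω := by positivity
  set T : ℕ → ℝ → ℝ := fun j t => ω ^ j * Real.cos (ω * (t - u) + j * (Real.pi / 2)) with hT
  set P : ℕ → ℝ → ℝ := fun j t => G j t - 2 * A * T j t with hP
  have hjet : IsJet n P (Icc u v) := fun j hj t ht =>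
    (hG j hj t ht).sub ((isJet_cos ω u n _ j hj t ht).const_mul (2 * A))
  have hcont : ContinuousOn (P 0) (Icc u v) := by
    refine hc.sub (Continuous.continuousOn ?_)
    simp only [hT]
    fun_prop
  let x : ℕ → ℝ := fun k => u + k * (v - u) / (n + 1)
  have hxI : ∀ k ≤ n + 1, x k ∈ Icc u v := by
    intro k hk
    have hk' : (k : ℝ) ≤ n + 1 := by exact_mod_cast hk
    constructor
    · simp only [x]; have : 0 ≤ k * (v - u) / (n + 1) := by positivity
      linarith
    · simp only [x]
      have : k * (v - u) / (n + 1) ≤ v - u := by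
        rw [div_le_iff₀ (by positivity)]; nlinarith
      linarith
  have hxlt : ∀ k, x k < x (k + 1) := by
    intro k
    simp only [x]
    gcongr
    simp
  have hTx : ∀ k, T 0 (x k) = (-1) ^ k := by
    intro k
    simp only [hT, x, hω]
    rw [← Real.cos_nat_mul_pi]
    simp only [pow_zero, one_mul, Nat.cast_zero, zero_mul, add_zero]
    congr 1
    field_simp
    ring
  have hsign : ∀ k ≤ n, ∃ z ∈ Ioo (x k) (x (k + 1)), P 0 z = 0 := by
    intro k hk
    have hsub : Icc (x k) (x (k + 1)) ⊆ Icc u v :=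
      Icc_subset_Icc (hxI k (by omega)).1 (hxI (k + 1) (by omega)).2
    have h1 := abs_le.1 (hbd _ (hxI k (by omega)))
    have h2 := abs_le.1 (hbd _ (hxI (k + 1) (by omega)))
    have e1 : P 0 (x k) = G 0 (x k) - 2 * A * (-1) ^ k := by simp only [hP, hTx]
    have e2 : P 0 (x (k + 1)) = G 0 (x (k + 1)) + 2 * A * (-1) ^ k := by
      simp only [hP, hTx, pow_succ]; ring
    rcases neg_one_pow_eq_or ℝ k with h | h <;> rw [h] at e1 e2
    · exact intermediate_value_Ioo (hxlt k).le (hcont.mono hsub)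
        ⟨by rw [e1]; linarith, by rw [e2]; linarith⟩
    · exact intermediate_value_Ioo' (hxlt k).le (hcont.mono hsub)
        ⟨by rw [e2]; linarith, by rw [e1]; linarith⟩
  have hsign' : ∀ k : Fin (n + 1), ∃ z ∈ Ioo (x k) (x (k + 1)), P 0 z = 0 := fun k =>
    hsign k (by omega)
  choose z hz hz0 using hsign'
  obtain ⟨ξ, hξ, h⟩ := hjet.exists_zero n z (Fin.strictMono_iff_lt_succ.2 fun i => by
      have h1 := (hz i.castSucc).2
      have h2 := (hz i.succ).1
      simp only [Fin.val_castSucc, Fin.val_succ] at h1 h2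
      exact h1.trans h2) (fun i => ⟨(hxI i (by omega)).1.trans (hz i).1.le,
        (hz i).2.le.trans (hxI (i + 1) (by omega)).2⟩) hz0
  refine ⟨ξ, hξ, ?_⟩
  have e : G n ξ = 2 * A * T n ξ := by simp only [hP] at h; linarith
  have hTn : |T n ξ| ≤ ω ^ n := by
    simp only [hT, abs_mul, abs_of_pos (pow_pos hω0 n)]
    exact mul_le_of_le_one_right (by positivity) (Real.abs_cos_le_one _)
  rw [e, abs_mul, abs_of_pos (by positivity : 0 < 2 * A), mul_assoc]
  gcongr
  calc |T n ξ| * (v - u) ^ n ≤ ω ^ n * (v - u) ^ n := by gcongr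
    _ = ((n + 1) * Real.pi) ^ n := by rw [← mul_pow, hω]; congr 1; field_simp

/-- Interpolation of derivatives: a bounded function whose derivative of order `n` has small
Hölder oscillation has all derivatives up to order `n` under control. -/
theorem exists_jet_bound (n : ℕ) : ∃ C : ℝ, 1 ≤ C ∧ ∀ (u v A H α : ℝ) (G : ℕ → ℝ → ℝ),
    u < v → 0 ≤ α → 0 < A → 0 ≤ H → IsJet n G (Icc u v) → ContinuousOn (G 0) (Icc u v) →
    (∀ x ∈ Icc u v, |G 0 x| ≤ A) →
    (∀ x ∈ Icc u v, ∀ y ∈ Icc u v, |G n x - G n y| ≤ H * |x - y| ^ α) →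
    H * (v - u) ^ ((n : ℝ) + α) ≤ A →
    ∀ i ≤ n, ∀ x ∈ Icc u v, |G i x| * (v - u) ^ i ≤ C * A := by
  set M : ℝ := 2 * ((n + 1) * Real.pi) ^ n with hM
  have hpi : 1 ≤ (n + 1) * Real.pi := by
    have := Real.pi_gt_three
    have h : (0 : ℝ) ≤ n := by positivity
    nlinarith
  have hM1 : 1 ≤ M := by
    have := one_le_pow₀ hpi (n := n)
    linarith
  refine ⟨M * (n + 2), by nlinarith [(by positivity : (0 : ℝ) ≤ n)], ?_⟩
  intro u v A H α G huv hα hA hH hG hc hbd hhol hHA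
  have hw : 0 < v - u := sub_pos.2 huv
  have hdist : ∀ x ∈ Icc u v, ∀ y ∈ Icc u v, |x - y| ≤ v - u := fun x hx y hy =>
    abs_le.2 ⟨by linarith [hx.1, hy.2], by linarith [hx.2, hy.1]⟩
  -- Each derivative has the right size at one point. The bound spreads to the interval by Hölder
  -- continuity for order `n`, then by the mean value theorem for lower orders.
  have hpt : ∀ i ≤ n, ∃ ξ ∈ Icc u v, |G i ξ| * (v - u) ^ i ≤ M * A := by
    intro i hi
    obtain ⟨ξ, hξ, h⟩ := (hG.mono hi subset_rfl).exists_abs_le huv hA hbd hc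
    refine ⟨ξ, hξ, h.trans ?_⟩
    have h1 : ((i + 1 : ℝ) * Real.pi) ^ i ≤ ((n + 1) * Real.pi) ^ n := by
      calc ((i + 1 : ℝ) * Real.pi) ^ i ≤ ((n + 1) * Real.pi) ^ i := by gcongr
        _ ≤ _ := pow_le_pow_right₀ hpi hi
    rw [hM]
    nlinarith
  have key : ∀ k ≤ n, ∀ x ∈ Icc u v, |G (n - k) x| * (v - u) ^ (n - k) ≤ M * (k + 2) * A := by
    intro k
    induction k with
    | zero =>
      intro _ x hx
      obtain ⟨ξ, hξ, h⟩ := hpt n le_rfl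
      have h2 := hhol x hx ξ hξ
      have h3 : H * |x - ξ| ^ α * (v - u) ^ n ≤ A := by
        refine le_trans ?_ hHA
        rw [Real.rpow_add hw, Real.rpow_natCast, mul_comm ((v - u) ^ n), ← mul_assoc]
        gcongr
        exact hdist x hx ξ hξ
      have h4 : |G n x| ≤ |G n ξ| + H * |x - ξ| ^ α := by
        have := abs_sub_abs_le_abs_sub (G n x) (G n ξ)
        linarith
      calc |G (n - 0) x| * (v - u) ^ (n - 0) ≤ (|G n ξ| + H * |x - ξ| ^ α) * (v - u) ^ n := by
            simp only [Nat.sub_zero]; gcongr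
        _ ≤ M * A + A := by rw [add_mul]; linarith
        _ ≤ _ := by push_cast; nlinarith
    | succ k ih =>
      intro hk x hx
      obtain ⟨ξ, hξ, h⟩ := hpt (n - (k + 1)) (by omega)
      obtain ⟨η, hη, h'⟩ := exists_eq_mul_sub (hG (n - (k + 1)) (by omega)) hξ hx
      have e : n - (k + 1) + 1 = n - k := by omega
      have e' : n - k = (n - (k + 1)) + 1 := by omega
      have h1 := ih (by omega) η hη
      have h4 : |G (n - (k + 1)) x| ≤ |G (n - (k + 1)) ξ| + |G (n - k) η| * (v - u) := by
        have := abs_sub_abs_le_abs_sub (G (n - (k + 1)) x) (G (n - (k + 1)) ξ)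
        rw [h', abs_mul, e] at this
        have h5 : |G (n - k) η| * |x - ξ| ≤ |G (n - k) η| * (v - u) := by
          gcongr; exact hdist x hx ξ hξ
        linarith
      calc |G (n - (k + 1)) x| * (v - u) ^ (n - (k + 1))
          ≤ (|G (n - (k + 1)) ξ| + |G (n - k) η| * (v - u)) * (v - u) ^ (n - (k + 1)) := by gcongr
        _ = |G (n - (k + 1)) ξ| * (v - u) ^ (n - (k + 1)) + |G (n - k) η| * (v - u) ^ (n - k) := by
          rw [e']; ring
        _ ≤ M * A + M * (k + 2) * A := add_le_add h h1
        _ = _ := by push_cast; ring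
  intro i hi x hx
  have := key (n - i) (by omega) x hx
  rw [Nat.sub_sub_self hi] at this
  refine this.trans ?_
  gcongr
  exact_mod_cast (by omega : n - i ≤ n)

end TorsionDecomp

namespace TorsionDecomp

open Set

/-! ### Slowly varying functions -/

/-- `f` does not vanish on `I` and its derivatives up to order `n` are at most `ε |f|`, when
measured at the length scale `w`. -/
structure SlowOn (n : ℕ) (ε w : ℝ) (I : Set ℝ) (f : ℝ → ℝ) : Prop where
  smooth : ContDiffOn ℝ n f I
  ne_zero : ∀ t ∈ I, f t ≠ 0
  bound : ∀ i, 1 ≤ i → i ≤ n → ∀ t ∈ I, |iteratedDerivWithin i f I t| * w ^ i ≤ ε * |f t|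

theorem SlowOn.mono {n : ℕ} {ε ε' w : ℝ} {I : Set ℝ} {f : ℝ → ℝ} (h : SlowOn n ε w I f)
    (he : ε ≤ ε') : SlowOn n ε' w I f :=
  ⟨h.smooth, h.ne_zero, fun i h1 h2 t ht => (h.bound i h1 h2 t ht).trans (by gcongr)⟩

theorem SlowOn.of_le {n m : ℕ} {ε w : ℝ} {I : Set ℝ} {f : ℝ → ℝ} (h : SlowOn n ε w I f)
    (hm : m ≤ n) : SlowOn m ε w I f :=
  ⟨h.smooth.of_le (by exact_mod_cast hm), h.ne_zero,
    fun i h1 h2 t ht => h.bound i h1 (h2.trans hm) t ht⟩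

theorem SlowOn.congr {n : ℕ} {ε w : ℝ} {I : Set ℝ} {f g : ℝ → ℝ} (h : SlowOn n ε w I f)
    (hfg : EqOn g f I) : SlowOn n ε w I g :=
  ⟨h.smooth.congr hfg, fun t ht => by rw [hfg ht]; exact h.ne_zero t ht, fun i h1 h2 t ht => by
    rw [iteratedDerivWithin_congr hfg ht, hfg ht]; exact h.bound i h1 h2 t ht⟩

theorem SlowOn.bound_le {n : ℕ} {ε w : ℝ} {I : Set ℝ} {f : ℝ → ℝ} (h : SlowOn n ε w I f)
    (he : ε ≤ 1) {i : ℕ} (hi : i ≤ n) {t : ℝ} (ht : t ∈ I) :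
    |iteratedDerivWithin i f I t| * w ^ i ≤ |f t| := by
  rcases Nat.eq_zero_or_pos i with rfl | h0
  · simp
  · exact (h.bound i h0 hi t ht).trans (mul_le_of_le_one_left (abs_nonneg _) he)

theorem sum_choose_le (i n : ℕ) (h : i ≤ n) :
    ∑ k ∈ Finset.range (i + 1), (i.choose k : ℝ) ≤ 2 ^ n := by
  have := Nat.sum_range_choose i
  calc ∑ k ∈ Finset.range (i + 1), (i.choose k : ℝ) = 2 ^ i := by exact_mod_cast this
    _ ≤ 2 ^ n := pow_le_pow_right₀ (by norm_num) h

/-- Each Leibniz term has at least one factor differentiated, which yields an `ε`; the binomial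
coefficients add up to at most `2 ^ n`. -/
theorem SlowOn.mul {n : ℕ} {ε w u v : ℝ} {f g : ℝ → ℝ} (huv : u < v) (hw : 0 ≤ w) (he0 : 0 ≤ ε)
    (he : ε ≤ 1) (hf : SlowOn n ε w (Icc u v) f) (hg : SlowOn n ε w (Icc u v) g) :
    SlowOn n (2 ^ n * ε) w (Icc u v) (f * g) := by
  refine ⟨hf.smooth.mul hg.smooth, fun t ht => mul_ne_zero (hf.ne_zero t ht) (hg.ne_zero t ht), ?_⟩
  intro i h1 h2 t ht
  have hin : ((i : ℕ) : WithTop ℕ∞) ≤ (n : ℕ) := by exact_mod_cast h2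
  rw [iteratedDerivWithin_mul ht (uniqueDiffOn_Icc huv) ((hf.smooth t ht).of_le hin)
    ((hg.smooth t ht).of_le hin)]
  calc _ ≤ (∑ k ∈ Finset.range (i + 1), |(i.choose k : ℝ) * iteratedDerivWithin k f (Icc u v) t *
        iteratedDerivWithin (i - k) g (Icc u v) t|) * w ^ i := by
        gcongr; exact Finset.abs_sum_le_sum_abs _ _
    _ ≤ (∑ k ∈ Finset.range (i + 1), (i.choose k : ℝ)) * (ε * (|f t| * |g t|)) := by
        rw [Finset.sum_mul, Finset.sum_mul]
        refine Finset.sum_le_sum fun k hk => ?_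
        have hk : k ≤ i := by simpa [Nat.lt_succ_iff] using hk
        have e : w ^ i = w ^ k * w ^ (i - k) := by rw [← pow_add]; congr 1; omega
        rw [abs_mul, abs_mul, Nat.abs_cast, e, mul_assoc, mul_assoc]
        refine mul_le_mul_of_nonneg_left ?_ (Nat.cast_nonneg _)
        calc |iteratedDerivWithin k f (Icc u v) t| * (|iteratedDerivWithin (i - k) g (Icc u v) t| *
              (w ^ k * w ^ (i - k)))
            = (|iteratedDerivWithin k f (Icc u v) t| * w ^ k) *
              (|iteratedDerivWithin (i - k) g (Icc u v) t| * w ^ (i - k)) := by ring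
          _ ≤ ε * (|f t| * |g t|) := by
            rcases Nat.eq_zero_or_pos k with rfl | hk0
            · have := hg.bound i h1 h2 t ht
              simp only [iteratedDerivWithin_zero, pow_zero, mul_one, Nat.sub_zero]
              calc _ ≤ |f t| * (ε * |g t|) := by gcongr
                _ = _ := by ring
            · have h3 := hf.bound k hk0 (hk.trans h2) t ht
              have h4 := hg.bound_le he (i := i - k) (by omega) ht
              calc _ ≤ (ε * |f t|) * |g t| := by gcongr
                _ = _ := by ring
    _ ≤ 2 ^ n * (ε * (|f t| * |g t|)) := by gcongr; exact sum_choose_le i n h2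
    _ = _ := by simp only [Pi.mul_apply, abs_mul]; ring

/-- The Leibniz rule for `f * f⁻¹ = 1` is solved for the highest derivative of `f⁻¹`. Every other
term contains a derivative of `f` of positive order, hence a factor `ε`. -/
theorem SlowOn.inv {n : ℕ} {ε w u v : ℝ} {f : ℝ → ℝ} (huv : u < v) (hw : 0 ≤ w) (he0 : 0 ≤ ε)
    (he : 2 ^ n * ε ≤ 1) (hf : SlowOn n ε w (Icc u v) f) :
    SlowOn n (2 ^ n * ε) w (Icc u v) f⁻¹ := by
  have hs : ContDiffOn ℝ n f⁻¹ (Icc u v) := hf.smooth.inv hf.ne_zero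
  have hone : EqOn (f * f⁻¹) (fun _ => (1 : ℝ)) (Icc u v) := fun t ht => by
    simp [hf.ne_zero t ht]
  suffices h : ∀ i ≤ n, 1 ≤ i → ∀ t ∈ Icc u v,
      |iteratedDerivWithin i f⁻¹ (Icc u v) t| * w ^ i ≤ 2 ^ n * ε * |f⁻¹ t| from
    ⟨hs, fun t ht => inv_ne_zero (hf.ne_zero t ht), fun i h1 h2 => h i h2 h1⟩
  intro i
  induction i using Nat.strong_induction_on with
  | _ i ih =>
  intro h2 h1 t ht
  have hin : ((i : ℕ) : WithTop ℕ∞) ≤ (n : ℕ) := by exact_mod_cast h2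
  have hL := iteratedDerivWithin_mul ht (uniqueDiffOn_Icc huv) ((hf.smooth t ht).of_le hin)
    ((hs t ht).of_le hin)
  rw [iteratedDerivWithin_congr hone ht, iteratedDerivWithin_const, if_neg (by omega),
    Finset.sum_range_succ'] at hL
  simp only [Nat.choose_zero_right, Nat.cast_one, one_mul, iteratedDerivWithin_zero,
    Nat.sub_zero] at hL
  have hft := hf.ne_zero t ht
  have habs : 0 < |f t| := abs_pos.2 hft
  have hprev : ∀ m < i, |iteratedDerivWithin m f⁻¹ (Icc u v) t| * w ^ m ≤ |f⁻¹ t| := by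
    intro m hm
    rcases Nat.eq_zero_or_pos m with rfl | h0
    · simp
    · exact (ih m hm (by omega) h0 t ht).trans (mul_le_of_le_one_left (abs_nonneg _) he)
  have key : |f t| * (|iteratedDerivWithin i f⁻¹ (Icc u v) t| * w ^ i) ≤
      |f t| * (2 ^ n * ε * |f⁻¹ t|) := by
    calc |f t| * (|iteratedDerivWithin i f⁻¹ (Icc u v) t| * w ^ i)
        = |∑ k ∈ Finset.range i, (i.choose (k + 1) : ℝ) *
          iteratedDerivWithin (k + 1) f (Icc u v) t *
          iteratedDerivWithin (i - (k + 1)) f⁻¹ (Icc u v) t| * w ^ i := by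
          rw [← mul_assoc, ← abs_mul, ← abs_neg]
          congr 2
          linarith
      _ ≤ (∑ k ∈ Finset.range i, |(i.choose (k + 1) : ℝ) *
          iteratedDerivWithin (k + 1) f (Icc u v) t *
          iteratedDerivWithin (i - (k + 1)) f⁻¹ (Icc u v) t|) * w ^ i := by
          gcongr; exact Finset.abs_sum_le_sum_abs _ _
      _ ≤ (∑ k ∈ Finset.range i, (i.choose (k + 1) : ℝ)) * (ε * |f t| * |f⁻¹ t|) := by
          rw [Finset.sum_mul, Finset.sum_mul]
          refine Finset.sum_le_sum fun k hk => ?_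
          have hk : k < i := by simpa using hk
          have e : w ^ i = w ^ (k + 1) * w ^ (i - (k + 1)) := by rw [← pow_add]; congr 1; omega
          rw [abs_mul, abs_mul, Nat.abs_cast, e, mul_assoc, mul_assoc]
          refine mul_le_mul_of_nonneg_left ?_ (Nat.cast_nonneg _)
          have h3 := hf.bound (k + 1) (by omega) (by omega) t ht
          have h4 := hprev (i - (k + 1)) (by omega)
          calc _ = (|iteratedDerivWithin (k + 1) f (Icc u v) t| * w ^ (k + 1)) *
              (|iteratedDerivWithin (i - (k + 1)) f⁻¹ (Icc u v) t| * w ^ (i - (k + 1))) := by ring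
            _ ≤ _ := by gcongr
      _ ≤ 2 ^ n * (ε * |f t| * |f⁻¹ t|) := by
          gcongr
          refine le_trans ?_ (sum_choose_le i n h2)
          rw [Finset.sum_range_succ']
          simp
      _ = _ := by ring
  exact le_of_mul_le_mul_left key habs

/-- Each division by `f` costs `2 ^ n` for the inverse and `2 ^ n` for the product. -/
theorem SlowOn.div_pow {n : ℕ} {ε w u v : ℝ} {f g : ℝ → ℝ} (huv : u < v) (hw : 0 ≤ w)
    (he0 : 0 ≤ ε) (hf : SlowOn n ε w (Icc u v) f) (hg : SlowOn n ε w (Icc u v) g) (m : ℕ)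
    (he : (4 ^ n) ^ m * ε ≤ 1) :
    SlowOn n ((4 ^ n) ^ m * ε) w (Icc u v) (fun t => g t / f t ^ m) := by
  induction m with
  | zero => simpa using hg
  | succ m ih =>
    have h4 : (4 : ℝ) ^ n = 2 ^ n * 2 ^ n := by rw [← mul_pow]; norm_num
    have h2 : (1 : ℝ) ≤ 2 ^ n := one_le_pow₀ (by norm_num)
    have h41 : (1 : ℝ) ≤ 4 ^ n := one_le_pow₀ (by norm_num)
    have h4m : (1 : ℝ) ≤ (4 ^ n) ^ m := one_le_pow₀ h41
    have e : ((4 : ℝ) ^ n) ^ (m + 1) * ε = 2 ^ n * (2 ^ n * ((4 ^ n) ^ m * ε)) := by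
      rw [pow_succ, h4]; ring
    have hpos : 0 ≤ ((4 : ℝ) ^ n) ^ m * ε := by positivity
    have ha : 2 ^ n * (((4 : ℝ) ^ n) ^ m * ε) ≤ 1 := by
      rw [e] at he; nlinarith
    have hb : ((4 : ℝ) ^ n) ^ m * ε ≤ 1 := by nlinarith
    have hc : 2 ^ n * ε ≤ 2 ^ n * (((4 : ℝ) ^ n) ^ m * ε) := by
      gcongr; nlinarith
    have h1 := (ih hb).mono (le_mul_of_one_le_left hpos h2)
    have h3 := (hf.inv huv hw he0 (hc.trans ha)).mono hc
    rw [e]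
    refine (h1.mul huv hw (by positivity) ha h3).congr fun t ht => ?_
    simp only [Pi.mul_apply, Pi.inv_apply, pow_succ]
    rw [div_mul_eq_div_div, div_eq_mul_inv _ (f t)]

/-! ### Determinants with rows evaluated at different points -/

theorem hasDerivWithinAt_det_updateRow {n : ℕ} (M : Matrix (Fin n) (Fin n) ℝ) (b : Fin n)
    {g : ℝ → Fin n → ℝ} {g' : Fin n → ℝ} {I : Set ℝ} {x : ℝ} (hg : HasDerivWithinAt g g' I x) :
    HasDerivWithinAt (fun x => (M.updateRow b (g x)).det) (M.updateRow b g').det I x := by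
  let L : (Fin n → ℝ) →ₗ[ℝ] ℝ :=
    (Matrix.detRowAlternating (n := Fin n) (R := ℝ)).toMultilinearMap.toLinearMap M b
  exact (LinearMap.toContinuousLinearMap L).hasFDerivAt.comp_hasDerivWithinAt x hg

/-- Rows of too low an order of differentiation can be raised, by the mean value theorem. -/
theorem exists_abs_det_le {n : ℕ} {u v : ℝ} {Φ : ℕ → ℝ → Fin n → ℝ}
    (hΦ : IsJet (n - 1) Φ (Icc u v)) (r : Fin n → ℕ) (s : Fin n → ℝ) (hr : ∀ b, r b ≤ b)
    (hs : ∀ b, s b ∈ Icc u v) :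
    ∃ s' : Fin n → ℝ, (∀ b, s' b ∈ Icc u v) ∧
      |(Matrix.of fun b => Φ (r b) (s b)).det| ≤
        (∏ b : Fin n, (v - u) ^ ((b : ℕ) - r b)) * |(Matrix.of fun b : Fin n => Φ b (s' b)).det| := by
  induction hK : ∑ b : Fin n, ((b : ℕ) - r b) generalizing r s with
  | zero =>
    have h : ∀ b : Fin n, (b : ℕ) - r b = 0 := fun b => (Finset.sum_eq_zero_iff.1 hK) b (by simp)
    have h' : ∀ b : Fin n, r b = b := fun b => le_antisymm (hr b) (by have := h b; omega)
    exact ⟨s, hs, by simp [h']⟩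
  | succ K ih =>
    have hex : ∃ m : ℕ, ∃ b : Fin n, (b : ℕ) = m ∧ r b < b := by
      by_contra hcon
      push Not at hcon
      have : ∑ b : Fin n, ((b : ℕ) - r b) = 0 :=
        Finset.sum_eq_zero fun b _ => by have := hcon b b rfl; omega
      omega
    classical
    -- `b` is the first row of too low an order, so row `i = r b` already has order `i`. Moving the
    -- point of row `b` to `s i` produces two equal rows, and the mean value theorem from `s i` to
    -- `s b` raises the order of row `b` by one.
    obtain ⟨b, hb, hrb⟩ := Nat.find_spec hex
    have hmin : ∀ c : Fin n, c < b → r c = c := by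
      intro c hc
      by_contra hne
      exact Nat.find_min hex (m := c) (by rw [← hb]; exact hc) ⟨c, rfl, by have := hr c; omega⟩
    let i : Fin n := ⟨r b, hrb.trans b.2⟩
    have hib : i < b := hrb
    set M : Matrix (Fin n) (Fin n) ℝ := Matrix.of fun b => Φ (r b) (s b) with hM
    have hMup : ∀ (k : ℕ) (x : ℝ), M.updateRow b (Φ k x) =
        Matrix.of fun c => Φ (Function.update r b k c) (Function.update s b x c) := by
      intro k x
      ext c a
      by_cases hc : c = b
      · subst hc; simp
      · simp [hc, hM]
    obtain ⟨ξ, hξ, h⟩ := exists_eq_mul_sub (u := u) (v := v)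
      (f := fun x => (M.updateRow b (Φ (r b) x)).det)
      (f' := fun x => (M.updateRow b (Φ (r b + 1) x)).det)
      (fun t ht => hasDerivWithinAt_det_updateRow M b (hΦ (r b) (by omega) t ht)) (hs i) (hs b)
    have h1 : (M.updateRow b (Φ (r b) (s i))).det = 0 := by
      refine Matrix.det_zero_of_row_eq hib.ne ?_
      rw [Matrix.updateRow_self, Matrix.updateRow_ne hib.ne]
      change Φ (r i) (s i) = Φ (r b) (s i)
      rw [hmin i hib]
    have h2 : M.updateRow b (Φ (r b) (s b)) = M := by
      rw [hMup]; simp [hM]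
    simp only [h1, h2, sub_zero] at h
    have hup : ∀ c, Function.update r b (r b + 1) c ≤ c := by
      intro c
      by_cases hc : c = b
      · subst hc; simpa using hrb
      · simpa [hc] using hr c
    have hsum : ∑ c : Fin n, ((c : ℕ) - Function.update r b (r b + 1) c) = K := by
      rw [← Finset.add_sum_erase _ _ (Finset.mem_univ b)] at hK ⊢
      rw [Finset.sum_congr rfl (g := fun c : Fin n => (c : ℕ) - r c)]
      · simp only [Function.update_self]; omega
      · intro c hc
        simp [Finset.ne_of_mem_erase hc]
    obtain ⟨s', hs', hle⟩ := ih (Function.update r b (r b + 1)) (Function.update s b ξ) hup (by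
      intro c
      by_cases hc : c = b
      · subst hc; simpa using hξ
      · simpa [hc] using hs c) hsum
    refine ⟨s', hs', ?_⟩
    have hw : 0 ≤ v - u := by linarith [hξ.1, hξ.2]
    rw [h, hMup, abs_mul, mul_comm]
    have hd : |s b - s i| ≤ v - u :=
      abs_le.2 ⟨by linarith [(hs b).1, (hs i).2], by linarith [(hs b).2, (hs i).1]⟩
    have hprod : ∏ c : Fin n, (v - u) ^ ((c : ℕ) - r c) =
        (v - u) * ∏ c : Fin n, (v - u) ^ ((c : ℕ) - Function.update r b (r b + 1) c) := by
      rw [Finset.prod_pow_eq_pow_sum, Finset.prod_pow_eq_pow_sum, hsum, hK, pow_succ']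
    rw [hprod, mul_assoc]
    gcongr

theorem det_sum_rows {n : ℕ} {κ : Type*} [Fintype κ] (c : Fin n → κ → ℝ)
    (X : Fin n → κ → Fin n → ℝ) :
    (Matrix.of fun b a => ∑ i, c b i * X b i a).det =
      ∑ r : Fin n → κ, (∏ b, c b (r b)) * (Matrix.of fun b => X b (r b)).det := by
  classical
  have h := (Matrix.detRowAlternating (n := Fin n) (R := ℝ)).toMultilinearMap.map_sum
    (fun b i => c b i • X b i)
  have e : (Matrix.of fun b a => ∑ i, c b i * X b i a) = fun b => ∑ i, c b i • X b i := by
    ext b a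
    simp
  rw [e]
  refine h.trans (Finset.sum_congr rfl fun r _ => ?_)
  rw [MultilinearMap.map_smul_univ]
  rfl

end TorsionDecomp

/-! ### Mixed determinants and Wronskians of slowly varying families -/

namespace TorsionDecomp

open Set

/-- The determinant of the `n × n` matrix whose row `b` holds the derivatives of order `b` of
`f 0, …, f (n - 1)` at the point `s b`. -/
noncomputable def mixedDet (n : ℕ) (f : ℕ → ℝ → ℝ) (I : Set ℝ) (s : ℕ → ℝ) : ℝ :=
  (Matrix.of fun b a : Fin n => iteratedDerivWithin b (f a) I (s b)).det

/-- The Wronskian of `f 0, …, f (n - 1)`. -/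
noncomputable def wronskian (n : ℕ) (f : ℕ → ℝ → ℝ) (I : Set ℝ) (t : ℝ) : ℝ :=
  mixedDet n f I fun _ => t

/-- The coefficients of the Leibniz rule for multiplication by `p`. -/
noncomputable def leibnizCoeff (p : ℝ → ℝ) (I : Set ℝ) (t : ℝ) (b i : ℕ) : ℝ :=
  b.choose i * iteratedDerivWithin (b - i) p I t

theorem iteratedDerivWithin_mul_eq_sum {u v : ℝ} (huv : u < v) {n : ℕ} {p φ g : ℝ → ℝ}
    (hp : ContDiffOn ℝ (n - 1 : ℕ) p (Icc u v)) (hφ : ContDiffOn ℝ (n - 1 : ℕ) φ (Icc u v))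
    (hg : EqOn g (φ * p) (Icc u v)) (b : Fin n) {t : ℝ} (ht : t ∈ Icc u v) :
    iteratedDerivWithin b g (Icc u v) t =
      ∑ i : Fin n, leibnizCoeff p (Icc u v) t b i * iteratedDerivWithin i φ (Icc u v) t := by
  have hb : ((b : ℕ) : WithTop ℕ∞) ≤ ((n - 1 : ℕ) : WithTop ℕ∞) := by
    exact_mod_cast (by omega : (b : ℕ) ≤ n - 1)
  rw [iteratedDerivWithin_congr hg ht, iteratedDerivWithin_mul ht (uniqueDiffOn_Icc huv)
    ((hφ t ht).of_le hb) ((hp t ht).of_le hb), Finset.sum_fin_eq_sum_range]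
  have hsub : Finset.range ((b : ℕ) + 1) ⊆ Finset.range n := by
    intro i hi; simp only [Finset.mem_range] at *; omega
  rw [← Finset.sum_subset hsub]
  · refine Finset.sum_congr rfl fun i hi => ?_
    simp only [Finset.mem_range] at hi
    rw [dif_pos (by omega), leibnizCoeff]
    ring
  · intro i hi hi'
    simp only [Finset.mem_range] at hi hi'
    rw [dif_pos hi, leibnizCoeff, Nat.choose_eq_zero_of_lt (show (b : ℕ) < i by omega)]
    simp

/-- The Leibniz rule factors the matrix of `f` through a lower triangular matrix with `p t` along
the diagonal. -/
theorem wronskian_mul {u v : ℝ} (huv : u < v) {n : ℕ} {p : ℝ → ℝ} {f φ : ℕ → ℝ → ℝ}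
    (hp : ContDiffOn ℝ (n - 1 : ℕ) p (Icc u v))
    (hφ : ∀ a < n, ContDiffOn ℝ (n - 1 : ℕ) (φ a) (Icc u v))
    (hf : ∀ a < n, EqOn (f a) (φ a * p) (Icc u v)) {t : ℝ} (ht : t ∈ Icc u v) :
    wronskian n f (Icc u v) t = p t ^ n * wronskian n φ (Icc u v) t := by
  set T : Matrix (Fin n) (Fin n) ℝ := Matrix.of fun b i => leibnizCoeff p (Icc u v) t b i with hT
  have hmul : (Matrix.of fun b a : Fin n => iteratedDerivWithin b (f a) (Icc u v) t) =
      T * Matrix.of fun i a : Fin n => iteratedDerivWithin i (φ a) (Icc u v) t := by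
    ext b a
    rw [Matrix.mul_apply]
    exact iteratedDerivWithin_mul_eq_sum huv hp (hφ a a.2) (hf a a.2) b ht
  have hdet : T.det = p t ^ n := by
    rw [Matrix.det_of_isLowerTriangular T]
    · simp [hT, leibnizCoeff]
    · intro b i hbi
      have : (b : ℕ) < i := hbi
      simp [hT, leibnizCoeff, Nat.choose_eq_zero_of_lt this]
  rw [wronskian, mixedDet, hmul, Matrix.det_mul, hdet]
  rfl

/-- The first column is `1, 0, …, 0`, so only one cofactor survives. -/
theorem mixedDet_succ_of_one {u v : ℝ} {n : ℕ} {φ : ℕ → ℝ → ℝ}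
    (h0 : EqOn (φ 0) (fun _ => 1) (Icc u v)) {s : ℕ → ℝ} (hs : ∀ b, s b ∈ Icc u v) :
    mixedDet (n + 1) φ (Icc u v) s =
      mixedDet n (fun a => derivWithin (φ (a + 1)) (Icc u v)) (Icc u v) fun b => s (b + 1) := by
  rw [mixedDet, Matrix.det_succ_column_zero, Fin.sum_univ_succ]
  have hz : ∀ b : Fin n, iteratedDerivWithin (b.succ : ℕ) (φ 0) (Icc u v) (s (b.succ : ℕ)) = 0 := by
    intro b
    rw [iteratedDerivWithin_congr h0 (hs _), iteratedDerivWithin_const, if_neg (by simp)]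
  have h1 : φ 0 (s 0) = 1 := h0 (hs 0)
  simp only [Matrix.of_apply, Fin.val_zero, hz, mul_zero, zero_mul, Finset.sum_const_zero,
    add_zero, pow_zero, iteratedDerivWithin_zero, h1, one_mul]
  rw [mixedDet]
  congr 1
  ext b a
  simp [iteratedDerivWithin_succ']

theorem abs_leibnizCoeff_mul_le {n : ℕ} {ε w : ℝ} {I : Set ℝ} {p : ℝ → ℝ} (hp : SlowOn n ε w I p)
    (he0 : 0 ≤ ε) {t : ℝ} (ht : t ∈ I) {b i : ℕ} (hb : b ≤ n) :
    |leibnizCoeff p I t b i| * w ^ (b - i) ≤ 2 ^ n * |p t| * (if i = b then 1 else ε) := by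
  rw [leibnizCoeff, abs_mul, Nat.abs_cast, mul_assoc]
  have hch : (b.choose i : ℝ) ≤ 2 ^ n := by
    calc (b.choose i : ℝ) ≤ 2 ^ b := by exact_mod_cast Nat.choose_le_two_pow b i
      _ ≤ 2 ^ n := pow_le_pow_right₀ (by norm_num) hb
  rcases lt_trichotomy i b with h | h | h
  · rw [if_neg h.ne]
    have := hp.bound (b - i) (by omega) (by omega) t ht
    calc _ ≤ (b.choose i : ℝ) * (ε * |p t|) := by gcongr
      _ ≤ 2 ^ n * (ε * |p t|) := by gcongr
      _ = _ := by ring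
  · rw [if_pos h, mul_one]
    subst h
    simp only [Nat.sub_self, iteratedDerivWithin_zero, pow_zero, mul_one]
    gcongr
  · rw [Nat.choose_eq_zero_of_lt h, if_neg h.ne']
    simp only [Nat.cast_zero, zero_mul]
    positivity

/-- Comparison of mixed determinants for `f = p φ` and for `φ`, when `p` varies slowly. -/
theorem abs_mixedDet_sub_le {u v ε A : ℝ} (huv : u < v) {n : ℕ} {p : ℝ → ℝ} {f φ : ℕ → ℝ → ℝ}
    (he0 : 0 ≤ ε) (he : ε ≤ 1)
    (hp : SlowOn (n - 1) ε (v - u) (Icc u v) p)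
    (hφ : ∀ a < n, ContDiffOn ℝ (n - 1 : ℕ) (φ a) (Icc u v))
    (hf : ∀ a < n, EqOn (f a) (φ a * p) (Icc u v))
    (hA : ∀ s : ℕ → ℝ, (∀ b, s b ∈ Icc u v) → |mixedDet n φ (Icc u v) s| ≤ A)
    {s : ℕ → ℝ} (hs : ∀ b, s b ∈ Icc u v) :
    |mixedDet n f (Icc u v) s - (∏ b : Fin n, p (s b)) * mixedDet n φ (Icc u v) s| ≤
      ε * ((n : ℝ) ^ n * (2 ^ n) ^ n * |∏ b : Fin n, p (s b)| * A) := by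
  classical
  have hA0 : 0 ≤ A := (abs_nonneg _).trans (hA s hs)
  have hw : 0 ≤ v - u := by linarith
  let Φ : ℕ → ℝ → Fin n → ℝ := fun i t a => iteratedDerivWithin i (φ a) (Icc u v) t
  have hΦ : IsJet (n - 1) Φ (Icc u v) := fun j hj t ht => hasDerivWithinAt_pi.2 fun a =>
    isJet_iteratedDerivWithin huv (hφ a a.2) j hj t ht
  let c : Fin n → Fin n → ℝ := fun b i => leibnizCoeff p (Icc u v) (s b) b i
  let D : (Fin n → Fin n) → ℝ := fun r => (Matrix.of fun b : Fin n => Φ (r b) (s b)).det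
  have hexp : mixedDet n f (Icc u v) s = ∑ r : Fin n → Fin n, (∏ b, c b (r b)) * D r := by
    rw [mixedDet, ← det_sum_rows c fun b i => Φ i (s b)]
    congr 1
    ext b a
    exact iteratedDerivWithin_mul_eq_sum huv hp.smooth (hφ a a.2) (hf a a.2) b (hs b)
  have hid : (∏ b, c b (id b)) * D id = (∏ b : Fin n, p (s b)) * mixedDet n φ (Icc u v) s := by
    congr 1
    exact Finset.prod_congr rfl fun b _ => by simp [c, leibnizCoeff]
  -- The choice `id` is the main term. Any other choice has some `r b > b`, with coefficient zero,
  -- or has `r b ≤ b` throughout with some `r b < b`, which yields a factor `ε`. The powers of `v -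
  -- u` gained in raising the rows to order `b` match those in the bounds for the derivatives of
  -- `p`.
  rw [hexp, ← Finset.add_sum_erase _ _ (Finset.mem_univ id), hid, add_sub_cancel_left]
  have hterm : ∀ r ∈ Finset.univ.erase (id : Fin n → Fin n), |(∏ b, c b (r b)) * D r| ≤
      ε * ((2 ^ n) ^ n * |∏ b : Fin n, p (s b)| * A) := by
    intro r hr
    have hrne : r ≠ id := Finset.ne_of_mem_erase hr
    by_cases hle : ∀ b, (r b : ℕ) ≤ b
    · obtain ⟨s', hs', hD⟩ := exists_abs_det_le hΦ (fun b => r b) (fun b => s b) hle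
        (fun b => hs b)
      have hDA : |(Matrix.of fun b : Fin n => Φ b (s' b)).det| ≤ A := by
        have := hA (fun b => if h : b < n then s' ⟨b, h⟩ else u) (fun b => by
          split_ifs
          · exact hs' _
          · exact left_mem_Icc.2 huv.le)
        simpa [mixedDet, Φ] using this
      obtain ⟨b₀, hb₀⟩ : ∃ b, r b ≠ b := by
        by_contra hcon; push Not at hcon; exact hrne (funext hcon)
      have hprod : ∏ b, (|c b (r b)| * (v - u) ^ ((b : ℕ) - r b)) ≤
          ε * ((2 ^ n) ^ n * |∏ b : Fin n, p (s b)|) := by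
        calc ∏ b, (|c b (r b)| * (v - u) ^ ((b : ℕ) - r b))
            ≤ ∏ b : Fin n, (2 ^ n * |p (s b)| * (if r b = b then 1 else ε)) := by
              refine Finset.prod_le_prod (fun b _ => by positivity) fun b _ => ?_
              have h := abs_leibnizCoeff_mul_le hp he0 (hs b) (b := b) (i := r b) (by omega)
              simp only [← Fin.ext_iff] at h
              refine h.trans ?_
              have h2 : (2 : ℝ) ^ (n - 1) ≤ 2 ^ n := pow_le_pow_right₀ (by norm_num) (by omega)
              gcongr
          _ = (2 ^ n) ^ n * |∏ b : Fin n, p (s b)| * ∏ b : Fin n, (if r b = b then 1 else ε) := by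
              rw [Finset.prod_mul_distrib, Finset.prod_mul_distrib, Finset.abs_prod]
              simp
          _ ≤ (2 ^ n) ^ n * |∏ b : Fin n, p (s b)| * ε := by
              gcongr
              rw [← Finset.mul_prod_erase _ _ (Finset.mem_univ b₀), if_neg hb₀]
              refine mul_le_of_le_one_right he0 (Finset.prod_le_one (fun b _ => ?_) fun b _ => ?_)
              · split_ifs <;> linarith
              · split_ifs <;> linarith
          _ = _ := by ring
      calc |(∏ b, c b (r b)) * D r|
          ≤ (∏ b, |c b (r b)|) * ((∏ b : Fin n, (v - u) ^ ((b : ℕ) - r b)) * A) := by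
            rw [abs_mul, Finset.abs_prod]
            gcongr
            exact hD.trans (by gcongr)
        _ = (∏ b, (|c b (r b)| * (v - u) ^ ((b : ℕ) - r b))) * A := by
            rw [Finset.prod_mul_distrib]; ring
        _ ≤ _ := (mul_le_mul_of_nonneg_right hprod hA0).trans_eq (by ring)
    · push Not at hle
      obtain ⟨b, hb⟩ := hle
      have : c b (r b) = 0 := by simp [c, leibnizCoeff, Nat.choose_eq_zero_of_lt hb]
      rw [Finset.prod_eq_zero (Finset.mem_univ b) this, zero_mul, abs_zero]
      positivity
  calc _ ≤ ∑ r ∈ Finset.univ.erase (id : Fin n → Fin n), |(∏ b, c b (r b)) * D r| :=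
        Finset.abs_sum_le_sum_abs _ _
    _ ≤ ∑ r ∈ Finset.univ.erase (id : Fin n → Fin n),
          ε * ((2 ^ n) ^ n * |∏ b : Fin n, p (s b)| * A) := Finset.sum_le_sum hterm
    _ ≤ ∑ r : Fin n → Fin n, ε * ((2 ^ n) ^ n * |∏ b : Fin n, p (s b)| * A) :=
        Finset.sum_le_sum_of_subset_of_nonneg (Finset.erase_subset _ _)
          fun _ _ _ => by positivity
    _ = _ := by
        simp only [Finset.sum_const, Finset.card_univ, Fintype.card_fun, Fintype.card_fin,
          nsmul_eq_mul, Nat.cast_pow]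
        ring

/-- For families with leading Wronskians that vary slowly on an interval, the mixed determinants
are comparable to the Wronskian, with constants `c` and `C`. -/
def MixedComparable (d : ℕ) (B ε c C : ℝ) : Prop :=
  ∀ (u v : ℝ) (f : ℕ → ℝ → ℝ), u < v →
    (∀ a < d, ContDiffOn ℝ (d - 1 : ℕ) (f a) (Icc u v)) →
    (∀ j ≤ d, ∀ t ∈ Icc u v, ∀ t' ∈ Icc u v,
      0 < wronskian j f (Icc u v) t / wronskian j f (Icc u v) t' ∧
      wronskian j f (Icc u v) t / wronskian j f (Icc u v) t' ≤ B) →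
    (∀ j, 1 ≤ j → j ≤ d → SlowOn (d - j) ε (v - u) (Icc u v) (wronskian j f (Icc u v))) →
    ∀ s : ℕ → ℝ, (∀ b, s b ∈ Icc u v) → ∀ t ∈ Icc u v,
      c ≤ mixedDet d f (Icc u v) s / wronskian d f (Icc u v) t ∧
      mixedDet d f (Icc u v) s / wronskian d f (Icc u v) t ≤ C

/-- Induction on `d`. Write `f a = f 0 * φ a`. Since `φ 0 = 1`, the mixed determinants of `φ` are
those, one size smaller, of the derivatives `g a` of `φ (a + 1)`. The Wronskian of `g` of order `j`
is that of `f` of order `j + 1` over `f 0 ^ (j + 1)`, so it is again slowly varying. Passing from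
`f` back to `φ` costs a relative error proportional to `ε`. -/
theorem exists_mixedComparable (d : ℕ) : ∀ B : ℝ, 1 ≤ B → ∃ ε c C : ℝ, 0 < ε ∧ 0 < c ∧ 0 < C ∧
    MixedComparable d B ε c C := by
  induction d with
  | zero =>
    intro B hB
    exact ⟨1, 1, 1, one_pos, one_pos, one_pos, fun u v f huv _ _ _ s hs t ht => by
      simp [wronskian, mixedDet]⟩
  | succ d ih =>
    intro B hB
    -- A quotient of a Wronskian by `f 0 ^ (j + 1)` has ratios up to `B * B ^ (j + 1)`, with `j ≤
    -- d`.
    obtain ⟨ε', c', C', hε', hc', hC', IH⟩ := ih (B ^ (d + 2)) (one_le_pow₀ hB)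
    set Q : ℝ := (4 ^ d) ^ (d + 1) with hQ
    have hQ1 : 1 ≤ Q := one_le_pow₀ (one_le_pow₀ (by norm_num))
    set K : ℝ := ((d + 1 : ℕ) : ℝ) ^ (d + 1) * (2 ^ (d + 1)) ^ (d + 1) * C' with hK
    have hK0 : 0 < K := by positivity
    -- `Q` is the loss of slowness under division by powers of `f 0`; `ε * K` is the relative error
    -- in comparing `f` with `φ`, which may use up half of `c'`.
    set ε : ℝ := min (min 1 ε' / Q) (c' / (2 * K)) with hε
    have hε0 : 0 < ε := by
      refine lt_min (div_pos (lt_min one_pos hε') (by linarith)) (by positivity)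
    have hεQ : Q * ε ≤ min 1 ε' := by
      calc Q * ε ≤ Q * (min 1 ε' / Q) := by gcongr; exact min_le_left _ _
        _ = _ := by field_simp
    have hεK : ε * K ≤ c' / 2 := by
      calc ε * K ≤ c' / (2 * K) * K := by gcongr; exact min_le_right _ _
        _ = _ := by field_simp
    have hε1 : ε ≤ 1 := by nlinarith [min_le_left 1 ε']
    have hB0 : 0 < B := by linarith
    refine ⟨ε, c' / 2 * (B⁻¹) ^ (d + 1), (C' + c' / 2) * B ^ (d + 1), hε0, by positivity,
      by positivity, ?_⟩
    intro u v f huv hf hratio hslow s hs t ht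
    set I := Icc u v with hI
    have hw : 0 ≤ v - u := by linarith
    have hL1 : ∀ t, wronskian 1 f I t = f 0 t := fun t => by simp [wronskian, mixedDet]
    have hp : SlowOn d ε (v - u) I (f 0) := (hslow 1 le_rfl (by omega)).congr fun t _ => (hL1 t).symm
    have hpr : ∀ t ∈ I, ∀ t' ∈ I, 0 < f 0 t / f 0 t' ∧ f 0 t / f 0 t' ≤ B := by
      intro t ht t' ht'
      have := hratio 1 (by omega) t ht t' ht'
      rwa [hL1, hL1] at this
    set φ : ℕ → ℝ → ℝ := fun a t => f a t / f 0 t with hφ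
    set g : ℕ → ℝ → ℝ := fun a => derivWithin (φ (a + 1)) I with hg
    have hφs : ∀ a < d + 1, ContDiffOn ℝ d (φ a) I := fun a ha =>
      (hf a ha).div (hf 0 (by omega)) hp.ne_zero
    have hφ0 : EqOn (φ 0) (fun _ => 1) I := fun t ht => div_self (hp.ne_zero t ht)
    have hfφ : ∀ a < d + 1, EqOn (f a) (φ a * f 0) I := fun a _ t ht => by
      simp [hφ, hp.ne_zero t ht]
    have hmix : ∀ (j : ℕ) (s : ℕ → ℝ), (∀ b, s b ∈ I) →
        mixedDet (j + 1) φ I s = mixedDet j g I fun b => s (b + 1) := fun j s hs =>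
      mixedDet_succ_of_one hφ0 hs
    have hWφ : ∀ j, ∀ t ∈ I, wronskian (j + 1) φ I t = wronskian j g I t := fun j t ht =>
      hmix j (fun _ => t) fun _ => ht
    have hW : ∀ j ≤ d, ∀ t ∈ I, wronskian (j + 1) f I t = f 0 t ^ (j + 1) * wronskian j g I t := by
      intro j hj t ht
      have hjd : ((j + 1 - 1 : ℕ) : WithTop ℕ∞) ≤ (d : ℕ) := by exact_mod_cast hj
      rw [wronskian_mul huv (n := j + 1) (hp.smooth.of_le hjd)
        (fun a ha => (hφs a (by omega)).of_le hjd) (fun a ha => hfφ a (by omega)) ht, hWφ j t ht]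
    have hWg : ∀ j ≤ d, ∀ t ∈ I, wronskian j g I t = wronskian (j + 1) f I t / f 0 t ^ (j + 1) := by
      intro j hj t ht
      rw [hW j hj t ht, mul_div_cancel_left₀ _ (pow_ne_zero _ (hp.ne_zero t ht))]
    have IH' := IH u v g huv (fun a ha => by
        refine ContDiffOn.derivWithin (hφs (a + 1) (by omega)) (uniqueDiffOn_Icc huv) ?_
        exact_mod_cast (by omega : d - 1 + 1 ≤ d)) (fun j hj x hx y hy => by
        have h1 := hratio (j + 1) (by omega) x hx y hy
        have h2 := hpr y hy x hx
        rw [hWg j hj x hx, hWg j hj y hy, div_div_div_comm, ← div_pow, div_eq_mul_inv, ← inv_pow,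
          inv_div]
        refine ⟨mul_pos h1.1 (pow_pos h2.1 _), ?_⟩
        calc _ ≤ B * B ^ (j + 1) := mul_le_mul h1.2 (pow_le_pow_left₀ h2.1.le h2.2 _)
              (pow_nonneg h2.1.le _) hB0.le
          _ = B ^ (j + 2) := by ring
          _ ≤ B ^ (d + 2) := pow_le_pow_right₀ hB (by omega)) (fun j hj1 hj => by
        have hQj : ((4 : ℝ) ^ (d - j)) ^ (j + 1) ≤ Q := by
          rw [hQ, ← pow_mul, ← pow_mul]
          exact pow_le_pow_right₀ (by norm_num) (Nat.mul_le_mul (by omega) (by omega))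
        have hle : ((4 : ℝ) ^ (d - j)) ^ (j + 1) * ε ≤ min 1 ε' :=
          (mul_le_mul_of_nonneg_right hQj hε0.le).trans hεQ
        have h1 : SlowOn (d - j) ε (v - u) I (wronskian (j + 1) f I) := by
          have := hslow (j + 1) (by omega) (by omega)
          rwa [show d + 1 - (j + 1) = d - j by omega] at this
        exact ((SlowOn.div_pow huv hw hε0.le (hp.of_le (by omega)) h1 (j + 1)
          (hle.trans (min_le_left _ _))).mono (hle.trans (min_le_right _ _))).congr
            fun t ht => hWg j hj t ht)
    have hgd : wronskian d g I t ≠ 0 := by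
      intro h0
      have h1 := (hratio (d + 1) le_rfl t ht t ht).1
      rw [hW d le_rfl t ht, h0] at h1
      simp at h1
    set Lg := wronskian d g I t with hLg
    have hAbs : 0 < |Lg| := abs_pos.2 hgd
    have hA : ∀ s : ℕ → ℝ, (∀ b, s b ∈ I) → |mixedDet (d + 1) φ I s| ≤ C' * |Lg| := by
      intro s hs
      rw [hmix d s hs]
      have h := IH' (fun b => s (b + 1)) (fun b => hs _) t ht
      rw [← div_le_iff₀ hAbs, ← abs_div, abs_of_pos (hc'.trans_le h.1)]
      exact h.2
    have hmain := abs_mixedDet_sub_le huv (n := d + 1) hε0.le hε1 hp hφs hfφ hA hs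
    set P : ℝ := ∏ b : Fin (d + 1), f 0 (s b) with hP
    have hP0 : P ≠ 0 := Finset.prod_ne_zero_iff.2 fun b _ => hp.ne_zero _ (hs b)
    have hPL : 0 < |P| * |Lg| := mul_pos (abs_pos.2 hP0) hAbs
    have hX : |mixedDet (d + 1) f I s / (P * Lg) - mixedDet (d + 1) φ I s / Lg| ≤ c' / 2 := by
      have e : mixedDet (d + 1) f I s / (P * Lg) - mixedDet (d + 1) φ I s / Lg =
          (mixedDet (d + 1) f I s - P * mixedDet (d + 1) φ I s) / (P * Lg) := by
        field_simp
      rw [e, abs_div, abs_mul, div_le_iff₀ hPL]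
      calc _ ≤ ε * (((d + 1 : ℕ) : ℝ) ^ (d + 1) * (2 ^ (d + 1)) ^ (d + 1) * |P| * (C' * |Lg|)) :=
            hmain
        _ = ε * K * (|P| * |Lg|) := by rw [hK]; ring
        _ ≤ _ := by gcongr
    have hY := IH' (fun b => s (b + 1)) (fun b => hs _) t ht
    rw [← hmix d s hs] at hY
    have hX' := abs_le.1 hX
    have hZ : P / f 0 t ^ (d + 1) = ∏ b : Fin (d + 1), f 0 (s b) / f 0 t := by
      rw [Finset.prod_div_distrib]; simp [hP]
    have hZ1 : (B⁻¹) ^ (d + 1) ≤ P / f 0 t ^ (d + 1) := by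
      rw [hZ]
      calc (B⁻¹) ^ (d + 1) = ∏ _b : Fin (d + 1), B⁻¹ := by simp
        _ ≤ _ := Finset.prod_le_prod (fun _ _ => by positivity) fun b _ => by
          have := hpr t ht (s b) (hs b)
          rw [← inv_div]
          exact inv_anti₀ this.1 this.2
    have hZ2 : P / f 0 t ^ (d + 1) ≤ B ^ (d + 1) := by
      rw [hZ]
      calc _ ≤ ∏ _b : Fin (d + 1), B := Finset.prod_le_prod
            (fun b _ => (hpr (s b) (hs b) t ht).1.le) fun b _ => (hpr (s b) (hs b) t ht).2
        _ = _ := by simp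
    have hsplit : mixedDet (d + 1) f I s / wronskian (d + 1) f I t =
        mixedDet (d + 1) f I s / (P * Lg) * (P / f 0 t ^ (d + 1)) := by
      rw [hW d le_rfl t ht, ← hLg]
      have := hp.ne_zero t ht
      field_simp
    rw [hsplit]
    have hZ0 : 0 ≤ P / f 0 t ^ (d + 1) := le_trans (by positivity) hZ1
    constructor
    · exact mul_le_mul (by linarith) hZ1 (by positivity) (by linarith)
    · exact mul_le_mul (by linarith) hZ2 hZ0 (by positivity)

end TorsionDecomp

namespace TorsionDecomp

open Set

/-! ### Hölder classes -/

/-- The Hölder class `C^{n, α}` of real functions on `I`. -/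
def HolderClass (n : ℕ) (α : ℝ) (I : Set ℝ) (f : ℝ → ℝ) : Prop :=
  ContDiffOn ℝ n f I ∧ ∃ H : ℝ, 0 ≤ H ∧ ∀ x ∈ I, ∀ y ∈ I,
    |iteratedDerivWithin n f I x - iteratedDerivWithin n f I y| ≤ H * |x - y| ^ α

theorem holderClass_succ_iff {n : ℕ} {α a b : ℝ} {f : ℝ → ℝ} (hab : a < b) :
    HolderClass (n + 1) α (Icc a b) f ↔ DifferentiableOn ℝ f (Icc a b) ∧
      HolderClass n α (Icc a b) (derivWithin f (Icc a b)) := by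
  unfold HolderClass
  rw [← iteratedDerivWithin_succ', ← and_assoc]
  have := contDiffOn_succ_iff_derivWithin (𝕜 := ℝ) (f := f) (n := (n : WithTop ℕ∞))
    (uniqueDiffOn_Icc hab)
  refine and_congr_left fun _ => ?_
  rw [show ((n + 1 : ℕ) : WithTop ℕ∞) = (n : WithTop ℕ∞) + 1 by norm_cast, this]
  simp

theorem HolderClass.congr {n : ℕ} {α : ℝ} {I : Set ℝ} {f g : ℝ → ℝ} (hf : HolderClass n α I f)
    (h : EqOn g f I) : HolderClass n α I g := by
  obtain ⟨h1, H, h2, h3⟩ := hf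
  refine ⟨h1.congr h, H, h2, fun x hx y hy => ?_⟩
  rw [iteratedDerivWithin_congr h hx, iteratedDerivWithin_congr h hy]
  exact h3 x hx y hy

/-- This turns Lipschitz into Hölder bounds. Adding `1` to the length makes the base at least `1`,
so the exponent `1 - α` may be raised to `1`. -/
theorem abs_le_mul_rpow {a b α x y : ℝ} (hα : 0 ≤ α) (hα1 : α ≤ 1) (hab : a < b)
    (hx : x ∈ Icc a b) (hy : y ∈ Icc a b) : |x - y| ≤ (b - a + 1) * |x - y| ^ α := by
  rcases eq_or_ne x y with rfl | hne
  · simp only [sub_self, abs_zero]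
    have : 0 ≤ (0 : ℝ) ^ α := Real.rpow_nonneg le_rfl _
    nlinarith
  have hpos : 0 < |x - y| := abs_pos.2 (sub_ne_zero.2 hne)
  have hle : |x - y| ≤ b - a :=
    abs_le.2 ⟨by linarith [hx.1, hy.2], by linarith [hx.2, hy.1]⟩
  calc |x - y| = |x - y| ^ (1 - α) * |x - y| ^ α := by
        rw [← Real.rpow_add hpos]; simp
    _ ≤ (b - a + 1) ^ (1 - α) * |x - y| ^ α := by
        gcongr
        linarith
    _ ≤ (b - a + 1) ^ (1 : ℝ) * |x - y| ^ α := by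
        gcongr
        · linarith
        · linarith
    _ = _ := by rw [Real.rpow_one]

theorem exists_abs_le_of_continuousOn {a b : ℝ} {f : ℝ → ℝ} (hf : ContinuousOn f (Icc a b)) :
    ∃ A : ℝ, 0 ≤ A ∧ ∀ x ∈ Icc a b, |f x| ≤ A := by
  obtain ⟨A, hA⟩ := isCompact_Icc.exists_bound_of_continuousOn hf
  exact ⟨max A 0, le_max_right _ _, fun x hx => (hA x hx).trans (le_max_left _ _)⟩

theorem HolderClass.pred {n : ℕ} {α a b : ℝ} (hα : 0 ≤ α) (hα1 : α ≤ 1) (hab : a < b)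
    {f : ℝ → ℝ} (hf : HolderClass (n + 1) α (Icc a b) f) : HolderClass n α (Icc a b) f := by
  have hc : ContDiffOn ℝ (n + 1 : ℕ) f (Icc a b) := hf.1
  refine ⟨hc.of_le (by exact_mod_cast Nat.le_succ n), ?_⟩
  obtain ⟨A, hA0, hA⟩ := exists_abs_le_of_continuousOn
    (hc.continuousOn_iteratedDerivWithin (m := n + 1) le_rfl (uniqueDiffOn_Icc hab))
  refine ⟨A * (b - a + 1), mul_nonneg hA0 (by linarith), fun x hx y hy => ?_⟩
  obtain ⟨ξ, hξ, h⟩ := exists_eq_mul_sub (isJet_iteratedDerivWithin hab hc n (by omega)) hy hx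
  rw [h, abs_mul, mul_assoc]
  gcongr
  · exact hA ξ hξ
  · exact abs_le_mul_rpow hα hα1 hab hx hy

theorem HolderClass.of_le {n m : ℕ} {α a b : ℝ} (hα : 0 ≤ α) (hα1 : α ≤ 1) (hab : a < b)
    {f : ℝ → ℝ} (hf : HolderClass n α (Icc a b) f) (hmn : m ≤ n) :
    HolderClass m α (Icc a b) f := by
  induction n, hmn using Nat.le_induction with
  | base => exact hf
  | succ n _ ih => exact ih (hf.pred hα hα1 hab)

theorem holderClass_const {n : ℕ} {α a b : ℝ} (c : ℝ) :
    HolderClass n α (Icc a b) fun _ => c :=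
  ⟨contDiffOn_const, 0, le_rfl, fun x _ y _ => by simp [iteratedDerivWithin_const]⟩

theorem HolderClass.add {n : ℕ} {α a b : ℝ} (hab : a < b) {f g : ℝ → ℝ}
    (hf : HolderClass n α (Icc a b) f) (hg : HolderClass n α (Icc a b) g) :
    HolderClass n α (Icc a b) (f + g) := by
  obtain ⟨hf1, H, hH, hf2⟩ := hf
  obtain ⟨hg1, K, hK, hg2⟩ := hg
  refine ⟨hf1.add hg1, H + K, by positivity, fun x hx y hy => ?_⟩
  rw [iteratedDerivWithin_add hx (uniqueDiffOn_Icc hab) (hf1 x hx) (hg1 x hx),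
    iteratedDerivWithin_add hy (uniqueDiffOn_Icc hab) (hf1 y hy) (hg1 y hy), add_mul,
    add_sub_add_comm]
  exact (abs_add_le _ _).trans (add_le_add (hf2 x hx y hy) (hg2 x hx y hy))

/-- Induction on `n` through the product rule, the undifferentiated factor being lowered by one
order. -/
theorem HolderClass.mul {n : ℕ} {α a b : ℝ} (hα : 0 ≤ α) (hα1 : α ≤ 1) (hab : a < b)
    {f g : ℝ → ℝ} (hf : HolderClass n α (Icc a b) f) (hg : HolderClass n α (Icc a b) g) :
    HolderClass n α (Icc a b) (f * g) := by
  induction n generalizing f g with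
  | zero =>
    obtain ⟨hf1, H, hH, hf2⟩ := hf
    obtain ⟨hg1, K, hK, hg2⟩ := hg
    obtain ⟨A, hA0, hA⟩ := exists_abs_le_of_continuousOn hf1.continuousOn
    obtain ⟨B, hB0, hB⟩ := exists_abs_le_of_continuousOn hg1.continuousOn
    refine ⟨hf1.mul hg1, A * K + B * H, by positivity, fun x hx y hy => ?_⟩
    have h1 := hf2 x hx y hy
    have h2 := hg2 x hx y hy
    simp only [iteratedDerivWithin_zero, Pi.mul_apply] at h1 h2 ⊢
    calc |f x * g x - f y * g y| = |f x * (g x - g y) + g y * (f x - f y)| := by ring_nf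
      _ ≤ |f x| * |g x - g y| + |g y| * |f x - f y| := by
          rw [← abs_mul, ← abs_mul]; exact abs_add_le _ _
      _ ≤ A * (K * |x - y| ^ α) + B * (H * |x - y| ^ α) := by
          gcongr
          · exact hA x hx
          · exact hB y hy
      _ = _ := by ring
  | succ n ih =>
    have hf' := (holderClass_succ_iff hab).1 hf
    have hg' := (holderClass_succ_iff hab).1 hg
    refine (holderClass_succ_iff hab).2 ⟨hf'.1.mul hg'.1, ?_⟩
    refine ((ih hf'.2 (hg.pred hα hα1 hab)).add hab
      (ih (hf.pred hα hα1 hab) hg'.2)).congr fun t ht => ?_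
    simp only [Pi.add_apply, Pi.mul_apply]
    exact derivWithin_mul (hf'.1 t ht) (hg'.1 t ht)

theorem HolderClass.sum {n : ℕ} {α a b : ℝ} (hab : a < b) {κ : Type*} (s : Finset κ)
    {f : κ → ℝ → ℝ} (hf : ∀ i ∈ s, HolderClass n α (Icc a b) (f i)) :
    HolderClass n α (Icc a b) fun t => ∑ i ∈ s, f i t := by
  classical
  induction s using Finset.induction_on with
  | empty => simpa using holderClass_const 0
  | insert i s his ih =>
    simp only [Finset.sum_insert his]
    exact (hf i (by simp)).add hab (ih fun j hj => hf j (by simp [hj]))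

theorem HolderClass.prod {n : ℕ} {α a b : ℝ} (hα : 0 ≤ α) (hα1 : α ≤ 1) (hab : a < b)
    {κ : Type*} (s : Finset κ)
    {f : κ → ℝ → ℝ} (hf : ∀ i ∈ s, HolderClass n α (Icc a b) (f i)) :
    HolderClass n α (Icc a b) fun t => ∏ i ∈ s, f i t := by
  classical
  induction s using Finset.induction_on with
  | empty => simpa using holderClass_const 1
  | insert i s his ih =>
    simp only [Finset.prod_insert his]
    exact (hf i (by simp)).mul hα hα1 hab (ih fun j hj => hf j (by simp [hj]))

theorem HolderClass.det {n m : ℕ} {α a b : ℝ} (hα : 0 ≤ α) (hα1 : α ≤ 1) (hab : a < b)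
    {M : ℝ → Matrix (Fin m) (Fin m) ℝ}
    (hM : ∀ i j, HolderClass n α (Icc a b) fun t => M t i j) :
    HolderClass n α (Icc a b) fun t => (M t).det := by
  simp only [Matrix.det_apply']
  exact HolderClass.sum hab _ fun σ _ => (holderClass_const _).mul hα hα1 hab
    (HolderClass.prod hα hα1 hab _ fun i _ => hM _ _)

theorem HolderClass.of_iteratedDeriv {n m : ℕ} {α a b : ℝ} (hab : a < b) {f : ℝ → ℝ}
    (hf : HolderClass (n + m) α (Icc a b) f) :
    HolderClass n α (Icc a b) (iteratedDerivWithin m f (Icc a b)) := by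
  induction m generalizing f with
  | zero => simpa using hf
  | succ m ih =>
    rw [iteratedDerivWithin_succ']
    exact ih ((holderClass_succ_iff hab).1 hf).2

/-! ### Level sets of functions in a Hölder class -/

/-- Near a point where `f` is far from the level `c`, the level `c` is attained at most `n` times. -/
theorem HolderClass.exists_level_finset {n : ℕ} {α a b H u v c : ℝ} (hα : 0 ≤ α) (hab : a < b)
    {f : ℝ → ℝ} (hf : ContDiffOn ℝ n f (Icc a b)) (hH0 : 0 ≤ H) (hH : ∀ x ∈ Icc a b, ∀ y ∈ Icc a b,
      |iteratedDerivWithin n f (Icc a b) x - iteratedDerivWithin n f (Icc a b) y| ≤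
        H * |x - y| ^ α) (hsub : Icc u v ⊆ Icc a b) :
    ∃ Z : Finset ℝ, Z.card ≤ n ∧ (∀ z ∈ Z, z ∈ Icc u v) ∧
      ((∃ t ∈ Icc u v, H * (v - u) ^ ((n : ℝ) + α) < |f t - c|) →
        ∀ x ∈ Icc u v, f x = c → x ∈ Z) := by
  by_cases hex : ∃ t ∈ Icc u v, H * (v - u) ^ ((n : ℝ) + α) < |f t - c|
  swap
  · exact ⟨∅, by simp, by simp, fun h => absurd h hex⟩
  obtain ⟨t, ht, hlt⟩ := hex
  set S : Set ℝ := {x | x ∈ Icc u v ∧ f x = c} with hS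
  -- With `n + 1` solutions, `f - c` would be at most `H (v - u) ^ (n + α)` on the whole interval,
  -- against the choice of `t`.
  have hcard : ∀ Z : Finset ℝ, (Z : Set ℝ) ⊆ S → Z.card ≤ n := by
    intro Z hZ
    by_contra hcon
    push Not at hcon
    let G : ℕ → ℝ → ℝ := fun i x => iteratedDerivWithin i f (Icc a b) x - if i = 0 then c else 0
    have hG : IsJet n G (Icc u v) := fun j hj x hx => by
      have h1 := (isJet_iteratedDerivWithin hab hf j hj x (hsub hx)).mono hsub
      have h2 := h1.sub_const (if j = 0 then c else 0)
      convert h2 using 1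
      simp [G]
    have := hG.abs_le_of_zeros hα hH0 (fun x hx y hy => by
      simpa [G] using hH x (hsub hx) y (hsub hy)) Z hcon (fun z hz => (hZ hz).1)
      (fun z hz => by simp [G, (hZ hz).2]) ht
    simp only [G, iteratedDerivWithin_zero, if_true] at this
    linarith
  have hfin : S.Finite := by
    by_contra hinf
    obtain ⟨Z, hZ, hc⟩ := Set.Infinite.exists_subset_card_eq (s := S) hinf (n + 1)
    have := hcard Z hZ
    omega
  refine ⟨hfin.toFinset, hcard _ (by simp), fun z hz => ?_, fun _ x hx hxc => ?_⟩
  · have := hfin.mem_toFinset.1 hz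
    exact this.1
  · exact hfin.mem_toFinset.2 ⟨hx, hxc⟩

theorem exists_abs_eq_of_lt {f : ℝ → ℝ} {u v s t c : ℝ} (hf : ContinuousOn f (Icc u v))
    (hs : s ∈ Icc u v) (ht : t ∈ Icc u v) (h1 : |f s| < c) (h2 : c < |f t|) :
    ∃ x ∈ Ioo u v, |f x| = c := by
  have hsub : uIcc s t ⊆ Icc u v := uIcc_subset_Icc hs ht
  have hcont : ContinuousOn (fun x => |f x|) (uIcc s t) := (hf.mono hsub).abs
  obtain ⟨x, hx, hxc⟩ := intermediate_value_uIcc hcont (mem_uIcc_of_le h1.le h2.le)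
  have hxs : x ≠ s := by rintro rfl; simp only at hxc; linarith
  have hxt : x ≠ t := by rintro rfl; simp only at hxc; linarith
  refine ⟨x, ?_, hxc⟩
  rcases le_total s t with h | h
  · rw [uIcc_of_le h] at hx
    exact ⟨hs.1.trans_lt (lt_of_le_of_ne hx.1 hxs.symm), (lt_of_le_of_ne hx.2 hxt).trans_le ht.2⟩
  · rw [uIcc_of_ge h] at hx
    exact ⟨ht.1.trans_lt (lt_of_le_of_ne hx.1 hxt.symm), (lt_of_le_of_ne hx.2 hxs).trans_le hs.2⟩

/-- The level set `|f| ≈ lam` of a function of class `C^{n, α}` is, up to a controlled number of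
breakpoints, made of intervals on which `|f| ≈ lam` and the derivatives of `f` are controlled. -/
theorem HolderClass.exists_breakpoints {n : ℕ} {α a b : ℝ} (hα : 0 ≤ α) (hβ : 0 < (n : ℝ) + α)
    (hab : a < b) {f : ℝ → ℝ} (hf : HolderClass n α (Icc a b) f) {Λ : ℝ} (hΛ : 0 < Λ) :
    ∃ K Q : ℝ, 0 < K ∧ 0 < Q ∧ ∀ lam : ℝ, 0 < lam → lam ≤ Λ → ∃ Z : Finset ℝ,
      (∀ z ∈ Z, z ∈ Icc a b) ∧ (Z.card : ℝ) ≤ K * lam ^ (-(1 / ((n : ℝ) + α))) ∧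
      ∀ u v : ℝ, u < v → Icc u v ⊆ Icc a b → (∀ z ∈ Z, z ∉ Ioo u v) →
        (∃ t ∈ Icc u v, lam / 2 ≤ |f t| ∧ |f t| ≤ lam) →
        (∀ s ∈ Icc u v, 3 / 8 * lam ≤ |f s| ∧ |f s| ≤ 3 / 2 * lam) ∧
        ∀ i ≤ n, ∀ s ∈ Icc u v,
          |iteratedDerivWithin i f (Icc a b) s| * (v - u) ^ i ≤ Q * lam := by
  classical
  obtain ⟨hfs, H₀, hH₀, hHol₀⟩ := hf
  obtain ⟨C, hC1, hC⟩ := exists_jet_bound n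
  set β : ℝ := (n : ℝ) + α with hβdef
  set H : ℝ := H₀ + 1 with hHdef
  have hH : 0 < H := by linarith
  have hHol : ∀ x ∈ Icc a b, ∀ y ∈ Icc a b,
      |iteratedDerivWithin n f (Icc a b) x - iteratedDerivWithin n f (Icc a b) y| ≤
        H * |x - y| ^ α := fun x hx y hy => (hHol₀ x hx y hy).trans (by gcongr; linarith)
  have hL : 0 < b - a := sub_pos.2 hab
  set X : ℝ := (b - a) * (16 * H) ^ (1 / β) with hX
  have hX0 : 0 < X := by positivity
  -- For `m` cells there are `m + 1` grid points and at most `n` points per cell and level, with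
  -- four levels. The term `2 * Λ ^ (1 / β)` pays for rounding `m` up, because `lam ≤ Λ`.
  set K : ℝ := (5 + 4 * n) * (X + 2 * Λ ^ (1 / β)) with hK
  refine ⟨K, C * (3 / 2), by positivity, by linarith, ?_⟩
  intro lam hlam hlamΛ
  -- the number of cells
  set m : ℕ := ⌈X * lam ^ (-(1 / β))⌉₊ + 1 with hm
  have hlp : 0 < lam ^ (-(1 / β)) := by positivity
  have hm0 : (0 : ℝ) < m := by simp only [hm]; positivity
  have hmX : X * lam ^ (-(1 / β)) ≤ m := by
    simp only [hm]; push_cast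
    linarith [Nat.le_ceil (X * lam ^ (-(1 / β)))]
  have hone : 1 ≤ Λ ^ (1 / β) * lam ^ (-(1 / β)) := by
    rw [Real.rpow_neg hlam.le, ← div_eq_mul_inv, one_le_div (by positivity)]
    exact Real.rpow_le_rpow hlam.le hlamΛ (by positivity)
  have hmK : (m : ℝ) ≤ (X + 2 * Λ ^ (1 / β)) * lam ^ (-(1 / β)) := by
    have := (Nat.ceil_lt_add_one (by positivity : 0 ≤ X * lam ^ (-(1 / β)))).le
    simp only [hm]; push_cast
    nlinarith
  set ℓ : ℝ := (b - a) / m with hℓ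
  have hℓ0 : 0 < ℓ := by positivity
  -- Cells this short take at most `n` times any level that lies farther than `lam / 16` from some
  -- value of `f` in the cell.
  have hℓβ : H * ℓ ^ β ≤ lam / 16 := by
    have h1 : ℓ ≤ (16 * H) ^ (-(1 / β)) * lam ^ (1 / β) := by
      rw [hℓ, div_le_iff₀ hm0]
      calc b - a = (16 * H) ^ (-(1 / β)) * lam ^ (1 / β) * (X * lam ^ (-(1 / β))) := by
            rw [hX, Real.rpow_neg hlam.le, Real.rpow_neg (by positivity)]
            field_simp
        _ ≤ _ := by gcongr
    calc H * ℓ ^ β ≤ H * ((16 * H) ^ (-(1 / β)) * lam ^ (1 / β)) ^ β := by gcongr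
      _ = H * ((16 * H)⁻¹ * lam) := by
          rw [Real.mul_rpow (by positivity) (by positivity), ← Real.rpow_mul (by positivity),
            ← Real.rpow_mul hlam.le]
          have e : 1 / β * β = 1 := by field_simp
          rw [neg_mul, e, Real.rpow_one, Real.rpow_neg (by positivity), Real.rpow_one]
      _ = lam / 16 := by field_simp
  let x : ℕ → ℝ := fun i => a + i * ℓ
  have hxm : x m = b := by simp only [x, hℓ]; field_simp; ring
  have hxmono : Monotone x := fun i j hij => by
    simp only [x]
    have : (i : ℝ) ≤ j := by exact_mod_cast hij
    gcongr
  have hxa : ∀ i, a ≤ x i := fun i => by simp only [x]; have : 0 ≤ i * ℓ := by positivity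
                                         linarith
  have hxb : ∀ i ≤ m, x i ≤ b := fun i hi => hxm ▸ hxmono hi
  have hcell : ∀ i < m, Icc (x i) (x (i + 1)) ⊆ Icc a b := fun i hi =>
    Icc_subset_Icc (hxa i) (hxb (i + 1) hi)
  have hxlen : ∀ i, x (i + 1) - x i = ℓ := fun i => by simp only [x]; push_cast; ring
  have hlev : ∀ (i : ℕ) (c : ℝ), ∃ Z : Finset ℝ, Z.card ≤ n ∧ (i < m → (∀ z ∈ Z, z ∈ Icc a b) ∧
      ((∃ t ∈ Icc (x i) (x (i + 1)), H * ℓ ^ β < |f t - c|) →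
        ∀ y ∈ Icc (x i) (x (i + 1)), f y = c → y ∈ Z)) := by
    intro i c
    by_cases hi : i < m
    · obtain ⟨Z, h1, h2, h3⟩ := exists_level_finset (c := c) hα hab hfs hH.le hHol (hcell i hi)
      rw [hxlen] at h3
      exact ⟨Z, h1, fun _ => ⟨fun z hz => hcell i hi (h2 z hz), h3⟩⟩
    · exact ⟨∅, by simp, fun h => absurd h hi⟩
  choose W hWc hW using hlev
  -- These levels bound the allowed range of `|f|` and stay at distance at least `lam / 8` from the
  -- band `lam / 2 ≤ |f| ≤ lam`, beyond the threshold `lam / 16`.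
  set lev : Finset ℝ := {3 / 8 * lam, -(3 / 8 * lam), 3 / 2 * lam, -(3 / 2 * lam)} with hlevd
  have hlevc : lev.card ≤ 4 := Finset.card_le_four
  refine ⟨(Finset.range (m + 1)).image x ∪
    (Finset.range m).biUnion fun i => lev.biUnion fun c => W i c, ?_, ?_, ?_⟩
  · intro z hz
    simp only [Finset.mem_union, Finset.mem_image, Finset.mem_range, Finset.mem_biUnion] at hz
    rcases hz with ⟨i, hi, rfl⟩ | ⟨i, hi, c, _, hz⟩
    · exact ⟨hxa i, hxb i (by omega)⟩
    · exact (hW i c hi).1 z hz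
  · have h1 : ((Finset.range (m + 1)).image x ∪
        (Finset.range m).biUnion fun i => lev.biUnion fun c => W i c).card ≤
        (m + 1) + m * (4 * n) := by
      refine (Finset.card_union_le _ _).trans (add_le_add ?_ ?_)
      · exact Finset.card_image_le.trans (by simp)
      · refine (Finset.card_biUnion_le_card_mul _ _ (4 * n) fun i _ => ?_).trans (by simp)
        exact (Finset.card_biUnion_le_card_mul _ _ n fun c _ => hWc i c).trans
          (Nat.mul_le_mul_right _ hlevc)
    have hm1 : 1 ≤ m := by omega
    have h2 : (m + 1) + m * (4 * n) ≤ (5 + 4 * n) * m := by nlinarith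
    calc _ ≤ (((5 + 4 * n) * m : ℕ) : ℝ) := by exact_mod_cast h1.trans h2
      _ = (5 + 4 * n) * (m : ℝ) := by push_cast; ring
      _ ≤ (5 + 4 * n) * ((X + 2 * Λ ^ (1 / β)) * lam ^ (-(1 / β))) := by gcongr
      _ = _ := by rw [hK]; ring
  · intro u v huv hsub hno ⟨t, ht, ht1, ht2⟩
    have hu := hsub (left_mem_Icc.2 huv.le)
    have hv := hsub (right_mem_Icc.2 huv.le)
    -- the cell containing the interval
    obtain ⟨i, him, hiu, hiv⟩ : ∃ i < m, x i ≤ u ∧ v ≤ x (i + 1) := by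
      set i : ℕ := ⌊(u - a) / ℓ⌋₊ with hi
      have hnn : 0 ≤ (u - a) / ℓ := div_nonneg (by linarith [hu.1]) hℓ0.le
      have h1 : x i ≤ u := by
        have := Nat.floor_le hnn
        rw [le_div_iff₀ hℓ0] at this
        simp only [x]; linarith
      have h2 : u < x (i + 1) := by
        have := Nat.lt_floor_add_one ((u - a) / ℓ)
        rw [div_lt_iff₀ hℓ0] at this
        simp only [x]; push_cast; linarith
      have him : i < m := by
        by_contra hcon
        push Not at hcon
        have := hxmono hcon
        rw [hxm] at this
        linarith [hv.2]
      refine ⟨i, him, h1, ?_⟩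
      by_contra hcon
      push Not at hcon
      refine hno (x (i + 1)) ?_ ⟨h2, hcon⟩
      exact Finset.mem_union_left _ (Finset.mem_image_of_mem _ (by simp; omega))
    have hsubc : Icc u v ⊆ Icc (x i) (x (i + 1)) := Icc_subset_Icc hiu hiv
    have hnolev : ∀ c ∈ lev, lam / 8 ≤ |f t - c| → ∀ y ∈ Ioo u v, f y ≠ c := by
      intro c hc hct y hy hyc
      refine hno y (Finset.mem_union_right _ ?_) hy
      simp only [Finset.mem_biUnion, Finset.mem_range]
      refine ⟨i, him, c, hc, (hW i c him).2 ⟨t, hsubc ht, ?_⟩ y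
        (hsubc (Ioo_subset_Icc_self hy)) hyc⟩
      linarith
    have hfar : ∀ c ∈ lev, lam / 8 ≤ |f t - c| := by
      intro c hc
      have h1 := abs_sub_abs_le_abs_sub (f t) c
      have h2 := abs_sub_abs_le_abs_sub c (f t)
      rw [abs_sub_comm c] at h2
      have hcabs : |c| = 3 / 8 * lam ∨ |c| = 3 / 2 * lam := by
        simp only [hlevd, Finset.mem_insert, Finset.mem_singleton] at hc
        rcases hc with rfl | rfl | rfl | rfl
        · left; rw [abs_of_pos (by positivity)]
        · left; rw [abs_neg, abs_of_pos (by positivity)]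
        · right; rw [abs_of_pos (by positivity)]
        · right; rw [abs_neg, abs_of_pos (by positivity)]
      rcases hcabs with h | h <;> rw [h] at h1 h2 <;> linarith
    have hcontf : ContinuousOn f (Icc u v) := hfs.continuousOn.mono hsub
    have hnoabs : ∀ y ∈ Ioo u v, |f y| ≠ 3 / 8 * lam ∧ |f y| ≠ 3 / 2 * lam := by
      intro y hy
      constructor
      · intro h
        rcases eq_or_eq_neg_of_abs_eq h with h | h
        · exact hnolev _ (by simp [hlevd]) (hfar _ (by simp [hlevd])) y hy h
        · exact hnolev _ (by simp [hlevd]) (hfar _ (by simp [hlevd])) y hy h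
      · intro h
        rcases eq_or_eq_neg_of_abs_eq h with h | h
        · exact hnolev _ (by simp [hlevd]) (hfar _ (by simp [hlevd])) y hy h
        · exact hnolev _ (by simp [hlevd]) (hfar _ (by simp [hlevd])) y hy h
    have hrange : ∀ s ∈ Icc u v, 3 / 8 * lam ≤ |f s| ∧ |f s| ≤ 3 / 2 * lam := by
      intro s hs
      constructor
      · by_contra hcon
        push Not at hcon
        obtain ⟨y, hy, h⟩ := exists_abs_eq_of_lt hcontf hs ht hcon (by linarith)
        exact (hnoabs y hy).1 h
      · by_contra hcon
        push Not at hcon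
        obtain ⟨y, hy, h⟩ := exists_abs_eq_of_lt hcontf ht hs (by linarith) hcon
        exact (hnoabs y hy).2 h
    refine ⟨hrange, fun k hk s hs => ?_⟩
    have hJ := (isJet_iteratedDerivWithin hab hfs).mono le_rfl hsub
    have := hC u v (3 / 2 * lam) H α _ huv hα (by positivity) hH.le hJ (by simpa using hcontf)
      (by simpa using fun y hy1 hy2 => (hrange y ⟨hy1, hy2⟩).2)
      (fun y hy z hz => hHol y (hsub hy) z (hsub hz)) (by
        have : v - u ≤ ℓ := by rw [← hxlen i]; linarith
        calc H * (v - u) ^ β ≤ H * ℓ ^ β := by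
              have : 0 ≤ v - u := by linarith
              gcongr
          _ ≤ _ := by linarith) k hk s hs
    calc _ ≤ C * (3 / 2 * lam) := this
      _ = _ := by ring

end TorsionDecomp

namespace TorsionDecomp

open Set

/-! ### The Jacobian -/

theorem hasFDerivWithinAt_sumMap {d : ℕ} {ζ ζ' : ℝ → Fin d → ℝ} {S : Set ℝ}
    (hζ : ∀ x ∈ S, HasDerivWithinAt ζ (ζ' x) S x) {t : Fin d → ℝ} (ht : ∀ i, t i ∈ S) :
    HasFDerivWithinAt (sumMap ζ)
      (∑ i, (ContinuousLinearMap.proj (R := ℝ) (φ := fun _ : Fin d => ℝ) i).smulRight (ζ' (t i)))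
      (univ.pi fun _ => S) t := by
  have h : ∀ i : Fin d, HasFDerivWithinAt (fun x : Fin d → ℝ => ζ (x i))
      ((ContinuousLinearMap.proj (R := ℝ) (φ := fun _ : Fin d => ℝ) i).smulRight (ζ' (t i)))
      (univ.pi fun _ => S) t := by
    intro i
    have h1 := (hζ (t i) (ht i)).hasFDerivWithinAt
    have h2 : HasFDerivWithinAt (fun x : Fin d → ℝ => x i)
        (ContinuousLinearMap.proj (R := ℝ) (φ := fun _ : Fin d => ℝ) i) (univ.pi fun _ => S) t :=
      (ContinuousLinearMap.proj (R := ℝ) (φ := fun _ : Fin d => ℝ) i).hasFDerivWithinAt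
    have h3 := HasFDerivWithinAt.comp t h1 h2 fun x hx => hx i (mem_univ i)
    refine h3.congr_fderiv ?_
    ext
    simp
  exact HasFDerivWithinAt.fun_sum fun i _ => h i

theorem jacobianSumMap_eq_det {d : ℕ} {ζ ζ' : ℝ → Fin d → ℝ} {u v : ℝ} (huv : u < v)
    (hζ : ∀ x ∈ Icc u v, HasDerivWithinAt ζ (ζ' x) (Icc u v) x) {t : Fin d → ℝ}
    (ht : ∀ i, t i ∈ Icc u v) :
    jacobianSumMap ζ (Icc u v) t = (Matrix.of fun b => ζ' (t b)).det := by
  have hu : UniqueDiffWithinAt ℝ (univ.pi fun _ : Fin d => Icc u v) t :=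
    UniqueDiffOn.univ_pi (fun _ => uniqueDiffOn_Icc huv) t fun i _ => ht i
  rw [jacobianSumMap, (hasFDerivWithinAt_sumMap hζ ht).fderivWithin hu, ContinuousLinearMap.det,
    ← LinearMap.det_toMatrix', ← Matrix.det_transpose]
  congr 1
  ext b a
  rw [Matrix.transpose_apply, LinearMap.toMatrix'_apply]
  simp [Pi.single_apply, Finset.sum_apply, ite_apply]

/-- Mean value theorem for determinants: the determinant of the values of a curve is the
Vandermonde determinant times a determinant of derivatives. -/
theorem exists_det_eq_vandermonde {d : ℕ} {u v : ℝ} {G : ℕ → ℝ → Fin d → ℝ}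
    (hG : IsJet (d - 1) G (Icc u v)) {t : Fin d → ℝ} (ht : ∀ b, t b ∈ Icc u v) :
    ∃ s : Fin d → ℝ, (∀ b, s b ∈ Icc u v) ∧
      (Matrix.of fun b => G 0 (t b)).det * ∏ b : Fin d, ((b : ℕ).factorial : ℝ) =
        (Matrix.vandermonde t).det * (Matrix.of fun b : Fin d => G b (s b)).det := by
  classical
  by_cases hinj : Function.Injective t
  swap
  · refine ⟨t, ht, ?_⟩
    rw [Function.not_injective_iff] at hinj
    obtain ⟨i, j, hij, hne⟩ := hinj
    rw [Matrix.det_zero_of_row_eq hne (by ext; simp [hij]),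
      Matrix.det_zero_of_row_eq hne (by ext; simp [hij, Matrix.vandermonde_apply])]
    simp
  -- In `N k` the last `k` rows are already derivatives. Rows are treated from the last upwards: as
  -- a function of the point of row `b`, the determinant vanishes at the points of the rows above,
  -- which still hold values of `G 0`. The Lagrange remainder then gives the factor `∏ (t b - t i)`
  -- over `b!`.
  let N : ℕ → (Fin d → ℝ) → Matrix (Fin d) (Fin d) ℝ := fun k s =>
    Matrix.of fun b => if (b : ℕ) < d - k then G 0 (t b) else G b (s b)
  have key : ∀ k ≤ d, ∃ s : Fin d → ℝ, (∀ b, s b ∈ Icc u v) ∧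
      (Matrix.of fun b => G 0 (t b)).det *
        ∏ b ∈ Finset.univ.filter (fun b : Fin d => d - k ≤ b), ((b : ℕ).factorial : ℝ) =
      (∏ b ∈ Finset.univ.filter (fun b : Fin d => d - k ≤ b), ∏ i ∈ Finset.Iio b, (t b - t i)) *
        (N k s).det := by
    intro k
    induction k with
    | zero =>
      intro _
      refine ⟨t, ht, ?_⟩
      have h1 : Finset.univ.filter (fun b : Fin d => d - 0 ≤ (b : ℕ)) = ∅ := by
        ext b; simp
      have h2 : N 0 t = Matrix.of fun b => G 0 (t b) := by
        ext b a; simp [N]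
      rw [h1, h2]
      simp
    | succ k ih =>
      intro hk
      obtain ⟨s, hs, h⟩ := ih (by omega)
      let b₀ : Fin d := ⟨d - (k + 1), by omega⟩
      set M := N k s with hM
      have hrow : ∀ c : Fin d, (c : ℕ) < d - k → M c = G 0 (t c) := fun c hc => by
        simp only [hM, N]
        exact if_pos hc
      let g : ℕ → ℝ → ℝ := fun i x => (M.updateRow b₀ (G i x)).det
      have hg : IsJet (b₀ : ℕ) g (Icc u v) := fun j hj x hx =>
        hasDerivWithinAt_det_updateRow M b₀ (hG j (by simp only [b₀] at hj; omega) x hx)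
      have hgt : g 0 (t b₀) = M.det := by
        simp only [g]
        rw [← hrow b₀ (by simp only [b₀]; omega), Matrix.updateRow_eq_self]
      obtain ⟨ξ, hξ, h'⟩ := hg.exists_eq_prod_mul ((Finset.Iio b₀).image t)
        (by rw [Finset.card_image_of_injective _ hinj, Fin.card_Iio])
        (by simpa using fun i _ => ht i)
        (by
          simp only [Finset.mem_image, Finset.mem_Iio]
          rintro z ⟨i, hi, rfl⟩
          refine Matrix.det_zero_of_row_eq hi.ne ?_
          rw [Matrix.updateRow_self, Matrix.updateRow_ne hi.ne]
          exact hrow i (by have : (i : ℕ) < b₀ := hi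
                           simp only [b₀] at this; omega)) (ht b₀)
      rw [hgt, Finset.prod_image hinj.injOn] at h'
      refine ⟨Function.update s b₀ ξ, fun b => ?_, ?_⟩
      · by_cases hb : b = b₀
        · subst hb; simpa using hξ
        · simpa [hb] using hs b
      have hfil : Finset.univ.filter (fun b : Fin d => d - (k + 1) ≤ (b : ℕ)) =
          insert b₀ (Finset.univ.filter (fun b : Fin d => d - k ≤ (b : ℕ))) := by
        ext b
        simp only [Finset.mem_filter, Finset.mem_univ, true_and, Finset.mem_insert, b₀,
          Fin.ext_iff]
        omega
      have hnot : b₀ ∉ Finset.univ.filter (fun b : Fin d => d - k ≤ (b : ℕ)) := by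
        simp only [Finset.mem_filter, Finset.mem_univ, true_and, b₀]
        omega
      have hN : N (k + 1) (Function.update s b₀ ξ) = M.updateRow b₀ (G b₀ ξ) := by
        ext b a
        by_cases hb : b = b₀
        · subst hb
          simp [N, b₀]
        · have hb' : (b : ℕ) ≠ d - (k + 1) := fun h => hb (Fin.ext h)
          rw [Matrix.updateRow_ne hb]
          simp only [N, hM, Matrix.of_apply, Function.update_of_ne hb]
          by_cases h1 : (b : ℕ) < d - (k + 1)
          · rw [if_pos h1, if_pos (by omega)]
          · rw [if_neg h1, if_neg (by omega)]
      rw [hfil, Finset.prod_insert hnot, Finset.prod_insert hnot, hN]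
      calc _ = ((b₀ : ℕ).factorial : ℝ) * ((Matrix.of fun b => G 0 (t b)).det *
            ∏ b ∈ Finset.univ.filter (fun b : Fin d => d - k ≤ b), ((b : ℕ).factorial : ℝ)) := by
            ring
        _ = (∏ b ∈ Finset.univ.filter (fun b : Fin d => d - k ≤ b),
            ∏ i ∈ Finset.Iio b, (t b - t i)) * (M.det * (b₀ : ℕ).factorial) := by
            rw [h]; ring
        _ = _ := by rw [h']; ring
  obtain ⟨s, hs, h⟩ := key d le_rfl
  refine ⟨s, hs, ?_⟩
  have hN : N d s = Matrix.of fun b : Fin d => G b (s b) := by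
    ext b a; simp [N]
  rw [hN] at h
  simp only [Nat.sub_self, Nat.zero_le, Finset.filter_true] at h
  rw [h, Matrix.det_vandermonde]
  congr 1
  refine Finset.prod_comm' fun i j => ?_
  simp

/-! ### Injectivity of the sum map -/

/-- Otherwise `f` would be strictly monotone on `[x, z]`, and two increments with weights not of
opposite sign could not cancel; `hnd` keeps at least one term nonzero. -/
theorem exists_deriv_zero_of_combination {f f' : ℝ → ℝ} {u v : ℝ}
    (hf : ∀ t ∈ Icc u v, HasDerivWithinAt f (f' t) (Icc u v) t) {x y z A B : ℝ}
    (hx : x ∈ Icc u v) (hz : z ∈ Icc u v) (hxy : x ≤ y) (hyz : y ≤ z) (hA : A ≠ 0)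
    (hAB : 0 ≤ A * B) (hnd : x < y ∨ (B ≠ 0 ∧ y < z))
    (h : A * (f y - f x) + B * (f z - f y) = 0) : ∃ ξ ∈ Ioo x z, f' ξ = 0 := by
  by_contra hcon
  push Not at hcon
  have hxz : x < z := by rcases hnd with h | h <;> [linarith; linarith [h.2]]
  have hsub : Icc x z ⊆ Icc u v := Icc_subset_Icc hx.1 hz.2
  have hcont : ContinuousOn f (Icc x z) := fun t ht =>
    ((hf t (hsub ht)).mono hsub).continuousWithinAt
  have hinj : InjOn f (Icc x z) := by
    intro p hp q hq hpq
    by_contra hne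
    rcases lt_or_gt_of_ne hne with hlt | hlt
    · obtain ⟨ξ, hξ, h0⟩ := exists_deriv_zero_Ioo hf (hsub hp) (hsub hq) hlt hpq
      exact hcon ξ ⟨hp.1.trans_lt hξ.1, hξ.2.trans_le hq.2⟩ h0
    · obtain ⟨ξ, hξ, h0⟩ := exists_deriv_zero_Ioo hf (hsub hq) (hsub hp) hlt hpq.symm
      exact hcon ξ ⟨hq.1.trans_lt hξ.1, hξ.2.trans_le hp.2⟩ h0
  have hx' : x ∈ Icc x z := left_mem_Icc.2 hxz.le
  have hy' : y ∈ Icc x z := ⟨hxy, hyz⟩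
  have hz' : z ∈ Icc x z := right_mem_Icc.2 hxz.le
  have hA2 : 0 < A ^ 2 := by positivity
  have h2 : A ^ 2 * (f y - f x) + A * B * (f z - f y) = 0 := by linear_combination A * h
  rcases hcont.strictMonoOn_of_injOn_Icc' hxz.le hinj with hm | hm
  · have h3 : 0 ≤ f y - f x := sub_nonneg.2 (hm.monotoneOn hx' hy' hxy)
    have h4 : 0 ≤ f z - f y := sub_nonneg.2 (hm.monotoneOn hy' hz' hyz)
    rcases hnd with hlt | ⟨hB, hlt⟩
    · have := hm hx' hy' hlt
      nlinarith [mul_nonneg hAB h4, mul_pos hA2 (sub_pos.2 this)]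
    · have := hm hy' hz' hlt
      have hAB' : 0 < A * B := lt_of_le_of_ne hAB (mul_ne_zero hA hB).symm
      nlinarith [mul_pos hAB' (sub_pos.2 this), mul_nonneg hA2.le h3]
  · have h3 : 0 ≤ f x - f y := sub_nonneg.2 (hm.antitoneOn hx' hy' hxy)
    have h4 : 0 ≤ f y - f z := sub_nonneg.2 (hm.antitoneOn hy' hz' hyz)
    rcases hnd with hlt | ⟨hB, hlt⟩
    · have := hm hx' hy' hlt
      nlinarith [mul_nonneg hAB h4, mul_pos hA2 (sub_pos.2 this)]
    · have := hm hy' hz' hlt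
      have hAB' : 0 < A * B := lt_of_le_of_ne hAB (mul_ne_zero hA hB).symm
      nlinarith [mul_pos hAB' (sub_pos.2 this), mul_nonneg hA2.le h3]

/-- Summation by parts with the increments grouped in pairs, so that `2 * n` points leave only `n`
vectors. -/
theorem sum_range_even_by_parts {E : Type*} [AddCommGroup E] (ε : ℕ → ℤ) (g : ℕ → E) (n : ℕ) :
    ∑ k ∈ Finset.range (2 * n), ε k • g k =
      (∑ i ∈ Finset.range (2 * n), ε i) • g (2 * n) - ∑ j ∈ Finset.range n,
        ((∑ i ∈ Finset.range (2 * j + 1), ε i) • (g (2 * j + 1) - g (2 * j)) +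
          (∑ i ∈ Finset.range (2 * j + 2), ε i) • (g (2 * j + 2) - g (2 * j + 1))) := by
  induction n with
  | zero => simp
  | succ n ih =>
    rw [show 2 * (n + 1) = 2 * n + 1 + 1 by ring, Finset.sum_range_succ, Finset.sum_range_succ, ih,
      Finset.sum_range_succ _ n]
    simp only [Finset.sum_range_succ _ (2 * n + 1), Finset.sum_range_succ _ (2 * n)]
    module

theorem partial_sum_parity (ε : ℕ → ℤ) (hε : ∀ k, ε k = 1 ∨ ε k = -1) (n : ℕ) :
    (∑ i ∈ Finset.range n, ε i) % 2 = (n : ℤ) % 2 := by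
  induction n with
  | zero => simp
  | succ n ih =>
    rw [Finset.sum_range_succ]
    rcases hε n with h | h <;> rw [h] <;> push_cast <;> omega

/-- A vanishing signed sum of values of a curve over an increasing sequence of points, when no
`d` distinct tangent vectors are dependent, has coinciding consecutive pairs of points. -/
theorem pairs_eq_of_signed_sum_eq_zero {d : ℕ} {ζ ζ' : ℝ → Fin d → ℝ} {u v : ℝ}
    (hζ : ∀ x ∈ Icc u v, HasDerivWithinAt ζ (ζ' x) (Icc u v) x)
    (hdet : ∀ y : Fin d → ℝ, StrictMono y → (∀ i, y i ∈ Icc u v) →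
      (Matrix.of fun b => ζ' (y b)).det ≠ 0)
    {p : ℕ → ℝ} (hp : Monotone p) (hpI : ∀ k, p k ∈ Icc u v)
    (hlt : ∀ j, j + 1 < d → p (2 * j) < p (2 * j + 2))
    {ε : ℕ → ℤ} (hε : ∀ k, ε k = 1 ∨ ε k = -1) (hsum : ∑ k ∈ Finset.range (2 * d), ε k = 0)
    (h0 : ∑ k ∈ Finset.range (2 * d), ε k • ζ (p k) = 0) :
    ∀ j < d, p (2 * j) = p (2 * j + 1) := by
  classical
  set T : ℕ → ℤ := fun n => ∑ i ∈ Finset.range n, ε i with hT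
  set w : ℕ → Fin d → ℝ := fun j => T (2 * j + 1) • (ζ (p (2 * j + 1)) - ζ (p (2 * j))) +
    T (2 * j + 2) • (ζ (p (2 * j + 2)) - ζ (p (2 * j + 1))) with hw
  have hsw : ∑ j : Fin d, w j = 0 := by
    have := sum_range_even_by_parts ε (fun k => ζ (p k)) d
    rw [h0, hsum, zero_smul, zero_sub, eq_comm, neg_eq_zero] at this
    rw [Finset.sum_range] at this
    exact this
  -- A sum of an odd number of signs is odd, so it is nonzero and one further sign cannot reverse
  -- it.
  have hTodd : ∀ j, T (2 * j + 1) ≠ 0 := fun j h => by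
    have := partial_sum_parity ε hε (2 * j + 1)
    simp only [hT] at h
    rw [h] at this
    push_cast at this
    omega
  have hTT : ∀ j, 0 ≤ T (2 * j + 1) * T (2 * j + 2) := fun j => by
    have h1 : T (2 * j + 2) = T (2 * j + 1) + ε (2 * j + 1) := Finset.sum_range_succ _ _
    rw [h1]
    have h2 := hTodd j
    rcases lt_or_gt_of_ne h2 with h | h <;> rcases hε (2 * j + 1) with h3 | h3 <;> rw [h3] <;>
      nlinarith
  -- For `deg j` the vector `w j` vanishes, and a tangent vector takes its place in `W`. A nonzero
  -- vector orthogonal to all rows of `W` would be orthogonal to the tangents at `d` increasing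
  -- points, one per interval `[p (2 j), p (2 j + 2)]`, against `hdet`.
  let deg : ℕ → Prop := fun j => p (2 * j) = p (2 * j + 1) ∧ T (2 * j + 2) = 0
  let W : Matrix (Fin d) (Fin d) ℝ :=
    Matrix.of fun j : Fin d => if deg j then ζ' (p (2 * j)) else w j
  have hWdet : W.det ≠ 0 := by
    intro hzero
    obtain ⟨ξ, hξ0, hξ⟩ := Matrix.exists_mulVec_eq_zero_iff.2 hzero
    have hfd : ∀ x ∈ Icc u v, HasDerivWithinAt (fun x => ζ x ⬝ᵥ ξ) (ζ' x ⬝ᵥ ξ) (Icc u v) x := by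
      intro x hx
      have h1 := hasDerivWithinAt_pi.1 (hζ x hx)
      simp only [dotProduct]
      exact HasDerivWithinAt.fun_sum fun i _ => (h1 i).mul_const (ξ i)
    have hy : ∀ j : Fin d, ∃ y ∈ Icc (p (2 * j)) (p (2 * j + 2)),
        ((j : ℕ) + 1 < d → y < p (2 * j + 2)) ∧ ζ' y ⬝ᵥ ξ = 0 := by
      intro j
      have hj : W j ⬝ᵥ ξ = 0 := congrFun hξ j
      by_cases hdg : deg j
      · have e : W j = ζ' (p (2 * j)) := if_pos hdg
        rw [e] at hj
        exact ⟨p (2 * j), ⟨le_rfl, hp (by omega)⟩, fun h => hlt j h, hj⟩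
      · have e : W j = w j := if_neg hdg
        rw [e] at hj
        have hjd : (j : ℕ) + 1 < d ∨ (j : ℕ) + 1 = d := by omega
        obtain ⟨ξ', h1, h2⟩ := exists_deriv_zero_of_combination hfd
          (A := (T (2 * j + 1) : ℝ)) (B := (T (2 * j + 2) : ℝ)) (hpI (2 * j)) (hpI (2 * j + 2))
          (y := p (2 * j + 1)) (hp (by omega)) (hp (by omega)) (by exact_mod_cast hTodd j)
          (by exact_mod_cast hTT j) (by
            by_cases heq : p (2 * j) = p (2 * j + 1)
            · right
              have hT0 : T (2 * j + 2) ≠ 0 := fun h => hdg ⟨heq, h⟩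
              refine ⟨by exact_mod_cast hT0, ?_⟩
              rcases hjd with h | h
              · rw [← heq]; exact hlt j h
              -- For the last `j`, `T (2 j + 2)` is the sum of all the signs, which is zero.
              · exfalso
                refine hT0 ?_
                rw [show 2 * (j : ℕ) + 2 = 2 * d by omega]
                exact hsum
            · exact Or.inl (lt_of_le_of_ne (hp (by omega)) heq)) (by
            rw [← hj, hw]
            simp only [← Int.cast_smul_eq_zsmul ℝ, add_dotProduct, smul_dotProduct, sub_dotProduct,
              smul_eq_mul])
        exact ⟨ξ', Ioo_subset_Icc_self h1, fun _ => h1.2, h2⟩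
    choose y hyI hylt hy0 using hy
    refine hdet y ?_ (fun j => ⟨(hpI _).1.trans (hyI j).1, (hyI j).2.trans (hpI _).2⟩) ?_
    · intro i j hij
      have hij' : (i : ℕ) < j := hij
      calc y i < p (2 * i + 2) := hylt i (by omega)
        _ ≤ p (2 * j) := hp (by omega)
        _ ≤ y j := (hyI j).1
    · exact Matrix.exists_mulVec_eq_zero_iff.1 ⟨ξ, hξ0, funext fun j => hy0 j⟩
  -- The rows that are not degenerate sum to `∑ w j = 0`, a nontrivial dependence in the invertible
  -- matrix `W` unless there are none.
  have hall : ∀ j : Fin d, deg j := by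
    by_contra hcon
    push Not at hcon
    obtain ⟨j₀, hj₀⟩ := hcon
    refine hWdet (Matrix.exists_vecMul_eq_zero_iff.1 ⟨fun j => if deg j then 0 else 1, ?_, ?_⟩)
    · intro h
      have := congrFun h j₀
      simp [hj₀] at this
    · have hterm : ∀ j : Fin d, (if deg j then (0 : ℝ) else 1) • W j = w j := by
        intro j
        by_cases hdg : deg j
        · rw [if_pos hdg, zero_smul]
          simp only [hw]
          rw [← hdg.1, hdg.2]
          simp
        · rw [if_neg hdg, one_smul]
          exact if_neg hdg
      rw [Matrix.vecMul_eq_sum, ← hsw]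
      exact Finset.sum_congr rfl fun j _ => hterm j
  exact fun j hj => (hall ⟨j, hj⟩).1

/-- Merge both tuples into one sorted sequence, with sign `1` for `t` and `-1` for `r`. No value
occurs three times, as each tuple is injective. Equality of the sums then forces the points to pair
up, so at most `d` values occur and both tuples enumerate the same set. -/
theorem injOn_sumMap {d : ℕ} {ζ ζ' : ℝ → Fin d → ℝ} {u v : ℝ}
    (hζ : ∀ x ∈ Icc u v, HasDerivWithinAt ζ (ζ' x) (Icc u v) x)
    (hdet : ∀ y : Fin d → ℝ, StrictMono y → (∀ i, y i ∈ Icc u v) →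
      (Matrix.of fun b => ζ' (y b)).det ≠ 0) :
    InjOn (sumMap ζ) {t | StrictMono t ∧ ∀ i, t i ∈ Icc u v} := by
  classical
  rintro t ⟨ht, htI⟩ r ⟨hr, hrI⟩ heq
  rcases Nat.eq_zero_or_pos d with rfl | hd
  · exact Subsingleton.elim _ _
  set x : Fin (d + d) → ℝ := Fin.append t r with hx
  set σ := Tuple.sort x with hσ
  have hmono : Monotone (x ∘ σ) := Tuple.monotone_sort x
  have hxl : ∀ i : Fin d, x (Fin.castAdd d i) = t i := fun i => Fin.append_left t r i
  have hxr : ∀ i : Fin d, x (Fin.natAdd d i) = r i := fun i => Fin.append_right t r i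
  have hxI : ∀ k, x k ∈ Icc u v := fun k => by
    refine Fin.addCases (fun i => ?_) (fun i => ?_) k
    · rw [hxl]; exact htI i
    · rw [hxr]; exact hrI i
  -- Indices are clamped at the last one, so that `p` is monotone on all of `ℕ`; `p (2 * d)` repeats
  -- the last point and carries weight zero.
  let ι : ℕ → Fin (d + d) := fun k => ⟨min k (d + d - 1), by omega⟩
  have hιmono : Monotone ι := fun i j hij => by
    simp only [ι, Fin.mk_le_mk]; omega
  let p : ℕ → ℝ := fun k => x (σ (ι k))
  let ε : ℕ → ℤ := fun k => if (σ (ι k) : ℕ) < d then 1 else -1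
  have hιval : ∀ k : Fin (d + d), ι k = k := fun k => by ext; simp only [ι]; omega
  have hsumgen : ∀ {E : Type} [AddCommGroup E] (F : Fin (d + d) → E),
      ∑ k ∈ Finset.range (2 * d), F (σ (ι k)) = ∑ i : Fin d, F (Fin.castAdd d i) +
        ∑ i : Fin d, F (Fin.natAdd d i) := by
    intro E _ F
    rw [two_mul, Finset.sum_range, ← Fin.sum_univ_add]
    simp only [hιval]
    exact Equiv.sum_comp σ F
  have hpairs := pairs_eq_of_signed_sum_eq_zero hζ hdet (p := p) (ε := ε)
    (fun i j hij => hmono (hιmono hij)) (fun k => hxI _) (fun j hj => by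
      refine lt_of_le_of_ne (hmono (hιmono (by omega))) fun hne => ?_
      have h1 : p (2 * j) = p (2 * j + 1) :=
        le_antisymm (hmono (hιmono (by omega))) (hne ▸ hmono (hιmono (by omega)))
      have h2 : p (2 * j + 1) = p (2 * j + 2) := h1.symm.trans hne
      have hιne : ∀ k l, k < 2 * d → l < 2 * d → k ≠ l → σ (ι k) ≠ σ (ι l) := by
        intro k l hk hl hkl h
        have := Fin.ext_iff.1 (σ.injective h)
        simp only [ι] at this
        omega
      have hsame : ∀ k l : Fin (d + d), x k = x l → ((k : ℕ) < d ↔ (l : ℕ) < d) → k = l := by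
        intro k l
        refine Fin.addCases (fun i => ?_) (fun i => ?_) k <;>
          refine Fin.addCases (fun i' => ?_) (fun i' => ?_) l
        · intro h _; simp only [hx, Fin.append_left] at h; rw [ht.injective h]
        · intro _ h; exfalso; simp only [Fin.val_castAdd, Fin.val_natAdd] at h; omega
        · intro _ h; exfalso; simp only [Fin.val_castAdd, Fin.val_natAdd] at h; omega
        · intro h _; simp only [hx, Fin.append_right] at h; rw [hr.injective h]
      have n1 := hιne (2 * j) (2 * j + 1) (by omega) (by omega) (by omega)
      have n2 := hιne (2 * j + 1) (2 * j + 2) (by omega) (by omega) (by omega)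
      have n3 := hιne (2 * j) (2 * j + 2) (by omega) (by omega) (by omega)
      have m1 := fun h => n1 (hsame _ _ h1 h)
      have m2 := fun h => n2 (hsame _ _ h2 h)
      have m3 := fun h => n3 (hsame _ _ hne h)
      tauto) (fun k => by
      simp only [ε]; split_ifs <;> simp) (by
      have := hsumgen (fun k => if (k : ℕ) < d then (1 : ℤ) else -1)
      simp only [ε]
      rw [this]
      simp) (by
      have := hsumgen (fun k => (if (k : ℕ) < d then (1 : ℤ) else -1) • ζ (x k))
      simp only [ε, p]
      rw [this]
      have h : ∑ i, ζ (t i) = ∑ i, ζ (r i) := heq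
      simp only [hxl, hxr, Fin.val_castAdd, Fin.is_lt, if_true, one_smul, Fin.val_natAdd, h,
        not_lt.2 (Nat.le_add_right d _), if_false, neg_smul, Finset.sum_neg_distrib,
        add_neg_cancel])
  have hrange : ∀ k : Fin (d + d), ∃ j : Fin d, x k = p (2 * j) := by
    intro k
    obtain ⟨l, rfl⟩ := σ.surjective k
    refine ⟨⟨(l : ℕ) / 2, by omega⟩, ?_⟩
    rcases Nat.even_or_odd' (l : ℕ) with ⟨c, hc | hc⟩
    · have : 2 * ((l : ℕ) / 2) = l := by omega
      simp only [this, p, hιval]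
    · have h2 : 2 * ((l : ℕ) / 2) + 1 = l := by omega
      have := hpairs ((l : ℕ) / 2) (by omega)
      simp only
      rw [this, h2]
      simp only [p, hιval]
  set R : Finset ℝ := Finset.univ.image fun j : Fin d => p (2 * j) with hR
  have hRc : R.card ≤ d := Finset.card_image_le.trans (by simp)
  have himg : ∀ q : Fin d → ℝ, StrictMono q → (∀ i, ∃ j : Fin d, q i = p (2 * j)) →
      range q = R := by
    intro q hq h
    have hsub : Finset.univ.image q ⊆ R := by
      intro z hz
      simp only [Finset.mem_image, Finset.mem_univ, true_and] at hz
      obtain ⟨i, rfl⟩ := hz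
      obtain ⟨j, hj⟩ := h i
      rw [hj, hR]
      exact Finset.mem_image_of_mem _ (Finset.mem_univ j)
    have := Finset.eq_of_subset_of_card_le hsub (by
      rw [Finset.card_image_of_injective _ hq.injective]; simpa using hRc)
    rw [← this]
    simp
  refine (StrictMono.range_inj ht hr).1 ((himg t ht fun i => ?_).trans (himg r hr fun i => ?_).symm)
  · rw [← hxl]; exact hrange _
  · rw [← hxr]; exact hrange _

end TorsionDecomp

namespace TorsionDecomp

open Set

/-! ### Offspring curves -/

/-- All determinants with row `b` taken from the values of `G b` on `I` have one sign and a
modulus between `c` and `C`. -/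
def MixedBound {d : ℕ} (G : ℕ → ℝ → Fin d → ℝ) (I : Set ℝ) (c C : ℝ) : Prop :=
  ∃ σ : ℝ, |σ| = 1 ∧ ∀ s : Fin d → ℝ, (∀ b, s b ∈ I) →
    c ≤ σ * (Matrix.of fun b : Fin d => G b (s b)).det ∧
      σ * (Matrix.of fun b : Fin d => G b (s b)).det ≤ C

theorem add_mem_of_mem_shiftInterval {m : ℕ} {a b t : ℝ} {h : Fin (m + 1) → ℝ} (hh : Monotone h)
    (ht : t ∈ shiftInterval a b h) (j : Fin (m + 1)) : t + h j ∈ Icc a b := by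
  have h1 := hh (Fin.zero_le j)
  have h2 := hh (Fin.le_last j)
  have h3 : a - h 0 ≤ t := ht.1
  have h4 : t ≤ b - h (Fin.last m) := ht.2
  exact ⟨by linarith, by linarith⟩

theorem hasDerivWithinAt_offspring {d m : ℕ} {a b : ℝ} {h : Fin (m + 1) → ℝ} (hh : Monotone h)
    {g g' : ℝ → Fin d → ℝ} (hg : ∀ x ∈ Icc a b, HasDerivWithinAt g (g' x) (Icc a b) x) {t : ℝ}
    (ht : t ∈ shiftInterval a b h) :
    HasDerivWithinAt (offspring g h) (offspring g' h t) (shiftInterval a b h) t := by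
  suffices H : HasDerivWithinAt (fun t => ∑ j, g (t + h j)) (∑ j, g' (t + h j))
      (shiftInterval a b h) t from H.const_smul (((m : ℝ) + 1)⁻¹)
  refine HasDerivWithinAt.fun_sum fun j _ => ?_
  have h1 : HasDerivWithinAt (fun x : ℝ => x + h j) 1 (shiftInterval a b h) t :=
    (hasDerivWithinAt_id t _).add_const (h j)
  have h2 := (hg _ (add_mem_of_mem_shiftInterval hh ht j)).scomp t h1
    fun x hx => add_mem_of_mem_shiftInterval hh hx j
  rw [one_smul] at h2
  exact h2

theorem iteratedDerivWithin_offspring {d m n : ℕ} {a b : ℝ} {h : Fin (m + 1) → ℝ}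
    (hh : Monotone h) (hlt : h (Fin.last m) - h 0 < b - a) {γ : ℝ → Fin d → ℝ}
    (hγ : ContDiffOn ℝ n γ (Icc a b)) {k : ℕ} (hk : k ≤ n) :
    EqOn (iteratedDerivWithin k (offspring γ h) (shiftInterval a b h))
      (offspring (iteratedDerivWithin k γ (Icc a b)) h) (shiftInterval a b h) := by
  have hab : a < b := by linarith [hh (Fin.zero_le (Fin.last m))]
  have hud : UniqueDiffOn ℝ (shiftInterval a b h) := uniqueDiffOn_Icc (by linarith)
  induction k with
  | zero => intro t _; simp
  | succ k ih =>
    intro t ht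
    rw [iteratedDerivWithin_succ, derivWithin_congr (ih (by omega)) (ih (by omega) ht)]
    exact (hasDerivWithinAt_offspring hh
      (isJet_iteratedDerivWithin hab hγ k (by omega)) ht).derivWithin (hud t ht)

/-- By multilinearity the determinant is the average of `(m + 1) ^ d` mixed determinants, one for
each choice of a shift in every row. Their common sign rules out cancellation. -/
theorem MixedBound.offspring {d m : ℕ} {G : ℕ → ℝ → Fin d → ℝ} {lo hi c C : ℝ}
    (hG : MixedBound G (Icc lo hi) c C) {h : Fin (m + 1) → ℝ} (hh : Monotone h) :
    MixedBound (fun b => offspring (G b) h) (shiftInterval lo hi h) c C := by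
  obtain ⟨σ, hσ, H⟩ := hG
  refine ⟨σ, hσ, fun s hs => ?_⟩
  set w : ℝ := ((m : ℝ) + 1)⁻¹ with hw
  have hw0 : 0 ≤ w := by positivity
  have hone : ∑ _r : Fin d → Fin (m + 1), w ^ d = 1 := by
    rw [Finset.sum_const, Finset.card_univ, Fintype.card_fun, Fintype.card_fin, Fintype.card_fin,
      nsmul_eq_mul, hw]
    push_cast
    rw [← mul_pow, mul_inv_cancel₀ (by positivity), one_pow]
  have hdet : (Matrix.of fun b : Fin d => _root_.offspring (G b) h (s b)).det =
      ∑ r : Fin d → Fin (m + 1), w ^ d *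
        (Matrix.of fun b : Fin d => G b (s b + h (r b))).det := by
    have := det_sum_rows (fun (_ : Fin d) (_ : Fin (m + 1)) => w)
      (fun b j => G b (s b + h j))
    simp only [Finset.prod_const, Finset.card_univ, Fintype.card_fin] at this
    rw [← this]
    congr 1
    ext b a
    simp [_root_.offspring, Finset.mul_sum, hw]
  have hterm : ∀ r : Fin d → Fin (m + 1), _ := fun r =>
    H (fun b => s b + h (r b)) fun b => add_mem_of_mem_shiftInterval hh (hs b) (r b)
  rw [hdet, Finset.mul_sum]
  constructor
  · calc c = ∑ _r : Fin d → Fin (m + 1), w ^ d * c := by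
          rw [← Finset.sum_mul, hone, one_mul]
      _ ≤ _ := Finset.sum_le_sum fun r _ => by
          rw [mul_left_comm]
          exact mul_le_mul_of_nonneg_left (hterm r).1 (by positivity)
  · calc _ ≤ ∑ _r : Fin d → Fin (m + 1), w ^ d * C := Finset.sum_le_sum fun r _ => by
          rw [mul_left_comm]
          exact mul_le_mul_of_nonneg_left (hterm r).2 (by positivity)
      _ = C := by rw [← Finset.sum_mul, hone, one_mul]

theorem MixedBound.abs_det {d : ℕ} {G : ℕ → ℝ → Fin d → ℝ} {I : Set ℝ} {c C : ℝ}
    (hG : MixedBound G I c C) (hc : 0 ≤ c) {s : Fin d → ℝ} (hs : ∀ b, s b ∈ I) :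
    c ≤ |(Matrix.of fun b : Fin d => G b (s b)).det| ∧
      |(Matrix.of fun b : Fin d => G b (s b)).det| ≤ C := by
  obtain ⟨σ, hσ, H⟩ := hG
  have h := H s hs
  have e : |(Matrix.of fun b : Fin d => G b (s b)).det| =
      σ * (Matrix.of fun b : Fin d => G b (s b)).det := by
    rw [← abs_of_nonneg (hc.trans h.1), abs_mul, hσ, one_mul]
  rw [e]
  exact h

/-- On an interval where the mixed determinants of a curve are bounded below, all offspring curves
have the required geometric properties. -/
theorem offspring_geometry {d m : ℕ} {a b lo hi c C : ℝ} {γ : ℝ → Fin d → ℝ} (hd : 1 ≤ d)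
    (hγ : ContDiffOn ℝ d γ (Icc a b)) (hsub : Icc lo hi ⊆ Icc a b) (hlohi : lo ≤ hi) (hc : 0 < c)
    (hG : MixedBound (fun k => iteratedDerivWithin (k + 1) γ (Icc a b)) (Icc lo hi) c C)
    {h : Fin (m + 1) → ℝ} (hh : Monotone h) (hlt : h (Fin.last m) - h 0 < b - a) :
    (∀ t ∈ shiftInterval lo hi h,
      c ≤ torsion (offspring γ h) (shiftInterval a b h) t ∧
        torsion (offspring γ h) (shiftInterval a b h) t ≤ C) ∧
    InjOn (sumMap (offspring γ h)) {t | StrictMono t ∧ ∀ i, t i ∈ shiftInterval lo hi h} ∧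
    ∀ t : Fin d → ℝ, (∀ i, t i ∈ shiftInterval lo hi h) →
      c / (∏ k : Fin d, ((k : ℕ).factorial : ℝ)) * |(Matrix.vandermonde t).det| ≤
        |jacobianSumMap (offspring γ h) (shiftInterval a b h) t| := by
  have hab : a < b := by linarith [hh (Fin.zero_le (Fin.last m))]
  have hne : a - h 0 < b - h (Fin.last m) := by linarith
  have hlo := hsub (left_mem_Icc.2 hlohi)
  have hhi := hsub (right_mem_Icc.2 hlohi)
  have hsub' : shiftInterval lo hi h ⊆ shiftInterval a b h :=
    Icc_subset_Icc (by linarith [hlo.1]) (by linarith [hhi.2])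
  set G : ℕ → ℝ → Fin d → ℝ := fun k => offspring (iteratedDerivWithin (k + 1) γ (Icc a b)) h
    with hGdef
  have hGb : MixedBound G (shiftInterval lo hi h) c C := hG.offspring hh
  have hjet0 : ∀ k < d, ∀ t ∈ shiftInterval a b h,
      HasDerivWithinAt (offspring (iteratedDerivWithin k γ (Icc a b)) h) (G k t)
        (shiftInterval a b h) t := fun k hk t ht =>
    hasDerivWithinAt_offspring hh (isJet_iteratedDerivWithin hab hγ k hk) ht
  have hζ : ∀ t ∈ shiftInterval a b h,
      HasDerivWithinAt (offspring γ h) (G 0 t) (shiftInterval a b h) t := fun t ht => by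
    simpa using hjet0 0 (by omega) t ht
  have hjet : IsJet (d - 1) G (Icc (lo - h 0) (hi - h (Fin.last m))) := fun k hk t ht =>
    (hjet0 (k + 1) (by omega) t (hsub' ht)).mono hsub'
  set F : ℝ := ∏ k : Fin d, ((k : ℕ).factorial : ℝ) with hF
  have hF0 : 0 < F := Finset.prod_pos fun k _ => by positivity
  have hvan : ∀ t : Fin d → ℝ, (∀ i, t i ∈ shiftInterval lo hi h) →
      c / F * |(Matrix.vandermonde t).det| ≤ |(Matrix.of fun b => G 0 (t b)).det| := by
    intro t ht
    obtain ⟨s, hs, he⟩ := exists_det_eq_vandermonde hjet ht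
    have h1 := (hGb.abs_det hc.le hs).1
    have h2 := congrArg abs he
    rw [abs_mul, abs_mul, ← hF, abs_of_pos hF0] at h2
    rw [div_mul_eq_mul_div, div_le_iff₀ hF0, h2, mul_comm]
    gcongr
  refine ⟨fun t ht => ?_, ?_, fun t ht => ?_⟩
  · have h1 := hGb.abs_det hc.le (s := fun _ => t) fun _ => ht
    have h2 : torsion (offspring γ h) (shiftInterval a b h) t =
        |(Matrix.of fun b : Fin d => G b t).det| := by
      rw [torsion, ← Matrix.det_transpose]
      congr 2
      ext i j
      simp only [Matrix.transpose_apply, Matrix.of_apply, hGdef]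
      rw [iteratedDerivWithin_offspring hh hlt hγ (by omega) (hsub' ht)]
    rw [h2]
    exact h1
  · refine injOn_sumMap (ζ' := G 0) (fun t ht => (hζ t (hsub' ht)).mono hsub') fun y hy hyI => ?_
    have h1 := hvan y hyI
    have h2 : 0 < |(Matrix.vandermonde y).det| :=
      abs_pos.2 (Matrix.det_vandermonde_ne_zero_iff.2 hy.injective)
    exact abs_pos.1 (lt_of_lt_of_le (by positivity) h1)
  · have h1 : jacobianSumMap (offspring γ h) (shiftInterval a b h) t =
        (Matrix.of fun b => G 0 (t b)).det :=
      jacobianSumMap_eq_det hne hζ fun i => hsub' (ht i)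
    rw [h1]
    exact hvan t ht

end TorsionDecomp

namespace TorsionDecomp

open Set

/-! ### Covers by finitely many intervals -/

/-- `S` is covered by at most `X` compact intervals with property `P` and total length at most
`Y`. -/
def HasCover (P : ℝ → ℝ → Prop) (S : Set ℝ) (X Y : ℝ) : Prop :=
  ∃ (m : ℕ) (lo hi : Fin m → ℝ), (∀ l, lo l ≤ hi l ∧ P (lo l) (hi l)) ∧
    (S ⊆ ⋃ l, Icc (lo l) (hi l)) ∧ (m : ℝ) ≤ X ∧ ∑ l, (hi l - lo l) ≤ Y

theorem hasCover_of_fintype {P : ℝ → ℝ → Prop} {S : Set ℝ} {X Y : ℝ} {κ : Type*} [Fintype κ]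
    (lo hi : κ → ℝ) (h1 : ∀ l, lo l ≤ hi l ∧ P (lo l) (hi l)) (h2 : S ⊆ ⋃ l, Icc (lo l) (hi l))
    (h3 : (Fintype.card κ : ℝ) ≤ X) (h4 : ∑ l, (hi l - lo l) ≤ Y) : HasCover P S X Y := by
  let e := (Fintype.equivFin κ).symm
  refine ⟨Fintype.card κ, lo ∘ e, hi ∘ e, fun l => h1 _, fun t ht => ?_, h3, ?_⟩
  · obtain ⟨l, hl⟩ := mem_iUnion.1 (h2 ht)
    refine mem_iUnion.2 ⟨e.symm l, ?_⟩
    simpa using hl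
  · exact (Equiv.sum_comp e fun l => hi l - lo l).trans_le h4

theorem hasCover_iUnion {P : ℝ → ℝ → Prop} {κ : Type*} [Fintype κ] {S : κ → Set ℝ} {X Y : ℝ}
    (h : ∀ i, HasCover P (S i) X Y) :
    HasCover P (⋃ i, S i) (Fintype.card κ * X) (Fintype.card κ * Y) := by
  choose m lo hi h1 h2 h3 h4 using h
  refine hasCover_of_fintype (κ := Σ i, Fin (m i)) (fun x => lo x.1 x.2) (fun x => hi x.1 x.2)
    (fun x => h1 _ _) ?_ ?_ ?_
  · intro t ht
    obtain ⟨i, hi'⟩ := mem_iUnion.1 ht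
    obtain ⟨l, hl⟩ := mem_iUnion.1 (h2 i hi')
    exact mem_iUnion.2 ⟨⟨i, l⟩, hl⟩
  · rw [Fintype.card_sigma]
    simp only [Fintype.card_fin]
    push_cast
    calc ∑ i, (m i : ℝ) ≤ ∑ _i : κ, X := Finset.sum_le_sum fun i _ => h3 i
      _ = _ := by simp
  · rw [Fintype.sum_sigma]
    calc _ ≤ ∑ _i : κ, Y := Finset.sum_le_sum fun i _ => h4 i
      _ = _ := by simp

theorem HasCover.mono {P : ℝ → ℝ → Prop} {S S' : Set ℝ} {X Y X' Y' : ℝ} (h : HasCover P S X Y)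
    (hS : S' ⊆ S) (hX : X ≤ X') (hY : Y ≤ Y') : HasCover P S' X' Y' := by
  obtain ⟨m, lo, hi, h1, h2, h3, h4⟩ := h
  exact ⟨m, lo, hi, h1, hS.trans h2, h3.trans hX, h4.trans hY⟩

theorem exists_gap (z : ℕ → ℝ) {t : ℝ} {m : ℕ} (hm : 0 < m) (h0 : z 0 ≤ t) (hz : t ≤ z m) :
    ∃ g < m, z g ≤ t ∧ t ≤ z (g + 1) := by
  induction m with
  | zero => omega
  | succ m ih =>
    rcases le_total (z m) t with h | h
    · exact ⟨m, by omega, h, hz⟩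
    · rcases Nat.eq_zero_or_pos m with rfl | hm'
      · exact ⟨0, by omega, h0, hz⟩
      · obtain ⟨g, hg, h1⟩ := ih hm' h
        exact ⟨g, by omega, h1⟩

/-- Cut `[a, b]` at the points of `Z`, and then each piece into `R` equal parts. -/
theorem hasCover_of_breakpoints {P : ℝ → ℝ → Prop} {S : Set ℝ} {a b : ℝ} (hab : a < b)
    (hS : S ⊆ Icc a b) (Z : Finset ℝ) (hZ : ∀ z ∈ Z, z ∈ Icc a b) (R : ℕ) (hR : 0 < R)
    (hP : ∀ u v : ℝ, u < v → Icc u v ⊆ Icc a b → (∀ z ∈ Z, z ∉ Ioo u v) →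
      (∃ t ∈ Icc u v, t ∈ S) → ∀ u' v' : ℝ, Icc u' v' ⊆ Icc u v → v' - u' = (v - u) / R →
        P u' v') :
    HasCover P S ((Z.card + 2) * R) (b - a) := by
  classical
  set W : Finset ℝ := insert a (insert b Z) with hW
  have haW : a ∈ W := by simp [hW]
  have hbW : b ∈ W := by simp [hW]
  have hWI : ∀ z ∈ W, z ∈ Icc a b := by
    intro z hz
    simp only [hW, Finset.mem_insert] at hz
    rcases hz with rfl | rfl | hz
    · exact left_mem_Icc.2 hab.le
    · exact right_mem_Icc.2 hab.le
    · exact hZ z hz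
  have hWc : W.card ≤ Z.card + 2 :=
    (Finset.card_insert_le _ _).trans (by have := Finset.card_insert_le b Z; omega)
  have hWpos : 2 ≤ W.card := by
    have : ({a, b} : Finset ℝ) ⊆ W := by
      intro z hz
      simp only [Finset.mem_insert, Finset.mem_singleton] at hz
      rcases hz with rfl | rfl <;> assumption
    calc 2 = ({a, b} : Finset ℝ).card := (Finset.card_pair hab.ne).symm
      _ ≤ _ := Finset.card_le_card this
  set m : ℕ := W.card - 1 with hm
  have hm0 : 0 < m := by omega
  let e := W.orderEmbOfFin (k := W.card) rfl
  let z : ℕ → ℝ := fun i => e ⟨min i m, by omega⟩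
  have hzI : ∀ i, z i ∈ W := fun i => W.orderEmbOfFin_mem rfl _
  have hzlt : ∀ i < m, z i < z (i + 1) := fun i hi =>
    e.strictMono (by simp only [Fin.mk_lt_mk]; omega)
  have hsurj : ∀ w ∈ W, ∃ i ≤ m, z i = w := by
    intro w hw
    have : w ∈ range e := by rw [Finset.range_orderEmbOfFin]; exact hw
    obtain ⟨i, hi⟩ := this
    refine ⟨i, by omega, ?_⟩
    rw [← hi]
    exact congrArg e (Fin.ext (min_eq_left (by omega)))
  have hzmono : Monotone z := fun i j hij => e.monotone (by simp only [Fin.mk_le_mk]; omega)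
  have hz0 : z 0 = a := by
    obtain ⟨i, _, hi⟩ := hsurj a haW
    exact le_antisymm (hi ▸ hzmono (Nat.zero_le i)) (hWI _ (hzI 0)).1
  have hzm : z m = b := by
    obtain ⟨i, him, hi⟩ := hsurj b hbW
    exact le_antisymm (hWI _ (hzI m)).2 (hi ▸ hzmono him)
  have hgap : ∀ g < m, ∀ w ∈ Z, w ∉ Ioo (z g) (z (g + 1)) := by
    intro g hg w hw hmem
    obtain ⟨i, _, hi⟩ := hsurj w (by simp [hW, hw])
    rw [← hi] at hmem
    have h1 : g < i := by
      by_contra hcon; push Not at hcon; exact absurd (hzmono hcon) (not_le.2 hmem.1)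
    exact absurd (hzmono (show g + 1 ≤ i by omega)) (not_le.2 hmem.2)
  have hR0 : (0 : ℝ) < R := by exact_mod_cast hR
  let len : ℕ → ℝ := fun g => (z (g + 1) - z g) / R
  -- Only gaps that meet `S` are kept, since `hP` says nothing about the others.
  let κ := {x : Fin m × Fin R // ∃ t ∈ Icc (z x.1) (z (x.1 + 1)), t ∈ S}
  let lo : Fin m × Fin R → ℝ := fun x => z x.1 + x.2 * len x.1
  let hi : Fin m × Fin R → ℝ := fun x => z x.1 + (x.2 + 1) * len x.1
  have hlen : ∀ g < m, 0 < len g := fun g hg => div_pos (sub_pos.2 (hzlt g hg)) hR0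
  have hlenR : ∀ g, R * len g = z (g + 1) - z g := fun g => by
    simp only [len]; field_simp
  have hdiff : ∀ x, hi x - lo x = len x.1 := fun x => by simp only [hi, lo]; ring
  refine hasCover_of_fintype (κ := κ) (fun x => lo x.1) (fun x => hi x.1) (fun x => ⟨?_, ?_⟩)
    ?_ ?_ ?_
  · have := hdiff x.1
    have := hlen x.1.1 x.1.1.2
    linarith
  · have hg := x.1.1.2
    refine hP (z x.1.1) (z (x.1.1 + 1)) (hzlt _ hg)
      (Icc_subset_Icc (hWI _ (hzI _)).1 (hWI _ (hzI _)).2) (hgap _ hg) x.2 _ _ ?_ (hdiff _)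
    have h1 := hlen x.1.1 hg
    refine Icc_subset_Icc ?_ ?_
    · simp only [lo]
      have : 0 ≤ (x.1.2 : ℝ) * len x.1.1 := by positivity
      linarith
    · simp only [hi]
      have h2 : ((x.1.2 : ℕ) : ℝ) + 1 ≤ R := by exact_mod_cast x.1.2.2
      have := mul_le_mul_of_nonneg_right h2 h1.le
      rw [hlenR] at this
      linarith
  · intro t ht
    have htI := hS ht
    obtain ⟨g, hg, h1, h2⟩ := exists_gap z hm0 (hz0 ▸ htI.1) (hzm ▸ htI.2)
    have hlg := hlen g hg
    obtain ⟨ρ, hρ, h3, h4⟩ := exists_gap (fun i => z g + i * len g) hR (t := t)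
      (by simpa using h1) (by rw [hlenR]; linarith)
    refine mem_iUnion.2 ⟨⟨(⟨g, hg⟩, ⟨ρ, hρ⟩), t, ⟨h1, h2⟩, ht⟩, ?_⟩
    simp only [lo, hi]
    exact ⟨h3, by simpa using h4⟩
  · have h1 : Fintype.card κ ≤ m * R := by
      refine (Fintype.card_subtype_le _).trans ?_
      simp
    have h2 : m * R ≤ (Z.card + 2) * R := Nat.mul_le_mul_right _ (by omega)
    exact_mod_cast h1.trans h2
  · simp only [hdiff]
    calc ∑ x : κ, len x.1.1 ≤ ∑ x : Fin m × Fin R, len x.1 := by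
          rw [← Finset.sum_subtype (Finset.univ.filter fun x : Fin m × Fin R =>
            ∃ t ∈ Icc (z x.1) (z (x.1 + 1)), t ∈ S) (by simp) (fun x : Fin m × Fin R => len x.1)]
          exact Finset.sum_le_sum_of_subset_of_nonneg (Finset.filter_subset _ _)
            fun x _ _ => (hlen x.1 x.1.2).le
      _ = ∑ g : Fin m, (z (g + 1) - z g) := by
          rw [Fintype.sum_prod_type]
          refine Finset.sum_congr rfl fun g _ => ?_
          simp only [Finset.sum_const, Finset.card_univ, Fintype.card_fin, nsmul_eq_mul]
          exact hlenR g
      _ = b - a := by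
          rw [← Finset.sum_range (fun g => z (g + 1) - z g), Finset.sum_range_sub, hzm, hz0]
      _ ≤ b - a := le_rfl

/-! ### Choice of the order of the coordinates -/

/-- In the Laplace expansion along the last row some minor is at least `|D| / ((n + 1) A)`. The
column it omits is put last, and the others are ordered by induction. -/
theorem exists_column_order {κ : Type*} (A : ℝ) (hA : 1 ≤ A) (M : ℕ → κ → ℝ)
    (hM : ∀ b k, |M b k| ≤ A) (n : ℕ) (e : Fin n → κ) :
    ∃ π : Fin n → Fin n, Function.Injective π ∧ ∀ (j : ℕ) (hj : j ≤ n),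
      |(Matrix.of fun b a : Fin n => M b (e a)).det| ≤
        (n * A + 1) ^ n *
          |(Matrix.of fun b a : Fin j => M b (e (π (Fin.castLE hj a)))).det| := by
  induction n with
  | zero =>
    refine ⟨id, Function.injective_id, fun j hj => ?_⟩
    obtain rfl : j = 0 := by omega
    simp
  | succ n ih =>
    set D := (Matrix.of fun b a : Fin (n + 1) => M b (e a)).det with hD
    let mi : Fin (n + 1) → ℝ := fun k =>
      (Matrix.of fun b a : Fin n => M b (e (k.succAbove a))).det
    have hexp : D = ∑ k : Fin (n + 1), (-1) ^ ((Fin.last n : ℕ) + (k : ℕ)) * M n (e k) * mi k := by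
      rw [hD, Matrix.det_succ_row _ (Fin.last n)]
      refine Finset.sum_congr rfl fun k _ => ?_
      congr 2
      ext b a
      simp
    obtain ⟨k, hk⟩ : ∃ k, |D| ≤ (n + 1) * A * |mi k| := by
      by_contra hcon
      push Not at hcon
      have h1 : |D| ≤ ∑ k : Fin (n + 1), A * |mi k| := by
        rw [hexp]
        refine (Finset.abs_sum_le_sum_abs _ _).trans (Finset.sum_le_sum fun k _ => ?_)
        rw [abs_mul, abs_mul, abs_pow, abs_neg, abs_one, one_pow, one_mul]
        gcongr
        exact hM _ _
      have h2 : (n + 1) * ∑ k : Fin (n + 1), A * |mi k| < ∑ _k : Fin (n + 1), |D| := by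
        rw [Finset.mul_sum]
        refine Finset.sum_lt_sum_of_nonempty Finset.univ_nonempty fun k _ => ?_
        have := hcon k
        linarith
      simp only [Finset.sum_const, Finset.card_univ, Fintype.card_fin, nsmul_eq_mul] at h2
      push_cast at h2
      have := lt_of_mul_lt_mul_left h2 (by positivity)
      linarith
    obtain ⟨π, hπ, hle⟩ := ih fun a => e (k.succAbove a)
    have hn1 : (1 : ℝ) ≤ (n + 1) * A + 1 := by nlinarith [(Nat.cast_nonneg n : (0 : ℝ) ≤ n)]
    let ρ : Fin (n + 1) → Fin (n + 1) := Fin.snoc (fun a => k.succAbove (π a)) k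
    have hρ : Function.Injective ρ := by
      rw [Fin.snoc_injective_iff]
      refine ⟨fun x y h => hπ (Fin.succAbove_right_injective h), ?_⟩
      rintro ⟨x, hx⟩
      exact Fin.succAbove_ne k _ hx
    refine ⟨ρ, hρ, fun j hj => ?_⟩
    push_cast
    rcases Nat.lt_or_ge n j with hlt | hge
    · obtain rfl : j = n + 1 := by omega
      let E : Equiv.Perm (Fin (n + 1)) := Equiv.ofBijective ρ (Finite.injective_iff_bijective.1 hρ)
      have h1 : (Matrix.of fun b a : Fin (n + 1) => M b (e (ρ (Fin.castLE hj a)))).det =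
          ((Equiv.Perm.sign E : ℤ) : ℝ) * D := by
        rw [hD, ← Matrix.det_permute']
        rfl
      have h2 : |((Equiv.Perm.sign E : ℤ) : ℝ)| = 1 := by
        rcases Int.units_eq_one_or (Equiv.Perm.sign E) with h | h <;> simp [h]
      rw [h1, abs_mul, h2, one_mul]
      exact le_mul_of_one_le_left (abs_nonneg _) (one_le_pow₀ hn1)
    · have h1 := hle j hge
      have h2 : ∀ a : Fin j, ρ (Fin.castLE hj a) = k.succAbove (π (Fin.castLE hge a)) := by
        intro a
        have : Fin.castLE hj a = (Fin.castLE hge a).castSucc := rfl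
        rw [this]
        exact Fin.snoc_castSucc (α := fun _ => Fin (n + 1)) _ _ _
      simp only [h2]
      calc |D| ≤ (n + 1) * A * |mi k| := hk
        _ ≤ (n + 1) * A * ((n * A + 1) ^ n * _) := by
            gcongr
        _ ≤ ((n + 1) * A + 1) * (((n + 1) * A + 1) ^ n * _) := by
            gcongr <;> linarith
        _ = _ := by rw [pow_succ']; ring

end TorsionDecomp

namespace TorsionDecomp

open Set

/-! ### Comparability on pieces of level intervals -/

theorem mixedDet_subset {d n : ℕ} {a b u v : ℝ} (huv : u < v) (hsub : Icc u v ⊆ Icc a b)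
    {f : ℕ → ℝ → ℝ} (hf : ∀ k < d, ContDiffOn ℝ (d - 1 : ℕ) (f k) (Icc a b)) (hn : n ≤ d)
    {s : ℕ → ℝ} (hs : ∀ k, s k ∈ Icc u v) :
    mixedDet n f (Icc u v) s = mixedDet n f (Icc a b) s := by
  rw [mixedDet, mixedDet]
  congr 1
  ext i j
  exact iteratedDerivWithin_Icc_subset huv hsub (hf j (by omega)) (by omega) (hs i)

theorem div_pos_of_ne_zero {g : ℝ → ℝ} {u v x y : ℝ} (hg : ContinuousOn g (Icc u v))
    (h0 : ∀ t ∈ Icc u v, g t ≠ 0) (hx : x ∈ Icc u v) (hy : y ∈ Icc u v) : 0 < g x / g y := by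
  by_contra hcon
  push Not at hcon
  have hsub : uIcc x y ⊆ Icc u v := uIcc_subset_Icc hx hy
  have hmem : (0 : ℝ) ∈ uIcc (g x) (g y) := by
    rcases lt_or_gt_of_ne (h0 x hx) with h1 | h1 <;> rcases lt_or_gt_of_ne (h0 y hy) with h2 | h2
    · exact absurd (div_pos_of_neg_of_neg h1 h2) (not_lt.2 hcon)
    · exact mem_uIcc_of_le h1.le h2.le
    · exact mem_uIcc_of_ge h2.le h1.le
    · exact absurd (div_pos h1 h2) (not_lt.2 hcon)
  obtain ⟨t, ht, h⟩ := intermediate_value_uIcc (hg.mono hsub) hmem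
  exact h0 t (hsub ht) h

/-- The ratio of `3 / 2` to `3 / 8` is the constant `4`. Passing to a part of length `(v - u) / R`
divides the scaled derivatives of order `i ≥ 1` by `R ^ i ≥ R`, which brings them below `ε` times
the function. -/
theorem MixedComparable.on_piece {d : ℕ} {ε c C : ℝ} (hcmp : MixedComparable d 4 ε c C)
    {a b : ℝ} {f : ℕ → ℝ → ℝ} (hf : ∀ k < d, ContDiffOn ℝ (d - 1 : ℕ) (f k) (Icc a b))
    (hW : ∀ j, 1 ≤ j → j ≤ d → ContDiffOn ℝ (d - j : ℕ) (wronskian j f (Icc a b)) (Icc a b))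
    {lam : ℕ → ℝ} (hlam : ∀ j, 0 < lam j) {Q : ℝ} (hQ : 0 ≤ Q) {R : ℕ} (hR0 : 0 < R)
    (hR : Q * (8 / 3) ≤ ε * R) {u v : ℝ} (huv : u < v) (hsub : Icc u v ⊆ Icc a b)
    (hlev : ∀ j, 1 ≤ j → j ≤ d → ∀ s ∈ Icc u v, 3 / 8 * lam j ≤ |wronskian j f (Icc a b) s| ∧
      |wronskian j f (Icc a b) s| ≤ 3 / 2 * lam j)
    (hder : ∀ j, 1 ≤ j → j ≤ d → ∀ i ≤ d - j, ∀ s ∈ Icc u v,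
      |iteratedDerivWithin i (wronskian j f (Icc a b)) (Icc a b) s| * (v - u) ^ i ≤ Q * lam j)
    {u' v' : ℝ} (hsub' : Icc u' v' ⊆ Icc u v) (hlen : v' - u' = (v - u) / R) {s : ℕ → ℝ}
    (hs : ∀ k, s k ∈ Icc u' v') {t : ℝ} (ht : t ∈ Icc u' v') :
    c ≤ mixedDet d f (Icc a b) s / wronskian d f (Icc a b) t ∧
      mixedDet d f (Icc a b) s / wronskian d f (Icc a b) t ≤ C := by
  have hRpos : (0 : ℝ) < R := by exact_mod_cast hR0
  have hR1 : (1 : ℝ) ≤ R := by exact_mod_cast hR0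
  have hw : 0 < v - u := sub_pos.2 huv
  have hw' : 0 < v' - u' := by rw [hlen]; positivity
  have huv' : u' < v' := sub_pos.1 hw'
  have hsubab : Icc u' v' ⊆ Icc a b := hsub'.trans hsub
  have heq : ∀ j ≤ d, EqOn (wronskian j f (Icc u' v')) (wronskian j f (Icc a b)) (Icc u' v') :=
    fun j hj t ht => mixedDet_subset huv' hsubab hf hj fun _ => ht
  have hne : ∀ j, 1 ≤ j → j ≤ d → ∀ t ∈ Icc u' v', wronskian j f (Icc a b) t ≠ 0 := by
    intro j h1 h2 t ht
    refine abs_pos.1 (lt_of_lt_of_le ?_ (hlev j h1 h2 t (hsub' ht)).1)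
    have := hlam j
    positivity
  have := hcmp u' v' f huv' (fun k hk => (hf k hk).mono hsubab) (fun j hj x hx y hy => by
      rcases Nat.eq_zero_or_pos j with rfl | hj1
      · simp [wronskian, mixedDet]
      rw [heq j hj hx, heq j hj hy]
      have hpos := div_pos_of_ne_zero ((hW j hj1 hj).continuousOn.mono hsubab) (hne j hj1 hj) hx hy
      refine ⟨hpos, ?_⟩
      rw [← abs_of_pos hpos, abs_div, div_le_iff₀ (abs_pos.2 (hne j hj1 hj y hy))]
      have h1 := (hlev j hj1 hj x (hsub' hx)).2
      have h2 := (hlev j hj1 hj y (hsub' hy)).1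
      linarith) (fun j hj1 hj => by
      refine SlowOn.congr ?_ (heq j hj)
      refine ⟨(hW j hj1 hj).mono hsubab, hne j hj1 hj, fun i hi1 hi t ht => ?_⟩
      rw [iteratedDerivWithin_Icc_subset huv' hsubab (hW j hj1 hj) hi ht, hlen, div_pow]
      have h1 := hder j hj1 hj i hi t (hsub' ht)
      have h2 := (hlev j hj1 hj t (hsub' ht)).1
      have h3 : (R : ℝ) ≤ R ^ i := le_self_pow₀ hR1 (by omega)
      have hε : 0 ≤ ε := by
        by_contra hcon
        push Not at hcon
        nlinarith
      have hl := hlam j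
      calc _ = |iteratedDerivWithin i (wronskian j f (Icc a b)) (Icc a b) t| * (v - u) ^ i / R ^ i := by
            ring
        _ ≤ Q * lam j / R := by
            have h0 : 0 ≤ Q * lam j := by positivity
            gcongr
        _ ≤ ε * (3 / 8 * lam j) := by
            rw [div_le_iff₀ hRpos]
            nlinarith
        _ ≤ _ := by gcongr) s hs t ht
  rwa [heq d le_rfl ht, mixedDet_subset huv' hsubab hf le_rfl hs] at this

/-! ### Coordinates of a curve -/

theorem iteratedDerivWithin_apply {d n : ℕ} {a b : ℝ} (hab : a < b) {γ : ℝ → Fin d → ℝ}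
    (hγ : ContDiffOn ℝ n γ (Icc a b)) (i : Fin d) {k : ℕ} (hk : k ≤ n) :
    EqOn (iteratedDerivWithin k (fun t => γ t i) (Icc a b))
      (fun t => iteratedDerivWithin k γ (Icc a b) t i) (Icc a b) := by
  induction k with
  | zero => intro t _; simp
  | succ k ih =>
    intro t ht
    rw [iteratedDerivWithin_succ, derivWithin_congr (ih (by omega)) (ih (by omega) ht)]
    exact (hasDerivWithinAt_pi.1 (isJet_iteratedDerivWithin hab hγ k (by omega) t ht) i).derivWithin
      (uniqueDiffOn_Icc hab t ht)

/-- The components of the tangent vector, in the order given by `π`. -/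
noncomputable def tangentCoord {d : ℕ} (γ : ℝ → Fin d → ℝ) (S : Set ℝ) (π : ℕ → Fin d) (k : ℕ) :
    ℝ → ℝ :=
  derivWithin (fun t => γ t (π k)) S

theorem iteratedDerivWithin_tangentCoord {d n : ℕ} {a b : ℝ} (hab : a < b) {γ : ℝ → Fin d → ℝ}
    (hγ : ContDiffOn ℝ n γ (Icc a b)) (π : ℕ → Fin d) (j : ℕ) {k : ℕ} (hk : k < n) {t : ℝ}
    (ht : t ∈ Icc a b) :
    iteratedDerivWithin k (tangentCoord γ (Icc a b) π j) (Icc a b) t =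
      iteratedDerivWithin (k + 1) γ (Icc a b) t (π j) := by
  rw [tangentCoord, ← iteratedDerivWithin_succ']
  exact iteratedDerivWithin_apply hab hγ (π j) hk ht

/-- Reordering coordinates permutes columns, at the cost of a sign that is the same for all points.
-/
theorem exists_sign_mixedDet {d : ℕ} {a b : ℝ} (hab : a < b) {γ : ℝ → Fin d → ℝ}
    (hγ : ContDiffOn ℝ d γ (Icc a b)) {π : ℕ → Fin d} (hπ : Function.Injective fun k : Fin d => π k) :
    ∃ σ : ℝ, |σ| = 1 ∧ ∀ s : ℕ → ℝ, (∀ k, s k ∈ Icc a b) →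
      mixedDet d (tangentCoord γ (Icc a b) π) (Icc a b) s =
        σ * (Matrix.of fun k : Fin d => iteratedDerivWithin (k + 1) γ (Icc a b) (s k)).det := by
  let E : Equiv.Perm (Fin d) := Equiv.ofBijective _ (Finite.injective_iff_bijective.1 hπ)
  refine ⟨((Equiv.Perm.sign E : ℤ) : ℝ), ?_, fun s hs => ?_⟩
  · rcases Int.units_eq_one_or (Equiv.Perm.sign E) with h | h <;> simp [h]
  · rw [← Matrix.det_permute', mixedDet]
    congr 1
    ext i j
    exact iteratedDerivWithin_tangentCoord hab hγ π j i.2 (hs i)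

theorem torsion_eq_abs_det {d : ℕ} (γ : ℝ → Fin d → ℝ) (S : Set ℝ) (t : ℝ) :
    torsion γ S t = |(Matrix.of fun k : Fin d => iteratedDerivWithin (k + 1) γ S t).det| := by
  rw [torsion, ← Matrix.det_transpose]
  rfl

theorem IsClassCN.holderClass {d : ℕ} {N a b : ℝ} (hN : 0 ≤ N) (hab : a < b) {γ : ℝ → Fin d → ℝ}
    (hγ : IsClassCN N γ (Icc a b)) (i : Fin d) :
    HolderClass ⌊N⌋₊ (N - ⌊N⌋₊) (Icc a b) fun t => γ t i := by
  obtain ⟨h1, K, h2⟩ := hγ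
  have hα : 0 ≤ N - ⌊N⌋₊ := sub_nonneg.2 (Nat.floor_le hN)
  refine ⟨contDiffOn_pi.1 h1 i, K, K.2, fun x hx y hy => ?_⟩
  rw [iteratedDerivWithin_apply hab h1 i le_rfl hx, iteratedDerivWithin_apply hab h1 i le_rfl hy]
  have h3 := h2.dist_le hx hy
  rw [Real.coe_toNNReal _ hα, Real.dist_eq] at h3
  exact (dist_le_pi_dist _ _ i).trans h3

/-- The Wronskian of order `j` involves derivatives of `γ` up to order `j` only. -/
theorem HolderClass.wronskian_tangentCoord {d n j : ℕ} {α a b : ℝ} (hα : 0 ≤ α) (hα1 : α ≤ 1)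
    (hab : a < b) {γ : ℝ → Fin d → ℝ} (hγ : ∀ i, HolderClass n α (Icc a b) fun t => γ t i)
    (π : ℕ → Fin d) (hj1 : 1 ≤ j) (hj : j ≤ n) :
    HolderClass (n - j) α (Icc a b)
      (wronskian j (tangentCoord γ (Icc a b) π) (Icc a b)) := by
  refine HolderClass.det hα hα1 hab fun p q => ?_
  have h1 : HolderClass (n - 1) α (Icc a b) (tangentCoord γ (Icc a b) π q) := by
    have := hγ (π q)
    rw [show n = n - 1 + 1 by omega, holderClass_succ_iff hab] at this
    exact this.2
  rw [show n - 1 = (n - 1 - p) + p by omega] at h1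
  exact (h1.of_iteratedDeriv hab).of_le hα hα1 hab (by omega)

end TorsionDecomp

namespace TorsionDecomp

open Set

/-! ### The decomposition -/

theorem exists_level {x : ℝ} (hx : 0 < x) :
    ∃ i : ℤ, (2 : ℝ) ^ (-i) / 2 ≤ x ∧ x ≤ (2 : ℝ) ^ (-i) := by
  obtain ⟨n, h1, h2⟩ := exists_mem_Ioc_zpow hx (one_lt_two : (1 : ℝ) < 2)
  refine ⟨-(n + 1), ?_, by simpa using h2⟩
  rw [neg_neg, zpow_add_one₀ two_ne_zero, mul_div_cancel_right₀ _ two_ne_zero]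
  exact h1.le

/-- The points where the torsion is of size `2 ^ (-k)`. -/
def torsionLevel {d : ℕ} (γ : ℝ → Fin d → ℝ) (a b : ℝ) (k : ℤ) : Set ℝ :=
  {t ∈ Icc a b | (2 : ℝ) ^ (-k) / 2 ≤ torsion γ (Icc a b) t ∧ torsion γ (Icc a b) t ≤ 2 ^ (-k)}

/-- The property of the intervals of the decomposition. -/
def GoodInterval {d : ℕ} (γ : ℝ → Fin d → ℝ) (a b c C : ℝ) (lo hi : ℝ) : Prop :=
  Icc lo hi ⊆ Icc a b ∧
    MixedBound (fun k => iteratedDerivWithin (k + 1) γ (Icc a b)) (Icc lo hi) c C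

/-- A piece of a level interval for all Wronskians that meets the torsion level is good. -/
theorem goodInterval_of_piece {d : ℕ} (hd : 1 ≤ d) {ε c C : ℝ} (hc : 0 < c)
    (hcmp : MixedComparable d 4 ε c C) {a b : ℝ} (hab : a < b) {γ : ℝ → Fin d → ℝ}
    (hγ : ContDiffOn ℝ d γ (Icc a b)) {π : ℕ → Fin d}
    (hW : ∀ j, 1 ≤ j → j ≤ d → ContDiffOn ℝ (d - j : ℕ)
      (wronskian j (tangentCoord γ (Icc a b) π) (Icc a b)) (Icc a b))
    {lam : ℕ → ℝ} (hlam : ∀ j, 0 < lam j) {Q : ℝ} (hQ : 0 ≤ Q) {R : ℕ} (hR0 : 0 < R)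
    (hR : Q * (8 / 3) ≤ ε * R) {u v : ℝ} (huv : u < v) (hsub : Icc u v ⊆ Icc a b)
    (hlev : ∀ j, 1 ≤ j → j ≤ d → ∀ s ∈ Icc u v,
      3 / 8 * lam j ≤ |wronskian j (tangentCoord γ (Icc a b) π) (Icc a b) s| ∧
      |wronskian j (tangentCoord γ (Icc a b) π) (Icc a b) s| ≤ 3 / 2 * lam j)
    (hder : ∀ j, 1 ≤ j → j ≤ d → ∀ i ≤ d - j, ∀ s ∈ Icc u v,
      |iteratedDerivWithin i (wronskian j (tangentCoord γ (Icc a b) π) (Icc a b)) (Icc a b) s| *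
        (v - u) ^ i ≤ Q * lam j)
    {k : ℤ} (hmeet : ∃ t ∈ Icc u v, t ∈ torsionLevel γ a b k ∧
      lam d / 2 ≤ |wronskian d (tangentCoord γ (Icc a b) π) (Icc a b) t| ∧
      |wronskian d (tangentCoord γ (Icc a b) π) (Icc a b) t| ≤ lam d)
    {u' v' : ℝ} (hsub' : Icc u' v' ⊆ Icc u v) (hlen : v' - u' = (v - u) / R) :
    GoodInterval γ a b (3 / 16 * c * 2 ^ (-k)) (3 * C * 2 ^ (-k)) u' v' := by
  have hsubab : Icc u' v' ⊆ Icc a b := hsub'.trans hsub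
  refine ⟨hsubab, ?_⟩
  set f := tangentCoord γ (Icc a b) π with hf
  set δ : ℝ := 2 ^ (-k) with hδ
  have hδ0 : 0 < δ := by positivity
  obtain ⟨t, ht, ⟨htI, ht1, ht2⟩, ht3, ht4⟩ := hmeet
  have hld := hlam d
  -- A repeated coordinate would make two columns equal and the last Wronskian zero.
  have hπ : Function.Injective fun k : Fin d => π k := by
    intro p q hpq
    by_contra hne
    have h0 : wronskian d f (Icc a b) t = 0 := by
      refine Matrix.det_zero_of_column_eq hne fun i => ?_
      have : π p = π q := hpq
      simp [hf, tangentCoord, this]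
    rw [h0, abs_zero] at ht3
    linarith
  obtain ⟨σ, hσ, hdet⟩ := exists_sign_mixedDet hab hγ hπ
  have hτ : |wronskian d f (Icc a b) t| = torsion γ (Icc a b) t := by
    rw [wronskian, hdet _ fun _ => htI, abs_mul, hσ, one_mul, torsion_eq_abs_det]
  rw [hτ] at ht3 ht4
  have hw : u' ≤ v' := by
    have : 0 ≤ (v - u) / R := div_nonneg (by linarith) (by positivity)
    linarith
  have hu' : u' ∈ Icc u' v' := left_mem_Icc.2 hw
  set x := wronskian d f (Icc a b) u' with hx
  have hxlev := hlev d hd le_rfl u' (hsub' hu')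
  -- At `t` the torsion lies both in `[δ / 2, δ]` and in `[lam d / 2, lam d]`, hence `δ / 2 ≤ lam d
  -- ≤ 2 δ`; the factors `3 / 8` and `3 / 2` carry this over to `u'`.
  have hx1 : 3 / 16 * δ ≤ |x| := by linarith [hxlev.1]
  have hx2 : |x| ≤ 3 * δ := by linarith [hxlev.2]
  have hx0 : 0 < |x| := by linarith
  have hfs : ∀ k < d, ContDiffOn ℝ (d - 1 : ℕ) (f k) (Icc a b) := fun k _ => by
    refine ContDiffOn.derivWithin (contDiffOn_pi.1 hγ (π k)) (uniqueDiffOn_Icc hab) ?_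
    exact_mod_cast (by omega : d - 1 + 1 ≤ d)
  refine ⟨σ * (|x| / x), ?_, fun s hs => ?_⟩
  · rw [abs_mul, hσ, one_mul, abs_div, abs_abs, div_self hx0.ne']
  let s' : ℕ → ℝ := fun k => if h : k < d then s ⟨k, h⟩ else u'
  have hs' : ∀ k, s' k ∈ Icc u' v' := fun k => by
    simp only [s']
    split_ifs
    · exact hs _
    · exact hu'
  have h1 := hcmp.on_piece hfs hW hlam hQ hR0 hR huv hsub hlev hder hsub' hlen hs' hu'
  rw [← hx, hdet s' fun k => hsubab (hs' k)] at h1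
  have e : (Matrix.of fun k : Fin d => iteratedDerivWithin (k + 1) γ (Icc a b) (s' k)) =
      Matrix.of fun k : Fin d => iteratedDerivWithin (k + 1) γ (Icc a b) (s k) := by
    ext i j
    simp [s']
  rw [e] at h1
  set D := (Matrix.of fun k : Fin d => iteratedDerivWithin (k + 1) γ (Icc a b) (s k)).det
  have e2 : σ * (|x| / x) * D = |x| * (σ * D / x) := by ring
  rw [e2]
  constructor
  · calc 3 / 16 * c * δ = (3 / 16 * δ) * c := by ring
      _ ≤ |x| * (σ * D / x) := mul_le_mul hx1 h1.1 hc.le hx0.le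
  · calc |x| * (σ * D / x) ≤ (3 * δ) * C :=
          mul_le_mul hx2 h1.2 (hc.le.trans h1.1) (by positivity)
      _ = _ := by ring

/-- At a point with torsion at least `y`, the coordinates can be ordered so that all leading
Wronskians are bounded below by a multiple of `y`. -/
theorem exists_order_wronskian {d : ℕ} [NeZero d] {a b A t : ℝ} (hab : a < b)
    {γ : ℝ → Fin d → ℝ} (hγ : ContDiffOn ℝ d γ (Icc a b)) (hA : 1 ≤ A)
    (hbd : ∀ k < d, ∀ i, |iteratedDerivWithin (k + 1) γ (Icc a b) t i| ≤ A) (ht : t ∈ Icc a b) :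
    ∃ π : Fin d → Fin d, ∀ j ≤ d, torsion γ (Icc a b) t ≤ (d * A + 1) ^ d *
      |wronskian j (tangentCoord γ (Icc a b) fun k => π (Fin.ofNat d k)) (Icc a b) t| := by
  obtain ⟨π, -, h⟩ := exists_column_order A hA
    (fun k i => if k < d then iteratedDerivWithin (k + 1) γ (Icc a b) t i else 0)
    (fun k i => by
      split_ifs with h
      · exact hbd k h i
      · simpa using by linarith) d id
  refine ⟨π, fun j hj => ?_⟩
  have h1 := h j hj
  have e1 : (Matrix.of fun k i : Fin d => if (k : ℕ) < d then
      iteratedDerivWithin (k + 1) γ (Icc a b) t (id i) else 0) =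
      Matrix.of fun k : Fin d => iteratedDerivWithin (k + 1) γ (Icc a b) t := by
    ext k i
    simp
  rw [e1, ← torsion_eq_abs_det] at h1
  refine h1.trans_eq ?_
  congr 2
  rw [wronskian, mixedDet]
  congr 1
  ext p q
  have hp : (p : ℕ) < d := p.2.trans_le hj
  have hq : Fin.ofNat d (q : ℕ) = Fin.castLE hj q := by
    ext; simp [Nat.mod_eq_of_lt (q.2.trans_le hj)]
  simp only [Matrix.of_apply, if_pos hp, id]
  rw [iteratedDerivWithin_tangentCoord hab hγ _ _ hp ht, hq]

theorem exists_deriv_bound {d : ℕ} {a b : ℝ} (hab : a < b) {γ : ℝ → Fin d → ℝ}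
    (hγ : ContDiffOn ℝ d γ (Icc a b)) :
    ∃ A : ℝ, 1 ≤ A ∧ ∀ k < d, ∀ t ∈ Icc a b, ∀ i,
      |iteratedDerivWithin (k + 1) γ (Icc a b) t i| ≤ A := by
  have h : ∀ k : Fin d, ∃ A : ℝ, ∀ t ∈ Icc a b, ‖iteratedDerivWithin (k + 1) γ (Icc a b) t‖ ≤ A :=
    fun k => isCompact_Icc.exists_bound_of_continuousOn
      (hγ.continuousOn_iteratedDerivWithin (by exact_mod_cast (by omega : (k : ℕ) + 1 ≤ d))
        (uniqueDiffOn_Icc hab))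
  choose A hA using h
  refine ⟨1 + ∑ k, |A k|, by
    have : 0 ≤ ∑ k, |A k| := Finset.sum_nonneg fun _ _ => abs_nonneg _
    linarith, fun k hk t ht i => ?_⟩
  have h1 := (norm_le_pi_norm (iteratedDerivWithin (k + 1) γ (Icc a b) t) i).trans
    (hA ⟨k, hk⟩ t ht)
  have h2 := Finset.single_le_sum (f := fun k => |A k|) (fun _ _ => abs_nonneg _)
    (Finset.mem_univ (⟨k, hk⟩ : Fin d))
  rw [Real.norm_eq_abs] at h1
  linarith [le_abs_self (A ⟨k, hk⟩)]

theorem exists_torsion_bound {d : ℕ} {a b : ℝ} (hab : a < b) {γ : ℝ → Fin d → ℝ}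
    (hγ : ContDiffOn ℝ d γ (Icc a b)) :
    ∃ T : ℝ, ∀ t ∈ Icc a b, torsion γ (Icc a b) t ≤ T := by
  have hc : ContinuousOn (fun t => (Matrix.of fun i j : Fin d =>
      iteratedDerivWithin (j + 1) γ (Icc a b) t i).det) (Icc a b) := by
    simp only [Matrix.det_apply']
    refine continuousOn_finsetSum _ fun σ _ => continuousOn_const.mul
      (continuousOn_finsetProd _ fun i _ => ?_)
    exact continuousOn_pi.1 (hγ.continuousOn_iteratedDerivWithin
      (by exact_mod_cast (by omega : (i : ℕ) + 1 ≤ d)) (uniqueDiffOn_Icc hab)) _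
  obtain ⟨T, -, hT⟩ := exists_abs_le_of_continuousOn hc
  exact ⟨T, hT⟩

set_option maxHeartbeats 2000000 in
/-- The torsion levels are covered by a controlled number of good intervals. -/
theorem exists_cover_torsionLevel {d : ℕ} (hd : 1 ≤ d) {ε c C : ℝ} (hε : 0 < ε) (hc : 0 < c)
    (hcmp : MixedComparable d 4 ε c C) {a b : ℝ} (hab : a < b)
    {γ : ℝ → Fin d → ℝ} {N : ℝ} (hN : (d : ℝ) < N) (hγN : IsClassCN N γ (Icc a b))
    {k₀ : ℤ} (hk₀ : k₀ ≤ 0) :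
    ∃ K : ℝ, 0 < K ∧ ∀ k : ℤ, k₀ ≤ k →
      HasCover (GoodInterval γ a b (3 / 16 * c * 2 ^ (-k)) (3 * C * 2 ^ (-k)))
        (torsionLevel γ a b k)
        (K * ((k : ℝ) + (1 - k₀)) ^ d *
          (2 : ℝ) ^ ((k : ℝ) * ∑ j ∈ Finset.Icc 1 d, 1 / (N - (j : ℝ))))
        (K * ((k : ℝ) + (1 - k₀)) ^ d) := by
  classical
  have : NeZero d := ⟨by omega⟩
  have hN0 : 0 ≤ N := (Nat.cast_nonneg d).trans hN.le
  set n : ℕ := ⌊N⌋₊ with hn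
  set α : ℝ := N - n with hα
  have hα0 : 0 ≤ α := sub_nonneg.2 (Nat.floor_le hN0)
  have hα1 : α ≤ 1 := by have := Nat.lt_floor_add_one N; simp only [hα, hn]; linarith
  have hdn : d ≤ n := Nat.le_floor hN.le
  have hγ : ContDiffOn ℝ d γ (Icc a b) := hγN.1.of_le (by exact_mod_cast hdn)
  have hcls : ∀ i, HolderClass n α (Icc a b) fun t => γ t i := IsClassCN.holderClass hN0 hab hγN
  obtain ⟨A, hA1, hA⟩ := exists_deriv_bound hab hγ
  let W : (Fin d → Fin d) → ℕ → ℝ → ℝ := fun π j =>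
    wronskian j (tangentCoord γ (Icc a b) fun k => π (Fin.ofNat d k)) (Icc a b)
  have hWcls : ∀ π j, 1 ≤ j → j ≤ d → HolderClass (n - j) α (Icc a b) (W π j) :=
    fun π j h1 h2 => HolderClass.wronskian_tangentCoord hα0 hα1 hab hcls _ h1 (by omega)
  have hβ : ∀ j ≤ d, ((n - j : ℕ) : ℝ) + α = N - j := fun j hj => by
    rw [Nat.cast_sub (by omega), hα]; ring
  have hβpos : ∀ j ≤ d, 0 < N - (j : ℝ) := fun j hj => by
    have : (j : ℝ) ≤ d := by exact_mod_cast hj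
    linarith
  -- uniform bounds for the Wronskians
  have hWb : ∀ (π : Fin d → Fin d) (j : ℕ), ∃ B : ℝ, 0 ≤ B ∧
      (1 ≤ j → j ≤ d → ∀ t ∈ Icc a b, |W π j t| ≤ B) := by
    intro π j
    by_cases hj : 1 ≤ j ∧ j ≤ d
    · obtain ⟨B, h1, h2⟩ := exists_abs_le_of_continuousOn (hWcls π j hj.1 hj.2).1.continuousOn
      exact ⟨B, h1, fun _ _ => h2⟩
    · exact ⟨0, le_rfl, fun h1 h2 => absurd ⟨h1, h2⟩ hj⟩
  choose B hB0 hB using hWb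
  set Bt : ℝ := ∑ π, ∑ j ∈ Finset.Icc 1 d, B π j with hBt
  have le_total : ∀ F : (Fin d → Fin d) → ℕ → ℝ, (∀ π j, 0 ≤ F π j) → ∀ π,
      ∑ j ∈ Finset.Icc 1 d, F π j ≤ ∑ π, ∑ j ∈ Finset.Icc 1 d, F π j := fun F hF π =>
    Finset.single_le_sum (f := fun π => ∑ j ∈ Finset.Icc 1 d, F π j)
      (fun π _ => Finset.sum_nonneg fun j _ => hF π j) (Finset.mem_univ π)
  have le_total' : ∀ F : (Fin d → Fin d) → ℕ → ℝ, (∀ π j, 0 ≤ F π j) → ∀ π j, 1 ≤ j → j ≤ d →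
      F π j ≤ ∑ π, ∑ j ∈ Finset.Icc 1 d, F π j := fun F hF π j h1 h2 =>
    (Finset.single_le_sum (f := fun j => F π j) (fun j _ => hF π j)
      (Finset.mem_Icc.2 ⟨h1, h2⟩)).trans (le_total F hF π)
  set Kd : ℝ := (d * A + 1) ^ d with hKd
  have hKd0 : 0 < Kd := by positivity
  -- `2 ^ r` exceeds both the Wronskians and the loss from ordering the coordinates. On the torsion
  -- level `k`, the exponents `i` with `|W π j|` about `2 ^ (-i)` then range from `-r` to `k + r`.
  obtain ⟨r, hr⟩ := pow_unbounded_of_one_lt (max (2 * Kd) (Bt + 1)) (one_lt_two : (1 : ℝ) < 2)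
  have hrK : 2 * Kd ≤ 2 ^ r := (le_max_left _ _).trans hr.le
  have hrB : Bt < 2 ^ r := by linarith [le_max_right (2 * Kd) (Bt + 1)]
  -- breakpoints
  have hbp : ∀ (π : Fin d → Fin d) (j : ℕ), ∃ K Q : ℝ, 0 < K ∧ 0 < Q ∧ (1 ≤ j → j ≤ d →
      ∀ lam : ℝ, 0 < lam → lam ≤ 2 ^ r → ∃ Z : Finset ℝ,
      (∀ z ∈ Z, z ∈ Icc a b) ∧ (Z.card : ℝ) ≤ K * lam ^ (-(1 / (N - (j : ℝ)))) ∧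
      ∀ u v : ℝ, u < v → Icc u v ⊆ Icc a b → (∀ z ∈ Z, z ∉ Ioo u v) →
        (∃ t ∈ Icc u v, lam / 2 ≤ |W π j t| ∧ |W π j t| ≤ lam) →
        (∀ s ∈ Icc u v, 3 / 8 * lam ≤ |W π j s| ∧ |W π j s| ≤ 3 / 2 * lam) ∧
        ∀ i ≤ n - j, ∀ s ∈ Icc u v,
          |iteratedDerivWithin i (W π j) (Icc a b) s| * (v - u) ^ i ≤ Q * lam) := by
    intro π j
    by_cases hj : 1 ≤ j ∧ j ≤ d
    · obtain ⟨K, Q, hK, hQ, h⟩ := (hWcls π j hj.1 hj.2).exists_breakpoints hα0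
        (by rw [hβ j hj.2]; exact hβpos j hj.2) hab (Λ := 2 ^ r) (by positivity)
      rw [hβ j hj.2] at h
      exact ⟨K, Q, hK, hQ, fun _ _ => h⟩
    · exact ⟨1, 1, one_pos, one_pos, fun h1 h2 => absurd ⟨h1, h2⟩ hj⟩
  choose K Q hK0 hQ0 hbp using hbp
  set Kt : ℝ := ∑ π, ∑ j ∈ Finset.Icc 1 d, K π j with hKt
  set Qt : ℝ := ∑ π, ∑ j ∈ Finset.Icc 1 d, Q π j with hQt
  have hQt0 : 0 ≤ Qt := Finset.sum_nonneg fun π _ => Finset.sum_nonneg fun j _ => (hQ0 π j).le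
  have hKt0 : 0 ≤ Kt := Finset.sum_nonneg fun π _ => Finset.sum_nonneg fun j _ => (hK0 π j).le
  obtain ⟨R, hR0, hR⟩ : ∃ R : ℕ, 0 < R ∧ Qt * (8 / 3) ≤ ε * R := by
    obtain ⟨R, hR⟩ := exists_nat_gt (Qt * (8 / 3) / ε)
    refine ⟨R, ?_, ?_⟩
    · have : (0 : ℝ) < R := lt_of_le_of_lt (by positivity) hR
      exact_mod_cast this
    · rw [div_lt_iff₀ hε] at hR
      linarith
  set Ss : ℝ := ∑ j ∈ Finset.Icc 1 d, 1 / (N - (j : ℝ)) with hSs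
  have hSj : ∀ j, 1 ≤ j → j ≤ d → 1 / (N - (j : ℝ)) ≤ Ss := fun j h1 h2 =>
    Finset.single_le_sum (f := fun j : ℕ => 1 / (N - (j : ℝ)))
      (fun j hj => (one_div_pos.2 (hβpos j (Finset.mem_Icc.1 hj).2)).le) (Finset.mem_Icc.2 ⟨h1, h2⟩)
  have hSs0 : 0 ≤ Ss := Finset.sum_nonneg fun j hj =>
    (one_div_pos.2 (hβpos j (Finset.mem_Icc.1 hj).2)).le
  -- As `k` may be negative, `1 / (N - j) ≤ Ss` is applied to the nonnegative numbers `k - k₀` and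
  -- `r`; `E` pays for both shifts.
  set E : ℝ := 2 ^ (((r : ℝ) - k₀) * Ss) with hE
  have hE0 : 0 < E := by positivity
  have hk₀r : (k₀ : ℝ) ≤ 0 := by exact_mod_cast hk₀
  refine ⟨(d : ℝ) ^ d * (2 * r + 2) ^ d * ((Kt + 2) * E * R + (b - a)), by
    have : 0 < b - a := sub_pos.2 hab
    positivity, fun k hk => ?_⟩
  have hkr : (k₀ : ℝ) ≤ k := by exact_mod_cast hk
  -- levels
  set L : ℕ := (k + 2 * r + 1).toNat with hL
  let lam : (Fin d → Fin L) → ℕ → ℝ := fun lev j =>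
    (2 : ℝ) ^ ((r : ℤ) - ((lev (Fin.ofNat d (j - 1)) : ℕ) : ℤ))
  have hlam0 : ∀ lev j, 0 < lam lev j := fun lev j => by positivity
  have hlamr : ∀ lev j, lam lev j ≤ 2 ^ r := fun lev j => by
    rw [← zpow_natCast]
    exact zpow_le_zpow_right₀ (by norm_num) (by omega)
  have hlamk : ∀ lev j, (2 : ℝ) ^ (-(k : ℝ) - r) ≤ lam lev j := fun lev j => by
    have : (2 : ℝ) ^ (-(k : ℝ) - r) = (2 : ℝ) ^ (-k - (r : ℤ)) := by
      rw [← Real.rpow_intCast]; push_cast; rfl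
    rw [this]
    exact zpow_le_zpow_right₀ (by norm_num) (by omega)
  set G : ℝ := E * 2 ^ ((k : ℝ) * Ss) with hG
  have hGe : G = 2 ^ (((k : ℝ) - k₀) * Ss + r * Ss) := by
    rw [hG, hE, ← Real.rpow_add two_pos]; congr 1; ring
  have hG1 : 1 ≤ G := by
    rw [hGe]
    refine Real.one_le_rpow (by norm_num) ?_
    have : 0 ≤ (k : ℝ) - k₀ := by linarith
    positivity
  have hlamG : ∀ lev j, 1 ≤ j → j ≤ d → lam lev j ^ (-(1 / (N - (j : ℝ)))) ≤ G := by
    intro lev j h1 h2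
    have hp : 0 < 1 / (N - (j : ℝ)) := one_div_pos.2 (hβpos j h2)
    calc lam lev j ^ (-(1 / (N - (j : ℝ)))) ≤ (2 ^ (-(k : ℝ) - r)) ^ (-(1 / (N - (j : ℝ)))) :=
          Real.rpow_le_rpow_of_nonpos (by positivity) (hlamk lev j) (by linarith)
      _ = 2 ^ (((k : ℝ) + r) * (1 / (N - (j : ℝ)))) := by
          rw [← Real.rpow_mul two_pos.le]; congr 1; ring
      _ ≤ G := by
          rw [hGe]
          refine Real.rpow_le_rpow_of_exponent_le (by norm_num) ?_
          have e : ((k : ℝ) + r) * (1 / (N - (j : ℝ))) = (k - k₀) * (1 / (N - (j : ℝ))) +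
            r * (1 / (N - (j : ℝ))) + k₀ * (1 / (N - (j : ℝ))) := by ring
          have h3 : ((k : ℝ) - k₀) * (1 / (N - (j : ℝ))) ≤ (k - k₀) * Ss :=
            mul_le_mul_of_nonneg_left (hSj j h1 h2) (by linarith)
          have h4 : (r : ℝ) * (1 / (N - (j : ℝ))) ≤ r * Ss :=
            mul_le_mul_of_nonneg_left (hSj j h1 h2) (by positivity)
          have h5 : (k₀ : ℝ) * (1 / (N - (j : ℝ))) ≤ 0 :=
            mul_nonpos_of_nonpos_of_nonneg hk₀r hp.le
          rw [e]; linarith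
  let S : (Fin d → Fin d) × (Fin d → Fin L) → Set ℝ := fun x =>
    {t | t ∈ torsionLevel γ a b k ∧ ∀ j, 1 ≤ j → j ≤ d →
      lam x.2 j / 2 ≤ |W x.1 j t| ∧ |W x.1 j t| ≤ lam x.2 j}
  have hcovS : ∀ x, HasCover (GoodInterval γ a b (3 / 16 * c * 2 ^ (-k)) (3 * C * 2 ^ (-k)))
      (S x) ((Kt + 2) * G * R) (b - a) := by
    rintro ⟨π, lev⟩
    have hZ : ∀ j : ℕ, ∃ Z : Finset ℝ, 1 ≤ j → j ≤ d →
        (∀ z ∈ Z, z ∈ Icc a b) ∧ (Z.card : ℝ) ≤ K π j * lam lev j ^ (-(1 / (N - (j : ℝ)))) ∧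
        ∀ u v : ℝ, u < v → Icc u v ⊆ Icc a b → (∀ z ∈ Z, z ∉ Ioo u v) →
          (∃ t ∈ Icc u v, lam lev j / 2 ≤ |W π j t| ∧ |W π j t| ≤ lam lev j) →
          (∀ s ∈ Icc u v, 3 / 8 * lam lev j ≤ |W π j s| ∧ |W π j s| ≤ 3 / 2 * lam lev j) ∧
          ∀ i ≤ n - j, ∀ s ∈ Icc u v,
            |iteratedDerivWithin i (W π j) (Icc a b) s| * (v - u) ^ i ≤ Q π j * lam lev j := by
      intro j
      by_cases hj : 1 ≤ j ∧ j ≤ d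
      · obtain ⟨Z, h⟩ := hbp π j hj.1 hj.2 (lam lev j) (hlam0 lev j) (hlamr lev j)
        exact ⟨Z, fun _ _ => h⟩
      · exact ⟨∅, fun h1 h2 => absurd ⟨h1, h2⟩ hj⟩
    choose Z hZ using hZ
    have hcov := hasCover_of_breakpoints
      (P := GoodInterval γ a b (3 / 16 * c * 2 ^ (-k)) (3 * C * 2 ^ (-k)))
      (S := S (π, lev)) hab (fun t ht => ht.1.1) ((Finset.Icc 1 d).biUnion Z)
      (fun z hz => by
        obtain ⟨j, hj, hz⟩ := Finset.mem_biUnion.1 hz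
        rw [Finset.mem_Icc] at hj
        exact (hZ j hj.1 hj.2).1 z hz) R hR0
      (fun u v huv hsub hno ⟨t, ht, htS⟩ u' v' hsub' hlen => by
        have key := fun j h1 h2 => (hZ j h1 h2).2.2 u v huv hsub
          (fun z hz => hno z (Finset.mem_biUnion.2 ⟨j, Finset.mem_Icc.2 ⟨h1, h2⟩, hz⟩))
          ⟨t, ht, htS.2 j h1 h2⟩
        refine goodInterval_of_piece hd hc hcmp hab hγ
          (fun j h1 h2 => (hWcls π j h1 h2).1.of_le (by exact_mod_cast (by omega : d - j ≤ n - j)))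
          (hlam0 lev) hQt0 hR0 hR huv hsub (fun j h1 h2 => (key j h1 h2).1)
          (fun j h1 h2 i hi s hs => ((key j h1 h2).2 i (by omega) s hs).trans ?_)
          ⟨t, ht, htS.1, htS.2 d hd le_rfl⟩ hsub' hlen
        have := hlam0 lev j
        gcongr
        exact le_total' Q (fun π j => (hQ0 π j).le) π j h1 h2)
    refine hcov.mono subset_rfl ?_ le_rfl
    gcongr
    -- Uniting the breakpoints of all Wronskians adds their numbers; the two end points are absorbed
    -- because `1 ≤ G`.
    have h1 : (((Finset.Icc 1 d).biUnion Z).card : ℝ) ≤ Kt * G := by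
      calc (((Finset.Icc 1 d).biUnion Z).card : ℝ) ≤ ∑ j ∈ Finset.Icc 1 d, ((Z j).card : ℝ) := by
            exact_mod_cast Finset.card_biUnion_le
        _ ≤ ∑ j ∈ Finset.Icc 1 d, K π j * G := Finset.sum_le_sum fun j hj => by
            rw [Finset.mem_Icc] at hj
            refine (hZ j hj.1 hj.2).2.1.trans ?_
            have := (hK0 π j).le
            gcongr
            exact hlamG lev j hj.1 hj.2
        _ = (∑ j ∈ Finset.Icc 1 d, K π j) * G := by rw [Finset.sum_mul]
        _ ≤ Kt * G := by
            gcongr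
            exact le_total K (fun π j => (hK0 π j).le) π
    nlinarith
  have hcov := hasCover_iUnion hcovS
  -- the number of levels
  set y : ℝ := (k : ℝ) + (1 - k₀) with hy
  have hy1 : 1 ≤ y := by simp only [hy]; linarith
  have hLy : (L : ℝ) ≤ (2 * r + 2) * y := by
    have hr0 : (0 : ℝ) ≤ r := by positivity
    rcases le_or_gt 0 (k + 2 * r + 1) with h | h
    · have : (L : ℤ) = k + 2 * r + 1 := Int.toNat_of_nonneg h
      have h2 : (L : ℝ) = k + 2 * r + 1 := by exact_mod_cast this
      rw [h2]
      have h3 : (k : ℝ) + 1 ≤ y := by simp only [hy]; linarith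
      nlinarith
    · have : L = 0 := Int.toNat_of_nonpos h.le
      rw [this]
      push_cast
      positivity
  have hcard : (Fintype.card ((Fin d → Fin d) × (Fin d → Fin L)) : ℝ) ≤
      (d : ℝ) ^ d * (2 * r + 2) ^ d * y ^ d := by
    simp only [Fintype.card_prod, Fintype.card_fun, Fintype.card_fin]
    push_cast
    rw [mul_assoc, ← mul_pow (2 * (r : ℝ) + 2)]
    gcongr
  have hba : 0 < b - a := sub_pos.2 hab
  refine hcov.mono ?_ ?_ ?_
  · intro t ht
    obtain ⟨htI, ht1, ht2⟩ := ht
    obtain ⟨π, hπ⟩ := exists_order_wronskian hab hγ hA1 (fun k hk i => hA k hk t htI i) htI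
    have hlow : ∀ j, 1 ≤ j → j ≤ d → (2 : ℝ) ^ (-k) / 2 ≤ Kd * |W π j t| := fun j h1 h2 =>
      ht1.trans (hπ j h2)
    have hδ : (0 : ℝ) < 2 ^ (-k) / 2 := by positivity
    have hpos : ∀ j, 1 ≤ j → j ≤ d → 0 < |W π j t| := fun j h1 h2 => by
      have := hlow j h1 h2
      by_contra hcon
      push Not at hcon
      nlinarith
    have hlv : ∀ j, 1 ≤ j → j ≤ d → ∃ i : ℕ, i < L ∧
        (2 : ℝ) ^ ((r : ℤ) - (i : ℤ)) / 2 ≤ |W π j t| ∧ |W π j t| ≤ 2 ^ ((r : ℤ) - (i : ℤ)) := by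
      intro j h1 h2
      obtain ⟨i, hi1, hi2⟩ := exists_level (hpos j h1 h2)
      have hlo : -(r : ℤ) ≤ i := by
        by_contra hcon
        push Not at hcon
        have h3 : (2 : ℝ) ^ ((r : ℤ) + 1) ≤ 2 ^ (-i) :=
          zpow_le_zpow_right₀ (by norm_num) (by omega)
        rw [zpow_add_one₀ two_ne_zero, zpow_natCast] at h3
        have h4 := (hB π j h1 h2 t htI).trans (le_total' B hB0 π j h1 h2)
        linarith
      -- A larger `i` would give `Kd * |W π j t| < 2 ^ (-k) / 2`, because `2 * Kd ≤ 2 ^ r`.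
      have hhi : i ≤ k + r := by
        by_contra hcon
        push Not at hcon
        have h3 : (2 : ℝ) ^ (-i) ≤ 2 ^ (-k - r - 1) :=
          zpow_le_zpow_right₀ (by norm_num) (by omega)
        have h5 : (2 : ℝ) ^ (-k - (r : ℤ) - 1) * 2 ^ r * 2 = 2 ^ (-k) := by
          rw [← zpow_natCast, ← zpow_add₀ two_ne_zero, ← zpow_add_one₀ two_ne_zero]
          congr 1; ring
        have h6 := hlow j h1 h2
        have h7 : (0 : ℝ) < 2 ^ (-k - (r : ℤ) - 1) := by positivity
        have h8 : Kd * |W π j t| ≤ Kd * 2 ^ (-k - (r : ℤ) - 1) := by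
          gcongr; exact hi2.trans h3
        have h9 := mul_le_mul_of_nonneg_right hrK h7.le
        have h10 : 0 < Kd * 2 ^ (-k - (r : ℤ) - 1) := by positivity
        nlinarith
      refine ⟨(i + r).toNat, by omega, ?_⟩
      have : (r : ℤ) - (((i + r).toNat : ℕ) : ℤ) = -i := by omega
      rw [this]
      exact ⟨hi1, hi2⟩
    choose! lv hlvL hlv using hlv
    refine mem_iUnion.2 ⟨(π, fun q : Fin d => ⟨lv (q + 1), hlvL _ (by omega) (by omega)⟩),
      ⟨htI, ht1, ht2⟩, fun j h1 h2 => ?_⟩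
    have : ((Fin.ofNat d (j - 1) : Fin d) : ℕ) + 1 = j := by
      simp only [Fin.val_ofNat, Nat.mod_eq_of_lt (show j - 1 < d by omega)]
      omega
    simp only [lam, this]
    exact hlv j h1 h2
  · calc _ ≤ (d : ℝ) ^ d * (2 * r + 2) ^ d * y ^ d * ((Kt + 2) * G * R) := by
          gcongr
      _ = (d : ℝ) ^ d * (2 * r + 2) ^ d * ((Kt + 2) * E * R) * y ^ d * 2 ^ ((k : ℝ) * Ss) := by
          rw [hG]; ring
      _ ≤ _ := by
          gcongr
          linarith
  · calc _ ≤ (d : ℝ) ^ d * (2 * r + 2) ^ d * y ^ d * (b - a) := by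
          gcongr
      _ = (d : ℝ) ^ d * (2 * r + 2) ^ d * (b - a) * y ^ d := by ring
      _ ≤ _ := by
          gcongr
          have : 0 ≤ (Kt + 2) * E * R := by positivity
          linarith

end TorsionDecomp

/-! ### Proof of the theorem -/

theorem theorem2p2 (d : ℕ) (hd : 1 ≤ d) (a b : ℝ) (hab : a < b) :
    -- constants that depend on `d` and `[a, b]` only
    ∃ c C : ℝ, 0 < c ∧ 0 < C ∧
    ∀ γ : ℝ → Fin d → ℝ,
    -- constants that depend on `γ` (and `d`, `[a, b]`) but not on `N`
    ∃ (k₀ : ℤ) (Cγ : ℝ), 0 < (k₀ : ℝ) + Cγ ∧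
    ∀ N : ℝ, (d : ℝ) < N → IsClassCN N γ (Set.Icc a b) →
    ∃ (CNγ : ℝ) (n : ℤ → ℕ) (lo hi : (k : ℤ) → Fin (n k) → ℝ),
      0 < CNγ ∧
      (∀ k, k₀ ≤ k → ∀ l, lo k l ≤ hi k l) ∧
      (Set.Icc a b = {t ∈ Set.Icc a b | torsion γ (Set.Icc a b) t = 0} ∪
        ⋃ (k : ℤ) (_ : k₀ ≤ k) (l : Fin (n k)), Set.Icc (lo k l) (hi k l)) ∧
      (∀ k, k₀ ≤ k → ∀ l : Fin (n k), ∀ (m : ℕ) (h : Fin (m + 1) → ℝ), Monotone h →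
        -- the domain `[a, b]_h` of `γ_h` is an interval with more than one point
        h (Fin.last m) - h 0 < b - a →
        (∀ t ∈ shiftInterval (lo k l) (hi k l) h,
          c * (2 : ℝ) ^ (-k) ≤ torsion (offspring γ h) (shiftInterval a b h) t ∧
          torsion (offspring γ h) (shiftInterval a b h) t ≤ C * (2 : ℝ) ^ (-k)) ∧
        Set.InjOn (sumMap (offspring γ h))
          {t | StrictMono t ∧ ∀ i, t i ∈ shiftInterval (lo k l) (hi k l) h} ∧
        (∀ t : Fin d → ℝ, (∀ i, t i ∈ shiftInterval (lo k l) (hi k l) h) →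
          c * (2 : ℝ) ^ (-k) * |(Matrix.vandermonde t).det| ≤
            |jacobianSumMap (offspring γ h) (shiftInterval a b h) t|)) ∧
      (∀ k, k₀ ≤ k → (n k : ℝ) ≤
        CNγ * ((k : ℝ) + Cγ) ^ d *
          (2 : ℝ) ^ ((k : ℝ) * ∑ j ∈ Finset.Icc 1 d, 1 / (N - (j : ℝ)))) ∧
      (∀ k, k₀ ≤ k → ∑ l, (hi k l - lo k l) ≤ CNγ * ((k : ℝ) + Cγ) ^ d) := by
  classical
  obtain ⟨ε, c, C, hε, hc, hC, hcmp⟩ := TorsionDecomp.exists_mixedComparable d 4 (by norm_num)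
  set F : ℝ := ∏ k : Fin d, ((k : ℕ).factorial : ℝ) with hF
  have hF1 : 1 ≤ F := Finset.one_le_prod fun k _ => by
    exact_mod_cast Nat.succ_le_of_lt (Nat.factorial_pos _)
  have hF0 : 0 < F := by linarith
  -- `F` is the product of factorials from the Vandermonde formula; as `1 ≤ F`, the same constant
  -- serves torsion and Jacobian.
  refine ⟨3 / 16 * c / F, 3 * C, by positivity, by positivity, fun γ => ?_⟩
  have hdiff : ∀ N : ℝ, (d : ℝ) < N → IsClassCN N γ (Set.Icc a b) →
      ContDiffOn ℝ d γ (Set.Icc a b) := fun N hN hγ =>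
    hγ.1.of_le (by exact_mod_cast Nat.le_floor hN.le)
  -- Bounding the torsion needs only class `C^d`, so `r`, which fixes `k₀` and `Cγ`, is chosen
  -- before `N`. If `γ` is not of class `C^d`, no `N` is admissible and any `r` will do.
  obtain ⟨r, hr⟩ : ∃ r : ℕ, ContDiffOn ℝ d γ (Set.Icc a b) →
      ∀ t ∈ Set.Icc a b, torsion γ (Set.Icc a b) t < 2 ^ r := by
    by_cases hγ : ContDiffOn ℝ d γ (Set.Icc a b)
    · obtain ⟨T, hT⟩ := TorsionDecomp.exists_torsion_bound hab hγ
      obtain ⟨r, hr⟩ := pow_unbounded_of_one_lt T (one_lt_two : (1 : ℝ) < 2)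
      exact ⟨r, fun _ t ht => (hT t ht).trans_lt hr⟩
    · exact ⟨0, fun h => absurd h hγ⟩
  -- `Cγ = 1 - k₀` makes `k + Cγ ≥ 1` on every level.
  refine ⟨-(r : ℤ), 1 - ((-(r : ℤ) : ℤ) : ℝ), by linarith, fun N hN hγN => ?_⟩
  have hγ := hdiff N hN hγN
  obtain ⟨K, hK, hcov⟩ := TorsionDecomp.exists_cover_torsionLevel hd hε hc hcmp hab hN hγN
    (k₀ := -(r : ℤ)) (by omega)
  have hex : ∀ k : ℤ, ∃ (n : ℕ) (lo hi : Fin n → ℝ), -(r : ℤ) ≤ k →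
      (∀ l, lo l ≤ hi l ∧ TorsionDecomp.GoodInterval γ a b (3 / 16 * c * 2 ^ (-k))
        (3 * C * 2 ^ (-k)) (lo l) (hi l)) ∧
      (TorsionDecomp.torsionLevel γ a b k ⊆ ⋃ l, Set.Icc (lo l) (hi l)) ∧
      (n : ℝ) ≤ K * ((k : ℝ) + (1 - ((-(r : ℤ) : ℤ) : ℝ))) ^ d *
        (2 : ℝ) ^ ((k : ℝ) * ∑ j ∈ Finset.Icc 1 d, 1 / (N - (j : ℝ))) ∧
      ∑ l, (hi l - lo l) ≤ K * ((k : ℝ) + (1 - ((-(r : ℤ) : ℤ) : ℝ))) ^ d := by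
    intro k
    by_cases hk : -(r : ℤ) ≤ k
    · obtain ⟨n, lo, hi, h⟩ := hcov k hk
      exact ⟨n, lo, hi, fun _ => h⟩
    · exact ⟨0, fun _ => 0, fun _ => 0, fun h => absurd h hk⟩
  choose n lo hi hP using hex
  refine ⟨K, n, lo, hi, hK, fun k hk l => ((hP k hk).1 l).1, ?_, fun k hk l m h hh hlt => ?_,
    fun k hk => (hP k hk).2.2.1, fun k hk => (hP k hk).2.2.2⟩
  · refine Set.Subset.antisymm (fun t ht => ?_) (Set.union_subset (fun t ht => ht.1) ?_)
    · by_cases h0 : torsion γ (Set.Icc a b) t = 0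
      · exact Or.inl ⟨ht, h0⟩
      · right
        obtain ⟨k, h1, h2⟩ := TorsionDecomp.exists_level
          (lt_of_le_of_ne (abs_nonneg _) (Ne.symm h0) : 0 < torsion γ (Set.Icc a b) t)
        have hk : -(r : ℤ) ≤ k := by
          by_contra hcon
          push Not at hcon
          have h3 : (2 : ℝ) ^ ((r : ℤ) + 1) ≤ 2 ^ (-k) :=
            zpow_le_zpow_right₀ (by norm_num) (by omega)
          rw [zpow_add_one₀ two_ne_zero, zpow_natCast] at h3
          linarith [hr hγ t ht]
        obtain ⟨l, hl⟩ := Set.mem_iUnion.1 ((hP k hk).2.1 ⟨ht, h1, h2⟩)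
        exact Set.mem_iUnion.2 ⟨k, Set.mem_iUnion.2 ⟨hk, Set.mem_iUnion.2 ⟨l, hl⟩⟩⟩
    · exact Set.iUnion_subset fun k => Set.iUnion_subset fun hk => Set.iUnion_subset fun l =>
        ((hP k hk).1 l).2.1
  · obtain ⟨hle, hsub, hG⟩ := (hP k hk).1 l
    have hck : 0 < 3 / 16 * c * (2 : ℝ) ^ (-k) := by positivity
    obtain ⟨g1, g2, g3⟩ := TorsionDecomp.offspring_geometry hd hγ hsub hle hck hG hh hlt
    have e : 3 / 16 * c / F * (2 : ℝ) ^ (-k) = 3 / 16 * c * (2 : ℝ) ^ (-k) / F := by ring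
    refine ⟨fun t ht => ⟨?_, (g1 t ht).2⟩, g2, fun t ht => ?_⟩
    · rw [e]
      exact (div_le_self hck.le hF1).trans (g1 t ht).1
    · rw [e]
      exact g3 t ht
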